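/- **Setting.** Let $T$ be a hyperbolic automorphism of $\mathbb T^2=\mathbb R^2/\mathbb Z^2$ given by $M=M_T=\begin{pmatrix}a&b\\c&d\end{pmatrix}\in GL(2,\mathbb Z)$ (no eigenvalue of modulus $1$) with trace $r=a+d>0$. Put $\sigma=\det M$, $D=r^2-4\sigma$, $\lambda=\frac{r+\sqrt D}2>1$ and $f_T(x,y)=bx^2-(a-d)xy-cy^2$. The matrix $M$ is *primitive* if there are no $K\in GL(2,\mathbb Z)$ and $n\ge2$ with $M=K^n$; two matrices are *algebraically conjugate* if they are conjugate in $GL(2,\mathbb Z)$. The Dirichlet group is $\mathcal U_D=\{\frac{x+y\sqrt D}2: x,y\in\mathbb Z,\ x^2-Dy^2=\pm4\}$. A point $x\in\mathbb T^2$ is homoclinic if $T^nx\to0$ as $n\to\pm\infty$; its coordinates in $\mathbb R^2$ are those of its representative on the eigenline $\{v: Mv=\lambda v\}$. Let $\widetilde{\mathfrak X}$ be the additive semigroup of all two-sided sequences $\varepsilon=(\varepsilon_n)_{n\in\mathbb Z}$ of nonnegative integers such that $\sum_{n\ge1}\varepsilon_n\lambda^{-n}$ and $\sum_{n\ge1}\varepsilon_{-n}\lambda^{-n}$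 converge, with the topology of the metric $\sum_n|\varepsilon_n-\varepsilon'_n|\lambda^{-|n|}$ (on sets of sequences with uniformly bounded coordinates this is coordinatewise convergence), and let $\tau$ be the shift, $(\tau\varepsilon)_n=\varepsilon_{n+1}$. An *arithmetic coding* of $T$ is a pair $(\phi,\mathfrak X)$, where $\phi:\widetilde{\mathfrak X}\to\mathbb T^2$ is a continuous semigroup homomorphism with $\phi\tau=T\phi$, and $\mathfrak X\subset\widetilde{\mathfrak X}$ is a closed shift-invariant set such that * $\mathfrak X$ is total: if $\varepsilon\in\mathfrak X$, $N\in\mathbb Z$ and $\varepsilon'\in\widetilde{\mathfrak X}$ satisfies $(\varepsilon'_{N+k},\varepsilon'_{N+k+1},\dots)\prec_{\rm lex}(\varepsilon_N,\varepsilon_{N+1},\dots)$ for every $k\in\mathbb Z$, then $\varepsilon'\in\mathfrak X$; * $\phi|_{\mathfrak X}$ is surjective, and it is one-to-one on the set of sequences in $\mathfrak X$ with finitely many nonzero coordinates. A map $\phi$ is a *bijective arithmetic coding* (BAC) of $T$ if, for some $\mathfrak X$, the pair $(\phi,\mathfrak X)$ is an arithmetic coding and Lebesgue-almost every point of $\mathbb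 T^2$ has exactly one preimage in $\mathfrak X$. **Theorem 2.6.** 1. $T$ admits a BAC only if $M$ is primitive, with the exception of the case $M=K^2$, where $K$ is algebraically conjugate to $\begin{pmatrix}1&1\\1&0\end{pmatrix}$; in this case $M$ is not primitive and $T$ does admit a BAC. 2. $T$ admits a BAC if and only if one of the equations $f_T(x,y)=\pm1$ is solvable in integers. Suppose that this is so. * If $M$ is primitive, then $\mathcal U_D=\{\pm\lambda^k: k\in\mathbb Z\}$, and there is a homoclinic point with coordinates $(\xi_0,\eta_0)$ in $\mathbb R^2$ such that the BACs of $T$ are exactly the maps $$\phi_k^{\pm}(\varepsilon)=\Bigl(\sum_{n=-\infty}^{\infty}\varepsilon_n\lambda^{-n}\Bigr)\begin{pmatrix}\pm\xi_0\lambda^k\\ \pm\eta_0\lambda^k\end{pmatrix}\bmod\mathbb Z^2,\qquad k\in\mathbb Z,$$ where the two-sided series is the limit modulo $\mathbb Z^2$ of the sums over $|n|\le N$ as $N\to\infty$. The correspondence $\pm\lambda^k\leftrightarrow\phi_k^\pm$ between $\mathcal U_D$ and the set of all BACs is one-to-one. * If $M$ is not primitive, then $\lambda=\frac{3+\sqrt5}2$,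 and with $\theta=\sqrt\lambda=\frac{1+\sqrt5}2$ one has $\mathcal U_D=\{\pm\theta^k: k\in\mathbb Z\}$, and there is a homoclinic point with coordinates $(\xi_0,\eta_0)$ in $\mathbb R^2$ such that the BACs of $T$ are exactly the maps $$\phi_k^{\pm}(\varepsilon)=\Bigl(\sum_{n=-\infty}^{\infty}\varepsilon_n\lambda^{-n}\Bigr)\begin{pmatrix}\pm\xi_0\theta^k\\ \pm\eta_0\theta^k\end{pmatrix}\bmod\mathbb Z^2,\qquad k\in\mathbb Z,$$ again with a one-to-one correspondence $\pm\theta^k\leftrightarrow\phi_k^\pm$ between $\mathcal U_D$ and the set of all BACs. -/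

import Mathlib

open Filter Topology MeasureTheory

namespace ArithmeticCoding

/-! ### Integer matrices and toral automorphisms -/

/-- The automorphism `T` of the torus `ℝ² / ℤ²` given by a matrix `M ∈ GL(2, ℤ)`. -/
def toralMap (M : GL (Fin 2) ℤ) (x : UnitAddTorus (Fin 2)) : UnitAddTorus (Fin 2) :=
  fun i => ∑ j, M.1 i j • x j

/-- Reduction modulo `ℤ²`. -/
def torusProj (v : Fin 2 → ℝ) : UnitAddTorus (Fin 2) := fun i => (v i : UnitAddCircle)

/-- The matrix has no eigenvalue on the unit circle. -/
def IsHyperbolicMatrix (M : GL (Fin 2) ℤ) : Prop :=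
  ∀ μ ∈ spectrum ℂ (M.1.map (Int.cast : ℤ → ℂ)), ‖μ‖ ≠ 1

/-- The discriminant `D = r² - 4σ` of the characteristic polynomial `x² - r x + σ`. -/
def discrim (M : GL (Fin 2) ℤ) : ℤ := M.1.trace ^ 2 - 4 * M.1.det

/-- The eigenvalue `λ = (r + √D) / 2`. -/
noncomputable def eigen (M : GL (Fin 2) ℤ) : ℝ :=
  ((M.1.trace : ℝ) + √(discrim M : ℝ)) / 2

/-- A matrix of `GL(2, ℤ)` is primitive if it is not a proper power in `GL(2, ℤ)`. -/
def IsPrimitiveMatrix (M : GL (Fin 2) ℤ) : Prop :=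
  ¬ ∃ (K : GL (Fin 2) ℤ) (n : ℕ), 2 ≤ n ∧ M = K ^ n

/-- The Fibonacci matrix as an element of `GL(2, ℤ)`. -/
noncomputable def fibMatrix : GL (Fin 2) ℤ :=
  Matrix.GeneralLinearGroup.mk'' !![1, 1; 1, 0] (by simp [Matrix.det_fin_two])

/-- `M = K²` with `K` conjugate in `GL(2, ℤ)` to the Fibonacci matrix. -/
def IsFibSquare (M : GL (Fin 2) ℤ) : Prop :=
  ∃ K : GL (Fin 2) ℤ, IsConj K fibMatrix ∧ M = K ^ 2

/-- The binary quadratic form `b x² - (a - d) x y - c y²` associated with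
`M = [[a, b], [c, d]]`. -/
def assocForm (M : GL (Fin 2) ℤ) (x y : ℤ) : ℤ :=
  M.1 0 1 * x ^ 2 - (M.1 0 0 - M.1 1 1) * x * y - M.1 1 0 * y ^ 2

/-- One of the two equations `f_T(x, y) = ± 1` is solvable in integers. -/
def RepresentsUnit (M : GL (Fin 2) ℤ) : Prop :=
  ∃ x y : ℤ, assocForm M x y = 1 ∨ assocForm M x y = -1

/-- The set of all `± μ ^ k`, `k ∈ ℤ`. -/
def signedPowers (μ : ℝ) : Set ℝ := {u | ∃ k : ℤ, u = μ ^ k ∨ u = -μ ^ k}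

/-- The Dirichlet group: the numbers `(x + y √D) / 2` with `x² - D y² = ± 4`. -/
def dirichletGroup (D : ℤ) : Set ℝ :=
  {u | ∃ x y : ℤ, (x ^ 2 - D * y ^ 2 = 4 ∨ x ^ 2 - D * y ^ 2 = -4) ∧
    u = ((x : ℝ) + y * √(D : ℝ)) / 2}

/-- `x` is homoclinic to zero: `Tⁿ x → 0` as `n → ± ∞`. -/
def IsHomoclinic (M : GL (Fin 2) ℤ) (x : UnitAddTorus (Fin 2)) : Prop :=
  Tendsto (fun n : ℤ => toralMap (M ^ n) x) atTop (𝓝 0) ∧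
    Tendsto (fun n : ℤ => toralMap (M ^ n) x) atBot (𝓝 0)

/-- `v` gives the coordinates in `ℝ²` of a homoclinic point: `v` is its representative on the
unstable eigenline, the line of eigenvectors for `λ`. -/
def IsHomoclinicCoord (M : GL (Fin 2) ℤ) (v : Fin 2 → ℝ) : Prop :=
  (M.1.map (Int.cast : ℤ → ℝ)).mulVec v = eigen M • v ∧ IsHomoclinic M (torusProj v)

/-! ### The primary symbolic space -/

/-- The semigroup of two-sided sequences of nonnegative integers for which both
`∑ ε_n λ⁻ⁿ` and `∑ ε_{-n} λ⁻ⁿ` (`n ≥ 0`) converge. -/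
def primarySet (lam : ℝ) : AddSubmonoid (ℤ → ℕ) where
  carrier := {ε | Summable (fun n : ℕ => (ε n : ℝ) * lam⁻¹ ^ n) ∧
    Summable (fun n : ℕ => (ε (-n) : ℝ) * lam⁻¹ ^ n)}
  zero_mem' := by
    constructor <;> simp
  add_mem' := by
    rintro a b ⟨ha, ha'⟩ ⟨hb, hb'⟩
    refine ⟨(ha.add hb).congr fun n => ?_, (ha'.add hb').congr fun n => ?_⟩ <;>
    · simp only [Pi.add_apply, Nat.cast_add]
      ring

/-- The primary symbolic space, a type of its own so that it does not inherit the topology of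
coordinatewise convergence. -/
def PrimarySpace (lam : ℝ) : Type := primarySet lam

instance (lam : ℝ) : AddCommMonoid (PrimarySpace lam) :=
  inferInstanceAs (AddCommMonoid (primarySet lam))

/-- The `n`-th coordinate of a sequence. -/
def PrimarySpace.digit {lam : ℝ} (ε : PrimarySpace lam) (n : ℤ) : ℕ := Subtype.val ε n

/-- The weighted sequence `(ε_n λ^{-|n|})_n` as an element of `ℓ¹(ℤ)`. -/
noncomputable def PrimarySpace.toL1 {lam : ℝ} (ε : PrimarySpace lam) :
    lp (fun _ : ℤ => ℝ) 1 :=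
  ⟨fun n => (ε.digit n : ℝ) * lam⁻¹ ^ n.natAbs, by
    refine memℓp_gen ?_
    have h := Subtype.property ε
    have h1 : Summable fun n : ℤ => (ε.digit n : ℝ) * lam⁻¹ ^ n.natAbs := by
      refine Summable.of_nat_of_neg ?_ ?_
      · simpa [PrimarySpace.digit] using h.1
      · simpa [PrimarySpace.digit] using h.2
    simpa using h1.abs⟩

/-- The natural topology of the primary space: `ε^{(j)} → ε` if and only if
`∑_n |ε^{(j)}_n - ε_n| λ^{-|n|} → 0`. On every set of sequences with uniformly bounded
digits it is, for `λ > 1`, the topology of coordinatewise convergence. -/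
noncomputable instance (lam : ℝ) : TopologicalSpace (PrimarySpace lam) :=
  TopologicalSpace.induced PrimarySpace.toL1 inferInstance

/-- The shift `τ`, `(τ ε)_n = ε_{n+1}`. -/
def PrimarySpace.shift {lam : ℝ} (ε : PrimarySpace lam) : PrimarySpace lam :=
  ⟨fun n => ε.digit (n + 1), by
    have h := Subtype.property ε
    constructor
    · rcases eq_or_ne lam 0 with rfl | hl
      · refine summable_of_ne_finset_zero (s := {0}) fun n hn => ?_
        have : n ≠ 0 := by simpa using hn
        simp [this]
      · have h1 := ((summable_nat_add_iff 1).2 h.1).mul_left lam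
        refine h1.congr fun n => ?_
        simp only [PrimarySpace.digit, Nat.cast_add, Nat.cast_one, pow_succ]
        field_simp
    · refine (summable_nat_add_iff 1).1 ?_
      refine (h.2.mul_right lam⁻¹).congr fun n => ?_
      have e : (-((n + 1 : ℕ) : ℤ) + 1) = -(n : ℤ) := by push_cast; ring
      simp only [PrimarySpace.digit, e, pow_succ]
      ring⟩

/-- A sequence is finite if only finitely many of its coordinates are nonzero. -/
def PrimarySpace.IsFiniteSeq {lam : ℝ} (ε : PrimarySpace lam) : Prop :=
  {n : ℤ | ε.digit n ≠ 0}.Finite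

/-- The one-sided sequence `(ε_N, ε_{N+1}, …)`. -/
def PrimarySpace.tail {lam : ℝ} (ε : PrimarySpace lam) (N : ℤ) : ℕ → ℕ :=
  fun j => ε.digit (N + j)

/-- Strict lexicographic order on one-sided sequences. -/
def LexLess (a b : ℕ → ℕ) : Prop := ∃ n, (∀ m < n, a m = b m) ∧ a n < b n

/-- `X` is total: together with `ε` it contains each `ε'` all of whose tails are
lexicographically less than one fixed tail of `ε`. -/
def IsTotal {lam : ℝ} (X : Set (PrimarySpace lam)) : Prop :=
  ∀ ε ∈ X, ∀ ε' : PrimarySpace lam,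
    (∃ N : ℤ, ∀ k : ℤ, LexLess (ε'.tail (N + k)) (ε.tail N)) → ε' ∈ X

/-! ### Arithmetic codings -/

/-- `(φ, X)` is an arithmetic coding of the automorphism given by `M`. -/
structure IsArithmeticCoding (M : GL (Fin 2) ℤ)
    (φ : PrimarySpace (eigen M) →+ UnitAddTorus (Fin 2))
    (X : Set (PrimarySpace (eigen M))) : Prop where
  continuous : Continuous φ
  equivariant : ∀ ε, φ ε.shift = toralMap M (φ ε)
  closed : IsClosed X
  shift_invariant : ∀ ε, ε.shift ∈ X ↔ ε ∈ X
  total : IsTotal X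
  surjOn : Set.SurjOn φ X Set.univ
  injOn_finite : Set.InjOn φ {ε | ε ∈ X ∧ ε.IsFiniteSeq}

/-- `φ` is a bijective arithmetic coding (BAC): for some `X` the pair `(φ, X)` is an arithmetic
coding and Lebesgue almost every point of the torus has exactly one preimage in `X`. -/
def IsBAC (M : GL (Fin 2) ℤ) (φ : PrimarySpace (eigen M) →+ UnitAddTorus (Fin 2)) : Prop :=
  ∃ X : Set (PrimarySpace (eigen M)), IsArithmeticCoding M φ X ∧
    ∀ᵐ x : UnitAddTorus (Fin 2), ∃! ε, ε ∈ X ∧ φ ε = x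

/-- The automorphism given by `M` admits a bijective arithmetic coding. -/
def AdmitsBAC (M : GL (Fin 2) ℤ) : Prop := ∃ φ, IsBAC M φ

/-- `φ(ε) = (∑_n ε_n λ⁻ⁿ) v mod ℤ²` for all `ε`, the two-sided series being the limit modulo `ℤ²`
of its symmetric partial sums. -/
def IsGivenBy (M : GL (Fin 2) ℤ) (φ : PrimarySpace (eigen M) →+ UnitAddTorus (Fin 2))
    (v : Fin 2 → ℝ) : Prop :=
  ∀ ε, Tendsto (fun N : ℕ => torusProj
    ((∑ n ∈ Finset.Icc (-(N : ℤ)) N, (ε.digit n : ℝ) * eigen M ^ (-n)) • v)) atTop (𝓝 (φ ε))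

/-- The BACs of `M` are exactly the maps given by the vectors `u v`, `u ∈ U`, and this is a
one-to-one correspondence between `U` and the set of all BACs. -/
def ParametrizesBACs (M : GL (Fin 2) ℤ) (U : Set ℝ) (v : Fin 2 → ℝ) : Prop :=
  (∀ u ∈ U, ∃! φ, IsBAC M φ ∧ IsGivenBy M φ (u • v)) ∧
    ∀ φ, IsBAC M φ → ∃! u, u ∈ U ∧ IsGivenBy M φ (u • v)

end ArithmeticCoding

open ArithmeticCoding

/-!
Let `λ'` be the second eigenvalue. An equivariant continuous homomorphism `φ` is determined by
`φ (δ₀)`, where `δ₀` is the sequence with a single digit `1`, at position `0`. This is a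
homoclinic point: it has representatives `v` on the expanding and `s` on the contracting
eigenline, and `m = v - s` is an integer vector. So `φ` is the coding `ε ↦ (∑ ε_n λ⁻ⁿ) v` of the
companion matrix of `M`, in which `v` has coordinates fixed by `λ` alone, followed by the toral
endomorphism with matrix `(m, M m)`.

For the companion matrix, the two-sided beta-shift of `λ` covers almost every point exactly once:
its image is compact and contains a dense ray of the expanding eigenline, and the pairs of values
of the two halves of an admissible sequence fill a region of the plane of area at most that of a
fundamental domain of `ℤ²`. If a closed total set omits an admissible sequence, then all its
members have tails bounded by a sequence of value less than `1`, and its image is a null set. So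
`φ` is a BAC exactly when the endomorphism `(m, M m)` is invertible. Its determinant is
`-f_T(x, y)` for `m = (-y, x)`, and replacing `m` by `a m + b M m` multiplies `v` by `a + b λ` and
the determinant by the norm of `a + b λ`. Hence the BACs form a torsor under the units of `ℤ[λ]`,
which is the Dirichlet group. These units are `± λ ^ k`, except when `λ` is the square of the
golden mean.
-/

namespace ArithmeticCoding

/-! ### Values of one-sided digit sequences -/

/-- The tail `(a_k, a_{k+1}, …)` of a one-sided sequence. -/
def dropSeq (k : ℕ) (a : ℕ → ℕ) : ℕ → ℕ := fun j => a (k + j)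

/-- The value `0.a₀a₁a₂… = ∑ a_j μ^{j+1}` of a digit sequence in base `μ⁻¹`. -/
noncomputable def seqVal (μ : ℝ) (a : ℕ → ℕ) : ℝ := ∑' j, (a j : ℝ) * μ ^ (j + 1)

/-- Convergence of the series defining `seqVal`. -/
def SeqSummable (μ : ℝ) (a : ℕ → ℕ) : Prop := Summable fun j => (a j : ℝ) * μ ^ (j + 1)

/-- Parry's admissibility condition: no tail of `a` is lexicographically greater than `d`. -/
def LexAdmissible (d a : ℕ → ℕ) : Prop := ∀ k, ¬ LexLess d (dropSeq k a)

@[simp] lemma dropSeq_zero (a : ℕ → ℕ) : dropSeq 0 a = a := by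
  funext j; simp [dropSeq]

lemma dropSeq_dropSeq (k l : ℕ) (a : ℕ → ℕ) :
    dropSeq k (dropSeq l a) = dropSeq (l + k) a := by
  funext j; simp [dropSeq, add_assoc]

lemma lexLess_iff_toLex_lt {a b : ℕ → ℕ} : LexLess a b ↔ toLex a < toLex b := Iff.rfl

lemma not_lexLess_iff {a b : ℕ → ℕ} : ¬ LexLess a b ↔ toLex b ≤ toLex a :=
  lexLess_iff_toLex_lt.not.trans not_lt

lemma LexLess.trans {a b c : ℕ → ℕ} (hab : LexLess a b) (hbc : LexLess b c) : LexLess a c :=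
  lt_trans (lexLess_iff_toLex_lt.1 hab) (lexLess_iff_toLex_lt.1 hbc)

lemma lexLess_trichotomy (a b : ℕ → ℕ) : LexLess a b ∨ a = b ∨ LexLess b a :=
  lt_trichotomy (toLex a) (toLex b)

lemma lexLess_of_head_lt {a b : ℕ → ℕ} (h : a 0 < b 0) : LexLess a b :=
  ⟨0, by simp, h⟩

namespace LexAdmissible

variable {d a : ℕ → ℕ}

lemma not_lexLess (h : LexAdmissible d a) : ¬ LexLess d a := by
  simpa using h 0

lemma drop (h : LexAdmissible d a) (k : ℕ) : LexAdmissible d (dropSeq k a) := by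
  intro l
  rw [dropSeq_dropSeq]
  exact h _

lemma le_head (h : LexAdmissible d a) (k : ℕ) : a k ≤ d 0 := by
  by_contra! hk
  exact h k (lexLess_of_head_lt (by simpa [dropSeq] using hk))

lemma lexLess_or_eq (h : LexAdmissible d a) : LexLess a d ∨ a = d := by
  simpa only [h.not_lexLess, or_false] using lexLess_trichotomy a d

end LexAdmissible

section seqVal

variable {μ : ℝ} {a b : ℕ → ℕ}

lemma seqSummable_of_le (h0 : 0 < μ) (h1 : μ < 1) {B : ℕ} (h : ∀ j, a j ≤ B) :
    SeqSummable μ a := by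
  refine Summable.of_nonneg_of_le (fun j => by positivity) (fun j => ?_)
    ((summable_geometric_of_lt_one h0.le h1).mul_left ((B : ℝ) * μ))
  rw [pow_succ', ← mul_assoc]
  have : (a j : ℝ) ≤ B := mod_cast h j
  gcongr

lemma seqVal_le_of_le (h0 : 0 < μ) (h1 : μ < 1) {B : ℕ} (h : ∀ j, a j ≤ B) :
    seqVal μ a ≤ B * μ * (1 - μ)⁻¹ := by
  rw [← tsum_geometric_of_lt_one h0.le h1, ← tsum_mul_left]
  refine Summable.tsum_le_tsum (fun j => ?_) (seqSummable_of_le h0 h1 h)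
    ((summable_geometric_of_lt_one h0.le h1).mul_left ((B : ℝ) * μ))
  rw [pow_succ', ← mul_assoc]
  have : (a j : ℝ) ≤ B := mod_cast h j
  gcongr

lemma seqVal_nonneg (h0 : 0 ≤ μ) (a : ℕ → ℕ) : 0 ≤ seqVal μ a :=
  tsum_nonneg fun j => by positivity

@[simp] lemma seqVal_zero (μ : ℝ) : seqVal μ 0 = 0 := by simp [seqVal]

lemma SeqSummable.drop (h0 : 0 < μ) (h : SeqSummable μ a) (k : ℕ) :
    SeqSummable μ (dropSeq k a) := by
  refine (((summable_nat_add_iff k).2 h).mul_left (μ ^ k)⁻¹).congr fun j => ?_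
  rw [dropSeq, show j + k + 1 = k + (j + 1) by ring, pow_add, add_comm j k]
  field_simp

lemma seqVal_eq_sum_add (h : SeqSummable μ a) (k : ℕ) :
    seqVal μ a =
      ∑ j ∈ Finset.range k, (a j : ℝ) * μ ^ (j + 1) + μ ^ k * seqVal μ (dropSeq k a) := by
  unfold seqVal
  rw [← h.sum_add_tsum_nat_add k, ← tsum_mul_left]
  congr! 3 with j
  rw [dropSeq, show j + k + 1 = k + (j + 1) by ring, pow_add, add_comm j k]
  ring

lemma seqVal_eq_head_add (h : SeqSummable μ a) :
    seqVal μ a = μ * (a 0 + seqVal μ (dropSeq 1 a)) := by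
  rw [seqVal_eq_sum_add h 1]
  simp only [Finset.sum_range_one, zero_add, pow_one]
  ring

lemma sum_range_le_seqVal (h0 : 0 ≤ μ) (h : SeqSummable μ a) (k : ℕ) :
    ∑ j ∈ Finset.range k, (a j : ℝ) * μ ^ (j + 1) ≤ seqVal μ a :=
  h.sum_le_tsum _ fun j _ => by positivity

lemma seqVal_eq_of_agree (ha : SeqSummable μ a) {i : ℕ} (hab : ∀ m < i, a m = b m) :
    seqVal μ a = ∑ j ∈ Finset.range i, (b j : ℝ) * μ ^ (j + 1) + a i * μ ^ (i + 1) +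
      μ ^ (i + 1) * seqVal μ (dropSeq (i + 1) a) := by
  rw [seqVal_eq_sum_add ha (i + 1), Finset.sum_range_succ]
  congr 2
  exact Finset.sum_congr rfl fun j hj => by rw [hab j (Finset.mem_range.1 hj)]

-- The first digit at which `a` and `b` differ costs `a` at least `μ ^ (k + 1)`, which the tail of
-- `a` beyond it makes up for at most when that tail has value `1`.
lemma LexLess.exists_seqVal_le (h0 : 0 < μ) (ha : SeqSummable μ a) (hb : SeqSummable μ b)
    (hab : LexLess a b) :
    ∃ k, seqVal μ a ≤ seqVal μ b + μ ^ (k + 1) * (seqVal μ (dropSeq (k + 1) a) - 1) := by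
  obtain ⟨i, heq, hlt⟩ := hab
  refine ⟨i, ?_⟩
  have hdigit : ((a i : ℝ) + 1) * μ ^ (i + 1) ≤ b i * μ ^ (i + 1) := by
    gcongr
    exact_mod_cast hlt
  have hsum := sum_range_le_seqVal h0.le hb (i + 1)
  rw [Finset.sum_range_succ] at hsum
  rw [seqVal_eq_of_agree ha heq]
  linarith

lemma LexLess.seqVal_le (h0 : 0 < μ) (ha : SeqSummable μ a) (hb : SeqSummable μ b)
    (hab : LexLess a b) (htail : ∀ k, seqVal μ (dropSeq k a) ≤ 1) : seqVal μ a ≤ seqVal μ b := by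
  obtain ⟨k, hk⟩ := hab.exists_seqVal_le h0 ha hb
  have := mul_nonpos_of_nonneg_of_nonpos (pow_nonneg h0.le (k + 1))
    (sub_nonpos.2 (htail (k + 1)))
  linarith

lemma LexLess.seqVal_lt (h0 : 0 < μ) (ha : SeqSummable μ a) (hb : SeqSummable μ b)
    (hab : LexLess a b) (htail : ∀ k, 0 < k → seqVal μ (dropSeq k a) < 1) :
    seqVal μ a < seqVal μ b := by
  obtain ⟨k, hk⟩ := hab.exists_seqVal_le h0 ha hb
  have := mul_neg_of_pos_of_neg (pow_pos h0 (k + 1)) (sub_neg.2 (htail (k + 1) k.succ_pos))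
  linarith

lemma eq_of_seqVal_eq (h0 : 0 < μ) (ha : SeqSummable μ a) (hb : SeqSummable μ b)
    (hta : ∀ k, seqVal μ (dropSeq k a) < 1) (htb : ∀ k, seqVal μ (dropSeq k b) < 1)
    (hab : seqVal μ a = seqVal μ b) : a = b := by
  rcases lexLess_trichotomy a b with hlt | heq | hgt
  · exact absurd hab (hlt.seqVal_lt h0 ha hb fun k _ => hta k).ne
  · exact heq
  · exact absurd hab (hgt.seqVal_lt h0 hb ha fun k _ => htb k).ne'

end seqVal

lemma nonpos_of_forall_exists_le_mul {ι : Type*} {f : ι → ℝ} {μ C : ℝ} (h0 : 0 ≤ μ) (h1 : μ < 1)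
    (hC : ∀ i, f i ≤ C) (hf : ∀ i, ∃ j, f i ≤ μ * max (f j) 0) (i : ι) : f i ≤ 0 := by
  have hbound : ∀ (n : ℕ) (i : ι), f i ≤ μ ^ n * max C 0 := by
    intro n
    induction n with
    | zero => intro i; simpa using Or.inl (hC i)
    | succ n ih =>
      intro i
      obtain ⟨j, hj⟩ := hf i
      calc f i ≤ μ * max (f j) 0 := hj
        _ ≤ μ * (μ ^ n * max C 0) := by
          gcongr
          exact max_le (ih j) (by positivity)
        _ = μ ^ (n + 1) * max C 0 := by ring
  have hlim : Tendsto (fun n : ℕ => μ ^ n * max C 0) atTop (𝓝 0) := by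
    simpa using (tendsto_pow_atTop_nhds_zero_of_lt_one h0 h1).mul_const (max C 0)
  exact ge_of_tendsto' hlim fun n => hbound n i

namespace LexAdmissible

variable {μ : ℝ} {d a : ℕ → ℕ}

lemma seqSummable (h0 : 0 < μ) (h1 : μ < 1) (h : LexAdmissible d a) : SeqSummable μ a :=
  seqSummable_of_le h0 h1 h.le_head

lemma seqVal_le_one (h0 : 0 < μ) (h1 : μ < 1) (hd : SeqSummable μ d) (hdv : seqVal μ d = 1)
    (ha : LexAdmissible d a) : seqVal μ a ≤ 1 := by
  have hcontract : ∀ k, ∃ l,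
      seqVal μ (dropSeq k a) - 1 ≤ μ * max (seqVal μ (dropSeq l a) - 1) 0 := by
    intro k
    rcases (ha.drop k).lexLess_or_eq with hlt | heq
    · obtain ⟨i, hi⟩ := hlt.exists_seqVal_le h0 ((ha.drop k).seqSummable h0 h1) hd
      rw [dropSeq_dropSeq, hdv] at hi
      refine ⟨k + (i + 1), ?_⟩
      calc seqVal μ (dropSeq k a) - 1
          ≤ μ ^ (i + 1) * (seqVal μ (dropSeq (k + (i + 1)) a) - 1) := by linarith
        _ ≤ μ ^ (i + 1) * max (seqVal μ (dropSeq (k + (i + 1)) a) - 1) 0 := by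
          gcongr
          exact le_max_left _ _
        _ ≤ μ * max (seqVal μ (dropSeq (k + (i + 1)) a) - 1) 0 := by
          gcongr
          exact pow_le_of_le_one h0.le h1.le i.succ_ne_zero
    · refine ⟨k, ?_⟩
      rw [heq, hdv, sub_self]
      positivity
  have hbound : ∀ k, seqVal μ (dropSeq k a) - 1 ≤ d 0 * μ * (1 - μ)⁻¹ := fun k =>
    (sub_le_self _ one_pos.le).trans (seqVal_le_of_le h0 h1 (ha.drop k).le_head)
  simpa using nonpos_of_forall_exists_le_mul h0.le h1 hbound hcontract 0

lemma seqVal_lt_one (h0 : 0 < μ) (h1 : μ < 1) (hd : SeqSummable μ d) (hdv : seqVal μ d = 1)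
    (hinf : ∀ n, ∃ m, n ≤ m ∧ d m ≠ 0) (ha : LexAdmissible d a) {n : ℕ}
    (hn : ∀ m, n ≤ m → a m = 0) : seqVal μ a < 1 := by
  have htail : ∀ l k : ℕ, n ≤ k + l → seqVal μ (dropSeq k a) < 1 := by
    intro l
    induction l with
    | zero =>
      intro k hk
      have : dropSeq k a = 0 := funext fun j => hn _ (by omega)
      simp [this]
    | succ l ih =>
      intro k hk
      rcases (ha.drop k).lexLess_or_eq with hlt | heq
      · rw [← hdv]
        refine hlt.seqVal_lt h0 ((ha.drop k).seqSummable h0 h1) hd fun i hi => ?_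
        rw [dropSeq_dropSeq]
        exact ih _ (by omega)
      · obtain ⟨m, hm, hdm⟩ := hinf n
        rw [← heq] at hdm
        exact absurd (hn (k + m) (by omega)) hdm
  simpa using htail n 0 (by omega)

end LexAdmissible

lemma lexAdmissible_of_seqVal_lt_one {μ : ℝ} {d a : ℕ → ℕ} (h0 : 0 < μ) (hd : SeqSummable μ d)
    (hdv : seqVal μ d = 1) (hdt : ∀ k, seqVal μ (dropSeq k d) ≤ 1) (ha : SeqSummable μ a)
    (hat : ∀ k, seqVal μ (dropSeq k a) < 1) : LexAdmissible d a := fun k hlt =>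
  (hat k).not_ge (hdv.ge.trans (hlt.seqVal_le h0 hd (ha.drop h0 k) hdt))

section ValueSet

variable {μ : ℝ} {w : ℕ → ℕ}

/-- The values of all sequences none of whose tails exceeds `w`. -/
def valueSet (μ : ℝ) (w : ℕ → ℕ) : Set ℝ := seqVal μ '' {a | LexAdmissible w a}

lemma volume_image_const_add_mul (c t : ℝ) (E : Set ℝ) :
    volume ((fun z => c + t * z) '' E) = ENNReal.ofReal |t| * volume E := by
  have : (fun z => c + t * z) '' E = (fun z => c + z) '' ((fun z => t • z) '' E) := by
    rw [Set.image_image]; rfl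
  rw [this, Set.image_add_left, measure_preimage_add, Set.image_smul, Measure.addHaar_smul]
  simp

lemma valueSet_subset_Icc (h0 : 0 < μ) (h1 : μ < 1) :
    valueSet μ w ⊆ Set.Icc 0 (w 0 * μ * (1 - μ)⁻¹) := by
  rintro _ ⟨a, ha, rfl⟩
  exact ⟨seqVal_nonneg h0.le a, seqVal_le_of_le h0 h1 ha.le_head⟩

lemma valueSet_subset_iUnion (h0 : 0 < μ) (h1 : μ < 1) :
    valueSet μ w ⊆ {seqVal μ w} ∪ ⋃ i : ℕ, ⋃ b ∈ Finset.range (w i),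
      (fun z => (∑ j ∈ Finset.range i, (w j : ℝ) * μ ^ (j + 1) + b * μ ^ (i + 1)) +
        μ ^ (i + 1) * z) '' valueSet μ w := by
  rintro _ ⟨a, ha, rfl⟩
  rcases ha.lexLess_or_eq with ⟨i, heq, hlt⟩ | rfl
  · right
    simp only [Set.mem_iUnion]
    refine ⟨i, a i, Finset.mem_range.2 hlt, seqVal μ (dropSeq (i + 1) a), ⟨_, ha.drop _, rfl⟩, ?_⟩
    exact (seqVal_eq_of_agree (ha.seqSummable h0 h1) heq).symm
  · exact Or.inl rfl

lemma volume_valueSet_le (h0 : 0 < μ) (h1 : μ < 1) (hw : SeqSummable μ w) :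
    volume (valueSet μ w) ≤ ENNReal.ofReal (seqVal μ w) * volume (valueSet μ w) := by
  calc volume (valueSet μ w) ≤ _ := measure_mono (valueSet_subset_iUnion h0 h1)
    _ ≤ volume {seqVal μ w} + _ := measure_union_le _ _
    _ ≤ 0 + ∑' i : ℕ, (w i : ENNReal) *
          (ENNReal.ofReal (μ ^ (i + 1)) * volume (valueSet μ w)) := by
      gcongr
      · simp
      · refine (measure_iUnion_le _).trans (ENNReal.tsum_le_tsum fun i => ?_)
        refine (measure_biUnion_finset_le _ _).trans ?_
        simp [volume_image_const_add_mul, abs_of_pos h0]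
    _ = ENNReal.ofReal (seqVal μ w) * volume (valueSet μ w) := by
      rw [zero_add, seqVal, ENNReal.ofReal_tsum_of_nonneg (fun j => by positivity) hw,
        ← ENNReal.tsum_mul_right]
      refine tsum_congr fun i => ?_
      rw [ENNReal.ofReal_mul (by positivity), ENNReal.ofReal_natCast, mul_assoc]

lemma volume_valueSet_eq_zero (h0 : 0 < μ) (h1 : μ < 1) (hw : SeqSummable μ w)
    (hw1 : seqVal μ w < 1) : volume (valueSet μ w) = 0 := by
  have hfinite : volume (valueSet μ w) ≠ ⊤ :=
    ((measure_mono (valueSet_subset_Icc h0 h1)).trans_lt measure_Icc_lt_top).ne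
  have hlt : ENNReal.ofReal (seqVal μ w) < 1 := ENNReal.ofReal_lt_one.2 hw1
  by_contra hne
  have := ENNReal.mul_lt_mul_left hne hfinite hlt
  rw [one_mul] at this
  exact (volume_valueSet_le h0 h1 hw).not_gt this

end ValueSet

/-! ### Two-sided digit sequences -/

/-- The one-sided sequence `e_N, e_{N+1}, …`. -/
def fwdSeq (e : ℤ → ℕ) (N : ℤ) : ℕ → ℕ := fun j => e (N + j)

/-- The one-sided sequence `e_N, e_{N-1}, …`. -/
def bwdSeq (e : ℤ → ℕ) (N : ℤ) : ℕ → ℕ := fun j => e (N - j)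

/-- Parry's admissibility condition for a two-sided sequence: none of its right tails is
lexicographically greater than `d`. -/
def ShiftAdmissible (d : ℕ → ℕ) (e : ℤ → ℕ) : Prop := ∀ N, ¬ LexLess d (fwdSeq e N)

lemma dropSeq_fwdSeq (e : ℤ → ℕ) (N : ℤ) (k : ℕ) : dropSeq k (fwdSeq e N) = fwdSeq e (N + k) := by
  funext j
  simp only [dropSeq, fwdSeq]
  congr 1; push_cast; ring

namespace ShiftAdmissible

variable {d : ℕ → ℕ} {e : ℤ → ℕ}

lemma lexAdmissible_fwdSeq (he : ShiftAdmissible d e) (N : ℤ) : LexAdmissible d (fwdSeq e N) :=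
  fun k => by rw [dropSeq_fwdSeq]; exact he _

lemma le_head (he : ShiftAdmissible d e) (n : ℤ) : e n ≤ d 0 := by
  simpa [fwdSeq] using (he.lexAdmissible_fwdSeq n).le_head 0

end ShiftAdmissible

lemma isOpen_lexLess (d : ℕ → ℕ) : IsOpen {a : ℕ → ℕ | LexLess d a} := by
  have : {a : ℕ → ℕ | LexLess d a} =
      ⋃ n, (⋂ m ∈ Finset.range n, {a : ℕ → ℕ | d m = a m}) ∩ {a | d n < a n} := by
    ext a
    simp [LexLess]
  rw [this]
  refine isOpen_iUnion fun n => (isOpen_biInter_finset fun m _ => ?_).inter ?_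
  · exact (isOpen_discrete {k | d m = k}).preimage (continuous_apply m)
  · exact (isOpen_discrete {k | d n < k}).preimage (continuous_apply n)

lemma isClosed_shiftAdmissible (d : ℕ → ℕ) : IsClosed {e : ℤ → ℕ | ShiftAdmissible d e} := by
  simp only [ShiftAdmissible, Set.ofPred_forall]
  exact isClosed_iInter fun N => ((isOpen_lexLess d).preimage
    (continuous_pi fun _ => continuous_apply _ : Continuous fun e => fwdSeq e N)).isClosed_compl

lemma isCompact_shiftAdmissible (d : ℕ → ℕ) : IsCompact {e : ℤ → ℕ | ShiftAdmissible d e} :=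
  (isCompact_univ_pi fun _ : ℤ => (Set.finite_Iic (d 0)).isCompact).of_isClosed_subset
    (isClosed_shiftAdmissible d) fun _ he n _ => he.le_head n

/-! ### The primary space -/

section lpOne

variable {α β : Type*} {g : β → α} {c : β → ℝ}

lemma summable_norm_lpOne (f : lp (fun _ : α => ℝ) 1) : Summable fun n => ‖f n‖ := by
  simpa using (lp.hasSum_norm (p := 1) (by simp) f).summable

lemma summable_norm_mul_comp (hg : Function.Injective g) (hc : ∀ j, |c j| ≤ 1)
    (f : lp (fun _ : α => ℝ) 1) : Summable fun j => ‖c j * f (g j)‖ := by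
  refine Summable.of_nonneg_of_le (fun _ => norm_nonneg _) (fun j => ?_)
    ((summable_norm_lpOne f).comp_injective hg)
  rw [norm_mul]
  exact mul_le_of_le_one_left (norm_nonneg _) (hc j)

lemma norm_tsum_mul_comp_le (hg : Function.Injective g) (hc : ∀ j, |c j| ≤ 1)
    (f : lp (fun _ : α => ℝ) 1) : ‖∑' j, c j * f (g j)‖ ≤ ‖f‖ := by
  have hnorm := summable_norm_lpOne f
  have hmul := summable_norm_mul_comp hg hc f
  calc ‖∑' j, c j * f (g j)‖ ≤ ∑' j, ‖c j * f (g j)‖ := norm_tsum_le_tsum_norm hmul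
    _ ≤ ∑' j, ‖f (g j)‖ := by
      refine hmul.tsum_le_tsum (fun j => ?_) (hnorm.comp_injective hg)
      rw [norm_mul]
      exact mul_le_of_le_one_left (norm_nonneg _) (hc j)
    _ ≤ ∑' n, ‖f n‖ := tsum_comp_le_tsum_of_inj hnorm (fun _ => norm_nonneg _) hg
    _ = ‖f‖ := by simp [lp.norm_eq_tsum_rpow (p := 1) (by simp) f]

lemma continuous_tsum_mul_comp (hg : Function.Injective g) (hc : ∀ j, |c j| ≤ 1) :
    Continuous fun f : lp (fun _ : α => ℝ) 1 => ∑' j, c j * f (g j) := by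
  have hsum (f : lp (fun _ : α => ℝ) 1) : Summable fun j => c j * f (g j) :=
    (summable_norm_mul_comp hg hc f).of_norm
  let F : lp (fun _ : α => ℝ) 1 →ₗ[ℝ] ℝ :=
    { toFun := fun f => ∑' j, c j * f (g j)
      map_add' := fun f f' => by
        rw [← (hsum f).tsum_add (hsum f')]
        exact tsum_congr fun j => by simp [mul_add]
      map_smul' := fun a f => by
        rw [RingHom.id_apply, smul_eq_mul, ← tsum_mul_left]
        exact tsum_congr fun j => by simp; ring }
  exact (F.mkContinuous 1 fun f =>
    (norm_tsum_mul_comp_le hg hc f).trans_eq (one_mul _).symm).continuous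

end lpOne

namespace PrimarySpace

variable {lam : ℝ}

/-- A two-sided sequence in the primary set as a point of the primary space. -/
def mk (e : ℤ → ℕ) (h : e ∈ primarySet lam) : PrimarySpace lam := ⟨e, h⟩

@[ext] lemma ext {a b : PrimarySpace lam} (h : ∀ n, a.digit n = b.digit n) : a = b :=
  Subtype.ext (funext h)

/-- The `n`-th digit as a homomorphism. -/
def digitHom (lam : ℝ) (n : ℤ) : PrimarySpace lam →+ ℕ where
  toFun ε := ε.digit n
  map_zero' := rfl
  map_add' _ _ := rfl

@[simp] lemma digit_zero (n : ℤ) : (0 : PrimarySpace lam).digit n = 0 := rfl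

@[simp] lemma digit_add (a b : PrimarySpace lam) (n : ℤ) :
    (a + b).digit n = a.digit n + b.digit n := rfl

@[simp] lemma digit_nsmul (k : ℕ) (a : PrimarySpace lam) (n : ℤ) :
    (k • a).digit n = k * a.digit n :=
  (map_nsmul (digitHom lam n) k a).trans (smul_eq_mul _ _)

@[simp] lemma digit_sum {ι : Type*} (s : Finset ι) (f : ι → PrimarySpace lam) (n : ℤ) :
    (∑ i ∈ s, f i).digit n = ∑ i ∈ s, (f i).digit n :=
  map_sum (digitHom lam n) f s

@[simp] lemma digit_shift (a : PrimarySpace lam) (n : ℤ) : a.shift.digit n = a.digit (n + 1) := rfl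

lemma mem_primarySet_of_finite {e : ℤ → ℕ} (h : {n | e n ≠ 0}.Finite) : e ∈ primarySet lam := by
  constructor
  · refine summable_of_hasFiniteSupport ((h.preimage (Nat.cast_injective.injOn)).subset ?_)
    intro n hn
    simp only [Function.mem_support] at hn
    simpa using left_ne_zero_of_mul hn
  · refine summable_of_hasFiniteSupport
      ((h.preimage ((neg_injective.comp Nat.cast_injective).injOn)).subset ?_)
    intro n hn
    simp only [Function.mem_support] at hn
    simpa using left_ne_zero_of_mul hn

/-- The sequence whose only nonzero digit is a `1` at place `n`. -/
def single (lam : ℝ) (n : ℤ) : PrimarySpace lam :=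
  mk (fun m => if m = n then 1 else 0)
    (mem_primarySet_of_finite ((Set.finite_singleton n).subset fun m hm => by
      by_contra h
      exact hm (if_neg h)))

@[simp] lemma digit_single (n m : ℤ) : (single lam n).digit m = if m = n then 1 else 0 := rfl

lemma shift_single (n : ℤ) : (single lam n).shift = single lam (n - 1) := by
  ext m
  simp only [digit_shift, digit_single]
  congr 1
  simp only [eq_iff_iff]
  omega

/-- The restriction of a sequence to the window `[-N, N]`. -/
noncomputable def trunc (N : ℕ) (ε : PrimarySpace lam) : PrimarySpace lam :=
  ∑ n ∈ Finset.Icc (-(N : ℤ)) N, ε.digit n • single lam n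

lemma digit_trunc (N : ℕ) (ε : PrimarySpace lam) (n : ℤ) :
    (trunc N ε).digit n = if n ∈ Finset.Icc (-(N : ℤ)) N then ε.digit n else 0 := by
  simp only [trunc, digit_sum, digit_nsmul, digit_single, mul_ite, mul_one, mul_zero,
    Finset.sum_ite_eq]

lemma digit_trunc_le (N : ℕ) (ε : PrimarySpace lam) (n : ℤ) :
    (trunc N ε).digit n ≤ ε.digit n := by
  rw [digit_trunc]; split_ifs <;> simp

lemma toL1_apply (ε : PrimarySpace lam) (n : ℤ) :
    ε.toL1 n = (ε.digit n : ℝ) * lam⁻¹ ^ n.natAbs := rfl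

lemma isInducing_toL1 : IsInducing (toL1 : PrimarySpace lam → _) := ⟨rfl⟩

lemma toL1_zero : (0 : PrimarySpace lam).toL1 = 0 := by
  ext n; simp [toL1_apply]

lemma continuous_digit (hl : lam ≠ 0) (n : ℤ) :
    Continuous fun ε : PrimarySpace lam => ε.digit n := by
  rw [Nat.isClosedEmbedding_coe_real.isInducing.continuous_iff]
  have h1 : Continuous fun f : lp (fun _ : ℤ => ℝ) 1 => f n :=
    (continuous_apply n).comp (lp.uniformContinuous_coe).continuous
  have h2 := (h1.comp (isInducing_toL1 (lam := lam)).continuous).mul_const (lam ^ n.natAbs : ℝ)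
  refine h2.congr fun ε => ?_
  simp [toL1_apply, hl]

lemma isClosed_shiftAdmissible (hl : lam ≠ 0) (d : ℕ → ℕ) :
    IsClosed {ε : PrimarySpace lam | ShiftAdmissible d ε.digit} :=
  (ArithmeticCoding.isClosed_shiftAdmissible d).preimage (continuous_pi (continuous_digit hl))

lemma toL1_trunc (N : ℕ) (ε : PrimarySpace lam) :
    (trunc N ε).toL1 = ∑ n ∈ Finset.Icc (-(N : ℤ)) N, lp.single 1 n (ε.toL1 n) := by
  ext n
  rw [toL1_apply, digit_trunc, lp.coeFn_sum, Finset.sum_apply]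
  simp only [lp.coeFn_single, Pi.single_apply, Finset.sum_ite_eq, toL1_apply]
  split_ifs <;> simp

lemma tendsto_trunc (ε : PrimarySpace lam) :
    Tendsto (fun N => trunc N ε) atTop (𝓝 ε) := by
  rw [isInducing_toL1.tendsto_nhds_iff]
  have := (lp.hasSum_single ENNReal.one_ne_top ε.toL1).comp (Finset.tendsto_Icc_neg (R := ℤ))
  refine this.congr fun N => ?_
  simp only [Function.comp, toL1_trunc]

lemma toL1_single (n : ℤ) : (single lam n).toL1 = lp.single 1 n (lam⁻¹ ^ n.natAbs) := by
  ext m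
  rw [toL1_apply, lp.coeFn_single, Pi.single_apply, digit_single]
  split_ifs with h
  · simp [h]
  · simp

lemma tendsto_single (hl : 1 < lam) {l : Filter ℤ} (h : Tendsto Int.natAbs l atTop) :
    Tendsto (fun n => single lam n) l (𝓝 0) := by
  rw [isInducing_toL1.tendsto_nhds_iff, toL1_zero, tendsto_zero_iff_norm_tendsto_zero]
  have h2 : Tendsto (fun n : ℕ => lam⁻¹ ^ n) atTop (𝓝 0) :=
    tendsto_pow_atTop_nhds_zero_of_lt_one (by positivity) (inv_lt_one_of_one_lt₀ hl)
  refine (h2.comp h).congr fun n => ?_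
  simp only [Function.comp, toL1_single]
  rw [lp.norm_single one_pos, Real.norm_of_nonneg (by positivity)]

lemma continuous_tsum_toL1 {g : ℕ → ℤ} (hg : Function.Injective g) {c : ℕ → ℝ}
    (hc : ∀ j, |c j| ≤ 1) :
    Continuous fun ε : PrimarySpace lam => ∑' j, c j * ε.toL1 (g j) :=
  (continuous_tsum_mul_comp hg hc).comp isInducing_toL1.continuous

lemma fwdSeq_digit (ε : PrimarySpace lam) (N : ℤ) : fwdSeq ε.digit N = ε.tail N := rfl

lemma dropSeq_tail (ε : PrimarySpace lam) (N : ℤ) (k : ℕ) :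
    dropSeq k (ε.tail N) = ε.tail (N + k) :=
  dropSeq_fwdSeq ε.digit N k

lemma tail_shift (ε : PrimarySpace lam) (N : ℤ) : ε.shift.tail N = ε.tail (N + 1) := by
  funext j
  simp only [tail, digit_shift]
  congr 1; ring

lemma seqSummable_tail_one (ε : PrimarySpace lam) :
    SeqSummable lam⁻¹ (ε.tail 1) := by
  have h := (summable_nat_add_iff 1).2 (Subtype.property ε).1
  refine h.congr fun n => ?_
  simp only [tail, digit]
  rw [show ((n + 1 : ℕ) : ℤ) = 1 + n by push_cast; ring]

lemma seqSummable_tail (hl : 1 < lam) (ε : PrimarySpace lam) (N : ℤ) :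
    SeqSummable lam⁻¹ (ε.tail N) := by
  have h0 : (0 : ℝ) < lam⁻¹ := by positivity
  obtain ⟨k, hk | hk⟩ : ∃ k : ℕ, N = 1 + k ∨ N = 1 - k := ⟨(N - 1).natAbs, by omega⟩
  · have := (seqSummable_tail_one ε).drop h0 k
    rwa [dropSeq_tail, ← hk] at this
  · have h1 := ((seqSummable_tail_one ε).mul_left (lam⁻¹ ^ k))
    refine (summable_nat_add_iff k).1 (h1.congr fun j => ?_)
    simp only [tail, hk]
    rw [show (1 : ℤ) - k + ((j + k : ℕ) : ℤ) = 1 + j by push_cast; ring]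
    ring

end PrimarySpace

/-! ### The torus -/

/-- Reduction modulo `ℤ²` as a group homomorphism. -/
def torusProjHom : (Fin 2 → ℝ) →+ UnitAddTorus (Fin 2) where
  toFun := torusProj
  map_zero' := by funext; simp [torusProj]
  map_add' v w := by funext; simp [torusProj]

lemma torusProjHom_apply (v : Fin 2 → ℝ) : torusProjHom v = torusProj v := rfl

lemma torusProj_add (v w : Fin 2 → ℝ) : torusProj (v + w) = torusProj v + torusProj w :=
  map_add torusProjHom v w

lemma torusProj_sub (v w : Fin 2 → ℝ) : torusProj (v - w) = torusProj v - torusProj w :=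
  map_sub torusProjHom v w

lemma torusProj_zero : torusProj 0 = 0 := map_zero torusProjHom

lemma torusProj_nsmul (k : ℕ) (w : Fin 2 → ℝ) : torusProj ((k : ℝ) • w) = k • torusProj w := by
  rw [Nat.cast_smul_eq_nsmul]
  exact map_nsmul torusProjHom k w

lemma continuous_torusProj : Continuous torusProj :=
  continuous_pi fun i => (AddCircle.continuous_mk' 1).comp (continuous_apply i)

/-- An integer vector as a real vector. -/
def intVec (k : Fin 2 → ℤ) : Fin 2 → ℝ := fun i => (k i : ℝ)

lemma torusProj_eq_zero_iff (v : Fin 2 → ℝ) : torusProj v = 0 ↔ ∃ k, v = intVec k := by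
  constructor
  · intro h
    have hint : ∀ i, ∃ k : ℤ, (k : ℝ) = v i := fun i => by
      obtain ⟨k, hk⟩ := (AddCircle.coe_eq_zero_iff (1 : ℝ)).1 (congrFun h i)
      exact ⟨k, by simpa using hk⟩
    choose k hk using hint
    exact ⟨k, funext fun i => (hk i).symm⟩
  · rintro ⟨k, rfl⟩
    funext i
    exact (AddCircle.coe_eq_zero_iff (1 : ℝ)).2 ⟨k i, by simp [intVec]⟩

lemma torusProj_eq_iff (v w : Fin 2 → ℝ) :
    torusProj v = torusProj w ↔ ∃ k, v = w + intVec k := by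
  rw [← sub_eq_zero, ← torusProj_sub, torusProj_eq_zero_iff]
  simp only [sub_eq_iff_eq_add']

lemma torusProj_intVec (k : Fin 2 → ℤ) : torusProj (intVec k) = 0 :=
  (torusProj_eq_zero_iff _).2 ⟨k, rfl⟩

/-- The representative of a point of the torus with coordinates in `(0, 1]`. -/
noncomputable def torusLift (x : UnitAddTorus (Fin 2)) : Fin 2 → ℝ :=
  fun i => (AddCircle.equivIoc (1 : ℝ) 0 (x i) : ℝ)

/-- The half-open unit square `(0, 1]²`, a fundamental domain of `ℤ²`. -/
def unitSquare : Set (Fin 2 → ℝ) := Set.univ.pi fun _ => Set.Ioc 0 1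

lemma torusProj_torusLift (x : UnitAddTorus (Fin 2)) : torusProj (torusLift x) = x := by
  funext i
  exact (AddCircle.equivIoc (1 : ℝ) 0).symm_apply_apply (x i)

lemma torusProj_surjective : Function.Surjective torusProj :=
  fun x => ⟨_, torusProj_torusLift x⟩

lemma torusLift_mem (x : UnitAddTorus (Fin 2)) : torusLift x ∈ unitSquare := fun i _ => by
  have := (AddCircle.equivIoc (1 : ℝ) 0 (x i)).2
  simpa [torusLift] using this

lemma measurePreserving_torusLift :
    MeasurePreserving torusLift volume (volume.restrict unitSquare) := by
  have hcircle : MeasurePreserving (fun x : UnitAddCircle => (AddCircle.equivIoc (1 : ℝ) 0 x : ℝ))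
      volume (volume.restrict (Set.Ioc 0 1)) := by
    simpa [Function.comp_def] using (measurePreserving_subtype_coe (μa := (volume : Measure ℝ))
      (measurableSet_Ioc (a := (0 : ℝ)) (b := 0 + 1))).comp
        (AddCircle.measurePreserving_equivIoc 1 (a := 0))
  have hpi := measurePreserving_pi (fun _ : Fin 2 => (volume : Measure UnitAddCircle))
    (fun _ : Fin 2 => (volume : Measure ℝ).restrict (Set.Ioc 0 1)) (fun _ => hcircle)
  rwa [← Measure.restrict_pi_pi] at hpi

lemma volume_unitSquare : volume unitSquare = 1 := by
  simp [unitSquare, volume_pi_pi]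

lemma measurableSet_unitSquare : MeasurableSet unitSquare :=
  MeasurableSet.univ_pi fun _ => measurableSet_Ioc

lemma volume_image_torusProj_eq_zero {S : Set (Fin 2 → ℝ)} (hS : volume S = 0) :
    volume (torusProj '' S) = 0 := by
  have htranslates : volume (⋃ k, (fun v => v + intVec k) ⁻¹' S) = 0 := by
    rw [measure_iUnion_null_iff]
    intro k
    rwa [measure_preimage_add_right]
  refine measure_mono_null ?_ (measurePreserving_torusLift.quasiMeasurePreserving.preimage_null
    (Measure.absolutelyContinuous_of_le Measure.restrict_le_self htranslates))
  rintro _ ⟨v, hv, rfl⟩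
  obtain ⟨k, hk⟩ := (torusProj_eq_iff v (torusLift (torusProj v))).1 (torusProj_torusLift _).symm
  simp only [Set.mem_preimage, Set.mem_iUnion]
  exact ⟨k, hk ▸ hv⟩

lemma existsUnique_add_intVec_mem (p : Fin 2 → ℝ) : ∃! k, p + intVec k ∈ unitSquare := by
  have h : ∀ i, ∃! k : ℤ, p i + k ∈ Set.Ioc (0 : ℝ) 1 := fun i => by
    simpa using existsUnique_add_zsmul_mem_Ioc (one_pos : (0 : ℝ) < 1) (p i) 0
  choose k hk hk' using h
  exact ⟨k, fun i _ => hk i, fun l hl => funext fun i => hk' i (l i) (hl i trivial)⟩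

/-- The number of points of `B` congruent to `p` modulo `ℤ²`. -/
noncomputable def multiplicity (B : Set (Fin 2 → ℝ)) (p : Fin 2 → ℝ) : ENNReal :=
  ∑' k, ((fun v => v + intVec k) ⁻¹' B).indicator 1 p

lemma measurableSet_preimage_add_intVec {B : Set (Fin 2 → ℝ)} (hB : MeasurableSet B)
    (k : Fin 2 → ℤ) : MeasurableSet ((fun v => v + intVec k) ⁻¹' B) :=
  hB.preimage (by fun_prop)

lemma measurable_multiplicity {B : Set (Fin 2 → ℝ)} (hB : MeasurableSet B) :
    Measurable (multiplicity B) :=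
  Measurable.tsum fun k => measurable_one.indicator (measurableSet_preimage_add_intVec hB k)

lemma volume_preimage_add_intVec_inter (B S : Set (Fin 2 → ℝ)) (k : Fin 2 → ℤ) :
    volume ((fun v => v + intVec k) ⁻¹' B ∩ S) =
      volume (B ∩ (fun v => v + intVec (-k)) ⁻¹' S) := by
  rw [← measure_preimage_add_right volume (intVec k)
    (B ∩ (fun v => v + intVec (-k)) ⁻¹' S)]
  congr 1
  ext v
  have : v + intVec k + intVec (-k) = v := by
    funext i; simp [intVec]
  simp [this]

lemma tsum_volume_inter_unitSquare {B : Set (Fin 2 → ℝ)} (hB : MeasurableSet B) :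
    ∑' k, volume ((fun v => v + intVec k) ⁻¹' B ∩ unitSquare) = volume B := by
  simp_rw [volume_preimage_add_intVec_inter]
  have hdisj : Pairwise (Function.onFun Disjoint fun k =>
      B ∩ (fun v => v + intVec (-k)) ⁻¹' unitSquare) := fun k l hkl =>
    Set.disjoint_left.2 fun p hp hp' =>
      hkl (neg_injective ((existsUnique_add_intVec_mem p).unique hp.2 hp'.2))
  rw [← measure_iUnion hdisj fun k =>
    hB.inter (measurableSet_preimage_add_intVec measurableSet_unitSquare (-k)),
    ← Set.inter_iUnion, Set.inter_eq_left.2 fun p _ => ?_]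
  obtain ⟨k, hk, -⟩ := existsUnique_add_intVec_mem p
  exact Set.mem_iUnion.2 ⟨-k, by simpa using hk⟩

lemma lintegral_multiplicity {B : Set (Fin 2 → ℝ)} (hB : MeasurableSet B) :
    ∫⁻ p in unitSquare, multiplicity B p = volume B := by
  have hmeas := measurableSet_preimage_add_intVec hB
  simp only [multiplicity]
  rw [lintegral_tsum fun k => (measurable_one.indicator (hmeas k)).aemeasurable,
    ← tsum_volume_inter_unitSquare hB]
  refine tsum_congr fun k => ?_
  rw [lintegral_indicator_one (hmeas k), Measure.restrict_apply (hmeas k)]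

lemma one_le_multiplicity {B : Set (Fin 2 → ℝ)} {p q : Fin 2 → ℝ} (hq : q ∈ B)
    (hqp : torusProj q = torusProj p) : 1 ≤ multiplicity B p := by
  obtain ⟨k, rfl⟩ := (torusProj_eq_iff _ _).1 hqp
  refine le_trans ?_ (ENNReal.le_tsum k)
  rw [Set.indicator_of_mem (by exact hq), Pi.one_apply]

lemma eq_of_multiplicity_le_one {B : Set (Fin 2 → ℝ)} {p q v : Fin 2 → ℝ} (hp : p ∈ B)
    (hq : q ∈ B) (hpv : torusProj p = torusProj v) (hqv : torusProj q = torusProj v)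
    (hv : multiplicity B v ≤ 1) : p = q := by
  obtain ⟨k, rfl⟩ := (torusProj_eq_iff _ _).1 hpv
  obtain ⟨l, rfl⟩ := (torusProj_eq_iff _ _).1 hqv
  by_contra hne
  have hkl : k ≠ l := fun e => hne (by rw [e])
  have hpair := (ENNReal.sum_le_tsum (f := fun k => ((fun v => v + intVec k) ⁻¹' B).indicator
    (1 : (Fin 2 → ℝ) → ENNReal) v) {k, l}).trans hv
  rw [Finset.sum_pair hkl, Set.indicator_of_mem (by exact hp),
    Set.indicator_of_mem (by exact hq)] at hpair
  norm_num at hpair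

lemma ae_unique_of_cover {B : Set (Fin 2 → ℝ)} (hB : MeasurableSet B) (hvol : volume B ≤ 1)
    (hcov : ∀ x, ∃ p ∈ B, torusProj p = x) :
    ∀ᵐ x, ∀ p ∈ B, ∀ q ∈ B, torusProj p = x → torusProj q = x → p = q := by
  have hone : ∀ p, 1 ≤ multiplicity B p := fun p =>
    let ⟨_, hq, hqp⟩ := hcov (torusProj p)
    one_le_multiplicity hq hqp
  have hexcess : ∫⁻ p in unitSquare, (multiplicity B p - 1) = 0 := by
    rw [lintegral_sub measurable_const (by simp [volume_unitSquare])
      (Eventually.of_forall hone), lintegral_multiplicity hB]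
    simp [volume_unitSquare, tsub_eq_zero_of_le hvol]
  have hae : ∀ᵐ p ∂(volume.restrict unitSquare), multiplicity B p ≤ 1 := by
    filter_upwards [(lintegral_eq_zero_iff
      ((measurable_multiplicity hB).sub measurable_const)).1 hexcess] with p hp
    exact tsub_eq_zero_iff_le.1 hp
  filter_upwards [measurePreserving_torusLift.quasiMeasurePreserving.ae hae]
    with x hx p hp q hq hpx hqx
  rw [← torusProj_torusLift x] at hpx hqx
  exact eq_of_multiplicity_le_one hp hq hpx hqx hx

/-! ### Integer matrices acting on the torus -/

/-- The real matrix with the given integer entries. -/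
def realMat (C : Matrix (Fin 2) (Fin 2) ℤ) : Matrix (Fin 2) (Fin 2) ℝ := C.map (Int.cast : ℤ → ℝ)

lemma realMat_mul (A C : Matrix (Fin 2) (Fin 2) ℤ) : realMat (A * C) = realMat A * realMat C :=
  Matrix.map_mul (f := Int.castRingHom ℝ)

lemma realMat_one : realMat 1 = 1 := by simp [realMat]

/-- The endomorphism of the torus given by an integer matrix. -/
def intMap (C : Matrix (Fin 2) (Fin 2) ℤ) : UnitAddTorus (Fin 2) →+ UnitAddTorus (Fin 2) where
  toFun x := fun i => ∑ j, C i j • x j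
  map_zero' := by funext; simp
  map_add' x y := by funext; simp [smul_add, Finset.sum_add_distrib]

lemma toralMap_eq (M : GL (Fin 2) ℤ) (x : UnitAddTorus (Fin 2)) : toralMap M x = intMap M.1 x := rfl

lemma continuous_intMap (C : Matrix (Fin 2) (Fin 2) ℤ) : Continuous (intMap C) :=
  continuous_pi fun i => continuous_finsetSum Finset.univ fun j _ =>
    (continuous_zsmul (C i j)).comp (continuous_apply (A := fun _ => UnitAddCircle) j)

lemma intMap_torusProj (C : Matrix (Fin 2) (Fin 2) ℤ) (v : Fin 2 → ℝ) :
    intMap C (torusProj v) = torusProj ((realMat C).mulVec v) := by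
  funext
  simp [intMap, torusProj, realMat, Matrix.mulVec, dotProduct, ← zsmul_eq_mul]

lemma intMap_mul (A C : Matrix (Fin 2) (Fin 2) ℤ) (x : UnitAddTorus (Fin 2)) :
    intMap (A * C) x = intMap A (intMap C x) := by
  obtain ⟨v, rfl⟩ := torusProj_surjective x
  simp only [intMap_torusProj, realMat_mul, Matrix.mulVec_mulVec]

lemma intMap_one (x : UnitAddTorus (Fin 2)) : intMap 1 x = x := by
  obtain ⟨v, rfl⟩ := torusProj_surjective x
  simp [intMap_torusProj, realMat_one]

lemma realMat_mulVec_intVec (C : Matrix (Fin 2) (Fin 2) ℤ) (k : Fin 2 → ℤ) :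
    (realMat C).mulVec (intVec k) = intVec (C.mulVec k) := by
  funext
  simp [intVec, realMat, Matrix.mulVec, dotProduct]

lemma intMap_inv_intMap {C : Matrix (Fin 2) (Fin 2) ℤ} (hC : IsUnit C.det)
    (x : UnitAddTorus (Fin 2)) : intMap C⁻¹ (intMap C x) = x := by
  rw [← intMap_mul, Matrix.nonsing_inv_mul _ hC, intMap_one]

lemma intMap_intMap_inv {C : Matrix (Fin 2) (Fin 2) ℤ} (hC : IsUnit C.det)
    (x : UnitAddTorus (Fin 2)) : intMap C (intMap C⁻¹ x) = x := by
  rw [← intMap_mul, Matrix.mul_nonsing_inv _ hC, intMap_one]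

lemma intMap_injective {C : Matrix (Fin 2) (Fin 2) ℤ} (hC : IsUnit C.det) :
    Function.Injective (intMap C) :=
  Function.LeftInverse.injective (intMap_inv_intMap hC)

lemma measurePreserving_intMap {C : Matrix (Fin 2) (Fin 2) ℤ} (hC : IsUnit C.det) :
    MeasurePreserving (intMap C) volume volume :=
  AddMonoidHom.measurePreserving (continuous_intMap C) (fun x => ⟨_, intMap_intMap_inv hC x⟩) rfl

lemma intVec_injective : Function.Injective intVec := fun _ _ h =>
  funext fun i => Int.cast_injective (congrFun h i)

lemma exists_eq_intVec_of_injective {C : Matrix (Fin 2) (Fin 2) ℤ}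
    (hC : Function.Injective (intMap C)) {v : Fin 2 → ℝ} {k : Fin 2 → ℤ}
    (h : (realMat C).mulVec v = intVec k) : ∃ l, v = intVec l := by
  rw [← torusProj_eq_zero_iff]
  apply hC
  rw [intMap_torusProj, h, torusProj_intVec, map_zero]

lemma det_realMat_ne_zero_of_injective {C : Matrix (Fin 2) (Fin 2) ℤ}
    (hC : Function.Injective (intMap C)) : (realMat C).det ≠ 0 := by
  intro hdet
  obtain ⟨v, hv, hCv⟩ := Matrix.exists_mulVec_eq_zero_iff.2 hdet
  obtain ⟨i, hi⟩ := Function.ne_iff.1 hv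
  -- a kernel vector rescaled to have a coordinate `1 / 2` would have to be integral
  obtain ⟨l, hl⟩ := exists_eq_intVec_of_injective hC (v := (2 * v i)⁻¹ • v) (k := 0) (by
    rw [Matrix.mulVec_smul, hCv]; funext; simp [intVec])
  have hhalf := congrFun hl i
  simp only [Pi.zero_apply] at hi
  simp only [Pi.smul_apply, smul_eq_mul, intVec] at hhalf
  have hone : (2 * l i : ℝ) = 1 := by rw [← hhalf]; field_simp
  have : 2 * l i = 1 := by exact_mod_cast hone
  omega

lemma isUnit_det_of_injective {C : Matrix (Fin 2) (Fin 2) ℤ} (hC : Function.Injective (intMap C)) :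
    IsUnit C.det := by
  have hdet : IsUnit (realMat C).det := (det_realMat_ne_zero_of_injective hC).isUnit
  have hsurj : Function.Surjective C.mulVec := fun k => by
    have hk : (realMat C).mulVec ((realMat C)⁻¹.mulVec (intVec k)) = intVec k := by
      rw [Matrix.mulVec_mulVec, Matrix.mul_nonsing_inv _ hdet, Matrix.one_mulVec]
    obtain ⟨l, hl⟩ := exists_eq_intVec_of_injective hC hk
    exact ⟨l, intVec_injective (by rw [← realMat_mulVec_intVec, ← hl, hk])⟩
  exact (Matrix.isUnit_iff_isUnit_det C).1 (Matrix.mulVec_surjective_iff_isUnit.1 hsurj)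

/-! ### Expansions in a quadratic unit base -/

/-- `lam > 1` is the larger root of `x² - r x + σ`, where `σ = ±1` and the roots are real,
of positive sum and not of modulus one. -/
structure IsQuadUnit (r σ : ℤ) (lam : ℝ) : Prop where
  one_lt : 1 < lam
  eqn : lam ^ 2 = r * lam - σ
  sign : (σ = 1 ∧ 3 ≤ r) ∨ (σ = -1 ∧ 1 ≤ r)

/-- The quasi-greedy expansion of `1` in base `lam`: `(r - 1) (r - 2) (r - 2) …` if `σ = 1` and
`r 0 r 0 …` if `σ = -1`. -/
def quasiGreedy (r σ : ℤ) : ℕ → ℕ := fun n =>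
  if σ = 1 then (if n = 0 then (r - 1).toNat else (r - 2).toNat)
  else if Even n then r.toNat else 0

lemma quasiGreedy_le (r σ : ℤ) (n : ℕ) : quasiGreedy r σ n ≤ r.toNat := by
  unfold quasiGreedy
  split_ifs <;> omega

lemma cast_toNat {n : ℤ} (hn : 0 ≤ n) : ((n.toNat : ℕ) : ℝ) = n :=
  mod_cast Int.toNat_of_nonneg hn

lemma dropSeq_quasiGreedy_one (r : ℤ) {k : ℕ} (hk : 0 < k) :
    dropSeq k (quasiGreedy r 1) = fun _ => (r - 2).toNat := by
  funext j
  have : k + j ≠ 0 := by omega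
  simp only [dropSeq, quasiGreedy, if_true, this, if_false]

lemma dropSeq_quasiGreedy_neg_one_of_even (r : ℤ) {k : ℕ} (hk : Even k) :
    dropSeq k (quasiGreedy r (-1)) = quasiGreedy r (-1) := by
  funext j
  simp [dropSeq, quasiGreedy, Nat.even_add, hk]

lemma dropSeq_quasiGreedy_neg_one_of_not_even (r : ℤ) {k : ℕ} (hk : ¬ Even k) :
    dropSeq k (quasiGreedy r (-1)) = dropSeq 1 (quasiGreedy r (-1)) := by
  funext j
  simp [dropSeq, quasiGreedy, Nat.even_add, hk]

namespace IsQuadUnit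

variable {r σ : ℤ} {lam : ℝ} (h : IsQuadUnit r σ lam)
include h

lemma pos : 0 < lam := zero_lt_one.trans h.one_lt

lemma inv_pos : 0 < lam⁻¹ := _root_.inv_pos.2 h.pos

lemma inv_lt_one : lam⁻¹ < 1 := inv_lt_one_of_one_lt₀ h.one_lt

lemma mul_inv : lam * lam⁻¹ = 1 := mul_inv_cancel₀ h.pos.ne'

lemma conj_eq : (σ : ℝ) * lam⁻¹ = r - lam := by
  have heqn := h.eqn
  have hpos := h.pos
  field_simp
  linarith

lemma abs_sign : |(σ : ℝ)| = 1 := by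
  rcases h.sign with ⟨rfl, -⟩ | ⟨rfl, -⟩ <;> simp

lemma isUnit_sign : IsUnit σ := by
  rcases h.sign with ⟨rfl, -⟩ | ⟨rfl, -⟩ <;> simp

lemma lam_sub_conj_pos : 0 < lam - σ * lam⁻¹ := by
  have hlam := h.one_lt
  have hinv := h.inv_lt_one
  have hinv0 := h.inv_pos
  rcases h.sign with ⟨rfl, -⟩ | ⟨rfl, -⟩ <;> push_cast <;> linarith

lemma sqrt_discrim : lam - σ * lam⁻¹ = √((r ^ 2 - 4 * σ : ℤ) : ℝ) := by
  symm
  rw [Real.sqrt_eq_iff_mul_self_eq_of_pos h.lam_sub_conj_pos, h.conj_eq]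
  push_cast
  linear_combination 4 * h.eqn

lemma not_isSquare_discrim : ¬ IsSquare (r ^ 2 - 4 * σ) := by
  rintro ⟨y, hy⟩
  rw [← abs_mul_abs_self] at hy
  have hnonneg := abs_nonneg y
  generalize |y| = z at hy hnonneg
  rcases h.sign with ⟨rfl, hr⟩ | ⟨rfl, hr⟩
  · have hlt : z < r := by nlinarith
    have hgt : r - 1 < z := by nlinarith
    omega
  · have hgt : r < z := by nlinarith
    have hlt : z < r + 2 := by nlinarith
    obtain rfl : z = r + 1 := by omega
    ring_nf at hy
    omega

lemma irrational : Irrational lam := by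
  have hdiscrim : 0 < r ^ 2 - 4 * σ := by
    exact_mod_cast Real.sqrt_pos.1 (h.sqrt_discrim ▸ h.lam_sub_conj_pos)
  have hsqrt := irrational_sqrt_intCast_iff.2 ⟨h.not_isSquare_discrim, hdiscrim.le⟩
  rw [← h.sqrt_discrim, h.conj_eq] at hsqrt
  rintro ⟨q, rfl⟩
  exact hsqrt ⟨2 * q - r, by push_cast; ring⟩

lemma irrational_conj : Irrational ((σ : ℝ) * lam⁻¹) := by
  rw [h.conj_eq]
  exact h.irrational.intCast_sub r

lemma summable_of_le {a : ℕ → ℕ} {B : ℕ} (ha : ∀ j, a j ≤ B) : SeqSummable lam⁻¹ a :=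
  seqSummable_of_le h.inv_pos h.inv_lt_one ha

lemma summable_quasiGreedy : SeqSummable lam⁻¹ (quasiGreedy r σ) :=
  h.summable_of_le (quasiGreedy_le r σ)

lemma quasiGreedy_zero_pos : 0 < quasiGreedy r σ 0 := by
  rcases h.sign with ⟨rfl, hr⟩ | ⟨rfl, hr⟩ <;> simp [quasiGreedy] <;> omega

lemma quasiGreedy_infinite (n : ℕ) : ∃ m, n ≤ m ∧ quasiGreedy r σ m ≠ 0 := by
  rcases h.sign with ⟨rfl, hr⟩ | ⟨rfl, hr⟩
  · refine ⟨n, le_rfl, ?_⟩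
    simp only [quasiGreedy, if_true]
    split_ifs <;> omega
  · refine ⟨2 * n, by omega, ?_⟩
    simp [quasiGreedy]
    omega

lemma cast_quasiGreedy_zero :
    (quasiGreedy r σ 0 : ℝ) = if σ = 1 then (r : ℝ) - 1 else r := by
  rcases h.sign with ⟨rfl, hr⟩ | ⟨rfl, hr⟩
  · simp only [quasiGreedy, if_true, cast_toNat (show 0 ≤ r - 1 by omega), Int.cast_sub,
      Int.cast_one]
  · simp [quasiGreedy, cast_toNat (show 0 ≤ r by omega)]

lemma seqVal_const (hσ : σ = 1) : seqVal lam⁻¹ (fun _ => (r - 2).toNat) = 1 - lam⁻¹ := by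
  subst hσ
  have hr : 3 ≤ r := by rcases h.sign with hr | hr <;> omega
  set v := seqVal lam⁻¹ fun _ => (r - 2).toNat
  have hv : v = lam⁻¹ * (((r - 2).toNat : ℕ) + v) :=
    seqVal_eq_head_add (h.summable_of_le fun _ => le_rfl)
  rw [cast_toNat (by omega)] at hv
  have hconj := h.conj_eq
  push_cast at hv hconj
  have hmul : (1 - lam⁻¹) * v = (1 - lam⁻¹) * (1 - lam⁻¹) := by
    linear_combination hv - lam⁻¹ * hconj + h.mul_inv
  exact mul_left_cancel₀ (sub_pos.2 h.inv_lt_one).ne' hmul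

lemma seqVal_quasiGreedy : seqVal lam⁻¹ (quasiGreedy r σ) = 1 := by
  have hsum := h.summable_quasiGreedy
  have hconj := h.conj_eq
  have hhead := h.cast_quasiGreedy_zero
  rcases h.sign with ⟨rfl, -⟩ | ⟨rfl, -⟩
  · rw [seqVal_eq_head_add hsum, dropSeq_quasiGreedy_one r one_pos, h.seqVal_const rfl, hhead]
    push_cast at hconj
    simp only [if_true]
    linear_combination h.mul_inv - lam⁻¹ * hconj
  · have hv := seqVal_eq_sum_add hsum 2
    rw [dropSeq_quasiGreedy_neg_one_of_even r even_two, Finset.sum_range_succ,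
      Finset.sum_range_one, hhead, show quasiGreedy r (-1) 1 = 0 by simp [quasiGreedy]] at hv
    norm_num at hv hconj
    have hne : 1 - lam⁻¹ ^ 2 ≠ 0 := by nlinarith [h.inv_pos, h.inv_lt_one]
    refine mul_left_cancel₀ hne ?_
    linear_combination hv - lam⁻¹ * hconj + h.mul_inv

lemma seqVal_dropSeq_quasiGreedy_le (k : ℕ) :
    seqVal lam⁻¹ (dropSeq k (quasiGreedy r σ)) ≤ 1 := by
  have hval := h.seqVal_quasiGreedy
  have hinv := h.inv_pos
  rcases h.sign with ⟨rfl, -⟩ | ⟨rfl, -⟩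
  · rcases Nat.eq_zero_or_pos k with rfl | hk
    · rw [dropSeq_zero, hval]
    · rw [dropSeq_quasiGreedy_one r hk, h.seqVal_const rfl]
      linarith
  · by_cases hk : Even k
    · rw [dropSeq_quasiGreedy_neg_one_of_even r hk, hval]
    · rw [dropSeq_quasiGreedy_neg_one_of_not_even r hk]
      rw [seqVal_eq_head_add h.summable_quasiGreedy, h.cast_quasiGreedy_zero] at hval
      have hconj := h.conj_eq
      norm_num at hval hconj
      rw [inv_mul_eq_one₀ h.pos.ne'] at hval
      linarith [h.inv_lt_one]

lemma seqVal_le_one {a : ℕ → ℕ} (ha : LexAdmissible (quasiGreedy r σ) a) : seqVal lam⁻¹ a ≤ 1 :=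
  ha.seqVal_le_one h.inv_pos h.inv_lt_one h.summable_quasiGreedy h.seqVal_quasiGreedy

lemma seqVal_lt_one {a : ℕ → ℕ} (ha : LexAdmissible (quasiGreedy r σ) a) {n : ℕ}
    (hn : ∀ m, n ≤ m → a m = 0) : seqVal lam⁻¹ a < 1 :=
  ha.seqVal_lt_one h.inv_pos h.inv_lt_one h.summable_quasiGreedy h.seqVal_quasiGreedy
    h.quasiGreedy_infinite hn

lemma lexAdmissible_of_seqVal_lt_one {a : ℕ → ℕ} (has : SeqSummable lam⁻¹ a)
    (ha : ∀ k, seqVal lam⁻¹ (dropSeq k a) < 1) : LexAdmissible (quasiGreedy r σ) a :=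
  ArithmeticCoding.lexAdmissible_of_seqVal_lt_one h.inv_pos h.summable_quasiGreedy
    h.seqVal_quasiGreedy h.seqVal_dropSeq_quasiGreedy_le has ha

end IsQuadUnit

/-- The orbit of `t` under the transformation `x ↦ {lam x}`. -/
noncomputable def greedyOrbit (lam t : ℝ) (n : ℕ) : ℝ := (fun x => Int.fract (lam * x))^[n] t

/-- The digits of the greedy expansion of `t` in base `lam`. -/
noncomputable def greedyDigit (lam t : ℝ) (n : ℕ) : ℕ := ⌊lam * greedyOrbit lam t n⌋₊

section Greedy

variable {lam t : ℝ}

lemma greedyOrbit_succ (lam t : ℝ) (n : ℕ) :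
    greedyOrbit lam t (n + 1) = Int.fract (lam * greedyOrbit lam t n) :=
  Function.iterate_succ_apply' _ _ _

lemma greedyOrbit_mem (lam : ℝ) (ht : t ∈ Set.Ico (0 : ℝ) 1) (n : ℕ) :
    greedyOrbit lam t n ∈ Set.Ico (0 : ℝ) 1 := by
  cases n with
  | zero => exact ht
  | succ n => rw [greedyOrbit_succ]; exact ⟨Int.fract_nonneg _, Int.fract_lt_one _⟩

lemma cast_greedyDigit (hl : 0 < lam) (ht : t ∈ Set.Ico (0 : ℝ) 1) (n : ℕ) :
    (greedyDigit lam t n : ℝ) = lam * greedyOrbit lam t n - greedyOrbit lam t (n + 1) := by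
  rw [greedyOrbit_succ, Int.self_sub_fract, greedyDigit]
  exact_mod_cast Int.natCast_floor_eq_floor (mul_nonneg hl.le (greedyOrbit_mem lam ht n).1)

lemma greedyDigit_le (hl : 0 < lam) (ht : t ∈ Set.Ico (0 : ℝ) 1) (n : ℕ) :
    greedyDigit lam t n ≤ ⌊lam⌋₊ :=
  Nat.floor_le_floor (mul_le_of_le_one_right hl.le (greedyOrbit_mem lam ht n).2.le)

lemma sum_range_greedyDigit (hl : 0 < lam) (ht : t ∈ Set.Ico (0 : ℝ) 1) (k n : ℕ) :
    ∑ j ∈ Finset.range n, (dropSeq k (greedyDigit lam t) j : ℝ) * lam⁻¹ ^ (j + 1) =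
      greedyOrbit lam t k - lam⁻¹ ^ n * greedyOrbit lam t (k + n) := by
  induction n with
  | zero => simp
  | succ n ih =>
    rw [Finset.sum_range_succ, ih, dropSeq, cast_greedyDigit hl ht, pow_succ, ← add_assoc]
    linear_combination (greedyOrbit lam t (k + n) * lam⁻¹ ^ n) * mul_inv_cancel₀ hl.ne'

lemma seqVal_dropSeq_greedyDigit (hl : 1 < lam) (ht : t ∈ Set.Ico (0 : ℝ) 1) (k : ℕ) :
    seqVal lam⁻¹ (dropSeq k (greedyDigit lam t)) = greedyOrbit lam t k := by
  have hpos := zero_lt_one.trans hl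
  have hinv : 0 < lam⁻¹ := inv_pos.2 hpos
  have hinv1 := inv_lt_one_of_one_lt₀ hl
  have hsum := (seqSummable_of_le hinv hinv1 (greedyDigit_le hpos ht)).drop hinv k
  have hrem : Tendsto (fun n => lam⁻¹ ^ n * greedyOrbit lam t (k + n)) atTop (𝓝 0) := by
    have hpow (n : ℕ) : 0 ≤ lam⁻¹ ^ n := pow_nonneg hinv.le n
    exact squeeze_zero (fun n => mul_nonneg (hpow n) (greedyOrbit_mem lam ht _).1)
      (fun n => mul_le_of_le_one_right (hpow n) (greedyOrbit_mem lam ht _).2.le)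
      (tendsto_pow_atTop_nhds_zero_of_lt_one hinv.le hinv1)
  refine tendsto_nhds_unique hsum.hasSum.tendsto_sum_nat ?_
  simp_rw [sum_range_greedyDigit hpos ht]
  simpa using hrem.const_sub (greedyOrbit lam t k)

end Greedy

lemma IsQuadUnit.exists_expansion {r σ : ℤ} {lam t : ℝ} (h : IsQuadUnit r σ lam)
    (ht : t ∈ Set.Ico (0 : ℝ) 1) :
    ∃ a, LexAdmissible (quasiGreedy r σ) a ∧ seqVal lam⁻¹ a = t := by
  refine ⟨greedyDigit lam t, h.lexAdmissible_of_seqVal_lt_one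
    (h.summable_of_le (greedyDigit_le h.pos ht)) fun k => ?_,
    by simpa [greedyOrbit] using seqVal_dropSeq_greedyDigit h.one_lt ht 0⟩
  rw [seqVal_dropSeq_greedyDigit h.one_lt ht]
  exact (greedyOrbit_mem lam ht k).2

/-! ### The coding attached to the companion matrix -/

/-- The companion matrix of `x² - r x + σ`. -/
def companion (r σ : ℤ) : Matrix (Fin 2) (Fin 2) ℤ := !![0, -σ; 1, r]

/-- The point `(p, q)` of the plane with `p + q λ = x` and `p + q λ' = -y`, where `λ' = σ / λ`:
`x` and `-y` are its coordinates along the eigenlines of the companion matrix. -/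
noncomputable def eigenPoint (lam : ℝ) (σ : ℤ) (x y : ℝ) : Fin 2 → ℝ :=
  ![x - (x + y) / (lam - σ * lam⁻¹) * lam, (x + y) / (lam - σ * lam⁻¹)]

/-- The representative of the homoclinic point of the companion matrix on the unstable line. -/
noncomputable def unstableVec (lam : ℝ) (σ : ℤ) : Fin 2 → ℝ := eigenPoint lam σ 1 0

/-- The coordinate `∑_{n > N} e_n λ^{N-n}`. -/
noncomputable def fwdCoord (lam : ℝ) (e : ℤ → ℕ) (N : ℤ) : ℝ := seqVal lam⁻¹ (fwdSeq e (N + 1))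

/-- The coordinate `∑_{n ≤ N} e_n λ'^{N-n}`, where `λ' = σ / λ`. -/
noncomputable def bwdCoord (lam : ℝ) (σ : ℤ) (e : ℤ → ℕ) (N : ℤ) : ℝ :=
  ∑' j, (bwdSeq e N j : ℝ) * (σ * lam⁻¹) ^ j

/-- The point of the plane whose coordinates along the eigenlines of the companion matrix are the
values of the two halves of `e` at `N`. -/
noncomputable def coordVec (lam : ℝ) (σ : ℤ) (e : ℤ → ℕ) (N : ℤ) : Fin 2 → ℝ :=
  eigenPoint lam σ (fwdCoord lam e N) (bwdCoord lam σ e N)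

lemma det_companion (r σ : ℤ) : (companion r σ).det = σ := by
  simp [companion, Matrix.det_fin_two]

lemma eigenPoint_fwd (lam : ℝ) (σ : ℤ) (x y : ℝ) :
    eigenPoint lam σ x y 0 + eigenPoint lam σ x y 1 * lam = x := by
  simp [eigenPoint]

lemma eigenPoint_add (lam : ℝ) (σ : ℤ) (x y x' y' : ℝ) :
    eigenPoint lam σ (x + x') (y + y') = eigenPoint lam σ x y + eigenPoint lam σ x' y' := by
  funext i
  fin_cases i <;> simp [eigenPoint] <;> ring

lemma eigenPoint_smul (lam : ℝ) (σ : ℤ) (c x y : ℝ) :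
    eigenPoint lam σ (c * x) (c * y) = c • eigenPoint lam σ x y := by
  funext i
  fin_cases i <;> simp [eigenPoint] <;> ring

lemma coordVec_of_bwd_eq_zero (lam : ℝ) (σ : ℤ) {e : ℤ → ℕ} {N : ℤ} (he : ∀ n ≤ N, e n = 0) :
    coordVec lam σ e N = fwdCoord lam e N • unstableVec lam σ := by
  have hbwd : bwdCoord lam σ e N = 0 := by
    have : ∀ j, bwdSeq e N j = 0 := fun j => he _ (by omega)
    simp [bwdCoord, this]
  rw [coordVec, hbwd, unstableVec, ← eigenPoint_smul, mul_one, mul_zero]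

namespace PrimarySpace

variable {lam : ℝ}

lemma bwdSeq_shift (ε : PrimarySpace lam) (N : ℤ) :
    bwdSeq ε.shift.digit N = bwdSeq ε.digit (N + 1) := by
  funext j
  simp only [bwdSeq, digit_shift]
  congr 1; ring

lemma seqSummable_bwdSeq_zero (ε : PrimarySpace lam) : SeqSummable lam⁻¹ (bwdSeq ε.digit 0) := by
  refine ((Subtype.property ε).2.mul_right lam⁻¹).congr fun n => ?_
  simp only [bwdSeq, digit, zero_sub, pow_succ]
  ring

lemma coordVec_shift (σ : ℤ) (ε : PrimarySpace lam) (N : ℤ) :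
    coordVec lam σ ε.shift.digit N = coordVec lam σ ε.digit (N + 1) := by
  simp only [coordVec, fwdCoord, bwdCoord, fwdSeq_digit, tail_shift, bwdSeq_shift]

lemma fwdCoord_add (hl : 1 < lam) (a b : PrimarySpace lam) (N : ℤ) :
    fwdCoord lam (a + b).digit N = fwdCoord lam a.digit N + fwdCoord lam b.digit N := by
  refine Eq.trans (tsum_congr fun j => ?_)
    ((a.seqSummable_tail hl (N + 1)).tsum_add (b.seqSummable_tail hl (N + 1)))
  simp [fwdSeq, tail, add_mul]

lemma continuous_fwdCoord (lam : ℝ) :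
    Continuous fun ε : PrimarySpace lam => fwdCoord lam ε.digit 0 := by
  refine (continuous_tsum_toL1 (lam := lam) (g := fun j : ℕ => 0 + 1 + (j : ℤ)) (c := fun _ => 1)
    (fun a b hab => by simpa using hab) (fun _ => by simp)).congr fun ε => tsum_congr fun j => ?_
  rw [toL1_apply, one_mul, show (0 + 1 + (j : ℤ)).natAbs = j + 1 by omega]
  rfl

lemma fwdCoord_single_zero (lam : ℝ) : fwdCoord lam (single lam 0).digit 0 = 0 := by
  have hzero : ∀ j, fwdSeq (single lam 0).digit (0 + 1) j = 0 := fun j => by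
    simp only [fwdSeq, digit_single]
    rw [if_neg (by omega)]
  simp only [fwdCoord, seqVal, hzero, Nat.cast_zero, zero_mul, tsum_zero]

lemma bwdCoord_single_zero (lam : ℝ) (σ : ℤ) : bwdCoord lam σ (single lam 0).digit 0 = 1 := by
  unfold bwdCoord
  rw [tsum_eq_single 0]
  · simp [bwdSeq]
  · intro j hj
    simp only [bwdSeq, digit_single]
    rw [if_neg (by omega), Nat.cast_zero, zero_mul]

end PrimarySpace

namespace IsQuadUnit

variable {r σ : ℤ} {lam : ℝ} (h : IsQuadUnit r σ lam)
include h

lemma eigenPoint_bwd (x y : ℝ) :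
    eigenPoint lam σ x y 0 + eigenPoint lam σ x y 1 * (σ * lam⁻¹) = -y := by
  have hne := h.lam_sub_conj_pos.ne'
  simp only [eigenPoint, Matrix.cons_val_zero, Matrix.cons_val_one]
  generalize (σ : ℝ) * lam⁻¹ = c at hne ⊢
  field_simp
  ring

lemma eq_eigenPoint (p : Fin 2 → ℝ) :
    p = eigenPoint lam σ (p 0 + p 1 * lam) (-(p 0 + p 1 * (σ * lam⁻¹))) := by
  have hquot : (p 0 + p 1 * lam + -(p 0 + p 1 * (σ * lam⁻¹))) / (lam - σ * lam⁻¹) = p 1 := by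
    rw [div_eq_iff h.lam_sub_conj_pos.ne']
    ring
  funext i
  fin_cases i <;> simp only [eigenPoint, hquot, Fin.zero_eta, Fin.mk_one, Matrix.cons_val_zero,
    Matrix.cons_val_one, add_sub_cancel_right]

lemma mulVec_eigenPoint (x y : ℝ) :
    (realMat (companion r σ)).mulVec (eigenPoint lam σ x y) =
      eigenPoint lam σ (lam * x) (σ * lam⁻¹ * y) := by
  have hfwd := eigenPoint_fwd lam σ x y
  have hbwd := h.eigenPoint_bwd x y
  have hconj := h.conj_eq
  rw [h.eq_eigenPoint ((realMat (companion r σ)).mulVec _)]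
  simp only [realMat, companion, Matrix.mulVec, dotProduct, Fin.sum_univ_two, Matrix.map_apply,
    Matrix.of_apply, Matrix.cons_val_zero, Matrix.cons_val_one]
  push_cast
  congr 1
  · linear_combination lam * hfwd - eigenPoint lam σ x y 1 * h.eqn
  · linear_combination -(σ * lam⁻¹) * hbwd + eigenPoint lam σ x y 1 *
      (σ * lam⁻¹ * hconj - σ * h.mul_inv)

lemma intVec_eq_eigenPoint (n : ℤ) : intVec ![n, 0] = eigenPoint lam σ n (-n) := by
  rw [h.eq_eigenPoint (intVec ![n, 0])]
  simp [intVec]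

lemma isUnit_det_companion : IsUnit (companion r σ).det := by
  rw [det_companion]; exact h.isUnit_sign

lemma mulVec_unstableVec :
    (realMat (companion r σ)).mulVec (unstableVec lam σ) = lam • unstableVec lam σ := by
  rw [unstableVec, h.mulVec_eigenPoint, ← eigenPoint_smul, mul_zero, mul_zero]

lemma summable_bwd {e : ℤ → ℕ} {N : ℤ} (he : SeqSummable lam⁻¹ (bwdSeq e N)) :
    Summable fun j => (bwdSeq e N j : ℝ) * (σ * lam⁻¹) ^ j := by
  refine Summable.of_norm ((he.mul_right lam).congr fun j => ?_)
  rw [norm_mul, norm_pow, norm_mul, Real.norm_eq_abs, Real.norm_eq_abs, Real.norm_eq_abs,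
    h.abs_sign, one_mul, abs_of_pos h.inv_pos, abs_of_nonneg (by positivity), pow_succ]
  linear_combination (bwdSeq e N j : ℝ) * lam⁻¹ ^ j * h.mul_inv

lemma lam_mul_fwdCoord {e : ℤ → ℕ} {N : ℤ} (he : SeqSummable lam⁻¹ (fwdSeq e (N + 1))) :
    lam * fwdCoord lam e N = e (N + 1) + fwdCoord lam e (N + 1) := by
  rw [fwdCoord, seqVal_eq_head_add he, dropSeq_fwdSeq, ← mul_assoc, h.mul_inv]
  simp [fwdSeq, fwdCoord]

lemma bwdCoord_succ {e : ℤ → ℕ} {N : ℤ} (he : SeqSummable lam⁻¹ (bwdSeq e (N + 1))) :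
    bwdCoord lam σ e (N + 1) = e (N + 1) + σ * lam⁻¹ * bwdCoord lam σ e N := by
  unfold bwdCoord
  rw [(h.summable_bwd he).tsum_eq_zero_add, ← tsum_mul_left]
  simp only [bwdSeq, Nat.cast_zero, sub_zero, pow_zero, mul_one]
  congr 2
  funext j
  rw [show N + 1 - ((j + 1 : ℕ) : ℤ) = N - j by push_cast; ring]
  ring

lemma coordVec_succ {e : ℤ → ℕ} {N : ℤ} (hf : SeqSummable lam⁻¹ (fwdSeq e (N + 1)))
    (hb : SeqSummable lam⁻¹ (bwdSeq e (N + 1))) :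
    (realMat (companion r σ)).mulVec (coordVec lam σ e N) =
      coordVec lam σ e (N + 1) + intVec ![(e (N + 1) : ℤ), 0] := by
  rw [coordVec, coordVec, h.mulVec_eigenPoint, h.intVec_eq_eigenPoint, ← eigenPoint_add,
    h.lam_mul_fwdCoord hf, h.bwdCoord_succ hb]
  congr 1 <;> push_cast <;> ring

lemma torusProj_coordVec_succ {e : ℤ → ℕ} {N : ℤ} (hf : SeqSummable lam⁻¹ (fwdSeq e (N + 1)))
    (hb : SeqSummable lam⁻¹ (bwdSeq e (N + 1))) :
    torusProj (coordVec lam σ e (N + 1)) =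
      intMap (companion r σ) (torusProj (coordVec lam σ e N)) := by
  rw [intMap_torusProj, h.coordVec_succ hf hb, torusProj_add, torusProj_intVec, add_zero]

lemma bwdCoord_add (a b : PrimarySpace lam) :
    bwdCoord lam σ (a + b).digit 0 = bwdCoord lam σ a.digit 0 + bwdCoord lam σ b.digit 0 := by
  unfold bwdCoord
  rw [← (h.summable_bwd a.seqSummable_bwdSeq_zero).tsum_add
    (h.summable_bwd b.seqSummable_bwdSeq_zero)]
  exact tsum_congr fun j => by simp [bwdSeq, add_mul]

lemma continuous_bwdCoord :
    Continuous fun ε : PrimarySpace lam => bwdCoord lam σ ε.digit 0 := by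
  refine (PrimarySpace.continuous_tsum_toL1 (lam := lam) (g := fun j : ℕ => 0 - (j : ℤ))
    (c := fun j => (σ : ℝ) ^ j) (fun a b hab => by simpa using hab)
    (fun j => by rw [abs_pow, h.abs_sign, one_pow])).congr fun ε => tsum_congr fun j => ?_
  rw [PrimarySpace.toL1_apply, mul_pow, show ((0 : ℤ) - j).natAbs = j by omega, bwdSeq]
  ring

/-- The coding of the companion matrix. -/
noncomputable def coding : PrimarySpace lam →+ UnitAddTorus (Fin 2) where
  toFun ε := torusProj (coordVec lam σ ε.digit 0)
  map_zero' := by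
    rw [coordVec_of_bwd_eq_zero lam σ fun _ _ => PrimarySpace.digit_zero _, ← torusProj_zero]
    simp [fwdCoord, fwdSeq, seqVal]
  map_add' a b := by
    simp only [coordVec]
    rw [a.fwdCoord_add h.one_lt, h.bwdCoord_add, eigenPoint_add, torusProj_add]

lemma coding_apply (ε : PrimarySpace lam) :
    h.coding ε = torusProj (coordVec lam σ ε.digit 0) := rfl

lemma continuous_coding : Continuous h.coding := by
  have hf := PrimarySpace.continuous_fwdCoord lam
  have hb := h.continuous_bwdCoord
  refine continuous_torusProj.comp (continuous_pi fun i => ?_)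
  fin_cases i
  · exact hf.sub (((hf.add hb).div_const _).mul_const _)
  · exact (hf.add hb).div_const _

lemma coding_shift (ε : PrimarySpace lam) :
    h.coding ε.shift = intMap (companion r σ) (h.coding ε) := by
  rw [coding_apply, coding_apply, PrimarySpace.coordVec_shift]
  exact h.torusProj_coordVec_succ (N := 0) (ε.seqSummable_tail h.one_lt _)
    (ε.bwdSeq_shift 0 ▸ ε.shift.seqSummable_bwdSeq_zero)

lemma coding_single_zero :
    h.coding (PrimarySpace.single lam 0) = torusProj (unstableVec lam σ) := by
  rw [coding_apply, torusProj_eq_iff, coordVec, PrimarySpace.fwdCoord_single_zero,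
    PrimarySpace.bwdCoord_single_zero, unstableVec]
  refine ⟨![-1, 0], ?_⟩
  rw [h.intVec_eq_eigenPoint, ← eigenPoint_add]
  norm_num

lemma coding_single (n : ℤ) :
    h.coding (PrimarySpace.single lam n) = torusProj (lam ^ (-n) • unstableVec lam σ) := by
  have hcoding : ∀ n : ℤ, intMap (companion r σ) (h.coding (PrimarySpace.single lam n)) =
      h.coding (PrimarySpace.single lam (n - 1)) := fun n => by
    rw [← coding_shift, PrimarySpace.shift_single]
  have hvec : ∀ n : ℤ, intMap (companion r σ) (torusProj (lam ^ (-n) • unstableVec lam σ)) =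
      torusProj (lam ^ (-(n - 1)) • unstableVec lam σ) := fun n => by
    rw [intMap_torusProj, Matrix.mulVec_smul, h.mulVec_unstableVec, smul_smul,
      show -(n - 1) = -n + 1 by ring, zpow_add_one₀ h.pos.ne']
  induction n using Int.induction_on with
  | zero => simp [h.coding_single_zero]
  | succ n ih =>
    apply intMap_injective h.isUnit_det_companion
    rw [hcoding, hvec]
    simpa using ih
  | pred n ih => rw [← hcoding, ih, hvec]

lemma coding_trunc (ε : PrimarySpace lam) (N : ℕ) :
    h.coding (PrimarySpace.trunc N ε) = torusProj
      ((∑ n ∈ Finset.Icc (-(N : ℤ)) N, (ε.digit n : ℝ) * lam ^ (-n)) • unstableVec lam σ) := by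
  rw [PrimarySpace.trunc, map_sum, Finset.sum_smul, ← torusProjHom_apply, map_sum]
  refine Finset.sum_congr rfl fun n _ => ?_
  rw [map_nsmul, coding_single, torusProjHom_apply, mul_smul, torusProj_nsmul]

end IsQuadUnit

/-! ### Surjectivity on the compactum of admissible sequences -/

lemma dense_torusProj_ray {α : ℝ} (hα : Irrational α) :
    Dense ((fun t : ℝ => torusProj (t • ![α, 1])) '' Set.Ici 0) := by
  have hdense : DenseRange fun j : ℕ => j • (α : UnitAddCircle) := by
    rw [← denseRange_zsmul_iff_nsmul, AddCircle.denseRange_zsmul_coe_iff]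
    simpa using hα
  intro x
  set z := torusLift x with hz
  have hz1 : 0 ≤ z 1 := (torusLift_mem x 1 trivial).1.le
  -- The ray meets the circle of points with second coordinate `z 1` at the times `z 1 + j`.
  let circle : UnitAddCircle → UnitAddTorus (Fin 2) := fun c =>
    ![c + ((α * z 1 : ℝ) : UnitAddCircle), ((z 1 : ℝ) : UnitAddCircle)]
  have hcircle : Continuous circle := by
    refine continuous_pi fun i => ?_
    fin_cases i
    · exact continuous_id.add continuous_const
    · exact continuous_const
  have hmem (c) : circle c ∈ closure ((fun t : ℝ => torusProj (t • ![α, 1])) '' Set.Ici 0) := by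
    refine hdense.induction_on c (isClosed_closure.preimage hcircle) fun j =>
      subset_closure ⟨z 1 + j, add_nonneg hz1 j.cast_nonneg, ?_⟩
    funext i
    fin_cases i
    · simp [circle, torusProj, add_mul, mul_comm α, add_comm]
    · have : ((j : ℝ) : UnitAddCircle) = 0 := (AddCircle.coe_eq_zero_iff (1 : ℝ)).2 ⟨j, by simp⟩
      simp [circle, torusProj, this]
  have hx : circle (((z 0 - α * z 1 : ℝ)) : UnitAddCircle) = x := by
    rw [← torusProj_torusLift x]
    funext i
    fin_cases i
    · simp [circle, torusProj, ← hz]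
    · rfl
  exact hx ▸ hmem _

/-- The two-sided sequences none of whose tails exceeds the quasi-greedy expansion of `1`. -/
def betaSet (r σ : ℤ) (lam : ℝ) : Set (PrimarySpace lam) :=
  {ε | ShiftAdmissible (quasiGreedy r σ) ε.digit}

lemma shift_mem_betaSet {r σ : ℤ} {lam : ℝ} {ε : PrimarySpace lam} :
    ε.shift ∈ betaSet r σ lam ↔ ε ∈ betaSet r σ lam := by
  have hshift (N) : fwdSeq ε.shift.digit N = fwdSeq ε.digit (N + 1) := by
    rw [PrimarySpace.fwdSeq_digit, PrimarySpace.tail_shift, PrimarySpace.fwdSeq_digit]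
  simp only [betaSet, Set.mem_ofPred_eq, ShiftAdmissible, hshift]
  exact ⟨fun h N => sub_add_cancel N 1 ▸ h (N - 1), fun h N => h (N + 1)⟩

namespace IsQuadUnit

variable {r σ : ℤ} {lam : ℝ} (h : IsQuadUnit r σ lam)
include h

lemma mem_primarySet_of_le {e : ℤ → ℕ} {B : ℕ} (he : ∀ n, e n ≤ B) : e ∈ primarySet lam := by
  have key (f : ℕ → ℕ) (hf : ∀ n, f n ≤ B) : Summable fun n => (f n : ℝ) * lam⁻¹ ^ n := by
    refine ((h.summable_of_le hf).mul_right lam).congr fun n => ?_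
    rw [pow_succ]
    linear_combination ((f n : ℝ) * lam⁻¹ ^ n) * h.mul_inv
  exact ⟨key _ fun n => he _, key _ fun n => he _⟩

lemma continuousOn_fwdCoord (B : ℕ) :
    ContinuousOn (fun e : ℤ → ℕ => fwdCoord lam e 0) {e | ∀ n, e n ≤ B} := by
  refine continuousOn_tsum (u := fun j => (B : ℝ) * lam⁻¹ ^ (j + 1)) (fun j => ?_)
    (h.summable_of_le (a := fun _ => B) fun _ => le_rfl) fun j e he => ?_
  · have : Continuous fun e : ℤ → ℕ => ((e (0 + 1 + j) : ℕ) : ℝ) :=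
      continuous_of_discreteTopology.comp (continuous_apply _)
    exact (this.mul_const _).continuousOn
  · have := h.inv_pos
    rw [Real.norm_of_nonneg (by positivity)]
    have : (fwdSeq e (0 + 1) j : ℝ) ≤ B := by exact_mod_cast he _
    gcongr

lemma norm_bwd_term_le {e : ℤ → ℕ} {B : ℕ} (he : ∀ n, e n ≤ B) (N : ℤ) (j : ℕ) :
    ‖(bwdSeq e N j : ℝ) * (σ * lam⁻¹) ^ j‖ ≤ B * lam⁻¹ ^ j := by
  have := h.inv_pos
  rw [norm_mul, norm_pow, norm_mul, Real.norm_eq_abs (σ : ℝ), h.abs_sign, one_mul,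
    Real.norm_of_nonneg h.inv_pos.le, Real.norm_of_nonneg (by positivity)]
  have : (bwdSeq e N j : ℝ) ≤ B := by exact_mod_cast he _
  gcongr

lemma summable_const_mul_inv_pow (c : ℝ) : Summable fun j : ℕ => c * lam⁻¹ ^ j :=
  (summable_geometric_of_lt_one h.inv_pos.le h.inv_lt_one).mul_left c

lemma continuousOn_bwdCoord (B : ℕ) :
    ContinuousOn (fun e : ℤ → ℕ => bwdCoord lam σ e 0) {e | ∀ n, e n ≤ B} := by
  refine continuousOn_tsum (fun j => ?_) (h.summable_const_mul_inv_pow B)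
    fun j e he => h.norm_bwd_term_le he 0 j
  have : Continuous fun e : ℤ → ℕ => ((e (0 - j) : ℕ) : ℝ) :=
    continuous_of_discreteTopology.comp (continuous_apply _)
  exact (this.mul_const _).continuousOn

lemma image_betaSet :
    h.coding '' betaSet r σ lam = (fun e => torusProj (coordVec lam σ e 0)) ''
      {e | ShiftAdmissible (quasiGreedy r σ) e} := by
  ext x
  constructor
  · rintro ⟨ε, hε, rfl⟩
    exact ⟨ε.digit, hε, rfl⟩
  · rintro ⟨e, he, rfl⟩
    exact ⟨PrimarySpace.mk e (h.mem_primarySet_of_le he.le_head), he, rfl⟩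

lemma isClosed_image_betaSet : IsClosed (h.coding '' betaSet r σ lam) := by
  rw [h.image_betaSet]
  refine ((isCompact_shiftAdmissible _).image_of_continuousOn ?_).isClosed
  have hbdd : {e | ShiftAdmissible (quasiGreedy r σ) e} ⊆ {e | ∀ n, e n ≤ quasiGreedy r σ 0} :=
    fun _ he => he.le_head
  have hfwd := (h.continuousOn_fwdCoord _).mono hbdd
  have hbwd := (h.continuousOn_bwdCoord _).mono hbdd
  refine continuous_torusProj.comp_continuousOn (continuousOn_pi.2 fun i => ?_)
  fin_cases i
  · exact hfwd.sub (((hfwd.add hbwd).div_const _).mul_const _)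
  · exact (hfwd.add hbwd).div_const _

lemma smul_unstableVec_mem_image {t : ℝ} (ht : t ∈ Set.Ico (0 : ℝ) 1) :
    torusProj (t • unstableVec lam σ) ∈ h.coding '' betaSet r σ lam := by
  obtain ⟨a, ha, hat⟩ := h.exists_expansion ht
  rw [h.image_betaSet]
  set e : ℤ → ℕ := fun n => if 1 ≤ n then a (n - 1).toNat else 0 with he
  have hfwd : fwdSeq e 1 = a := by
    funext j
    simp only [fwdSeq, he]
    rw [if_pos (by omega)]
    congr 1
    omega
  have hbwd (n : ℤ) (hn : n ≤ 0) : e n = 0 := if_neg (by omega)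
  refine ⟨e, fun N => ?_, ?_⟩
  · rcases le_or_gt 1 N with hN | hN
    · obtain ⟨k, rfl⟩ : ∃ k : ℕ, N = 1 + k := ⟨(N - 1).toNat, by omega⟩
      rw [← dropSeq_fwdSeq, hfwd]
      exact ha k
    · refine not_lexLess_iff.2 (lexLess_iff_toLex_lt.1 (lexLess_of_head_lt ?_)).le
      simpa [fwdSeq, hbwd N (by omega)] using h.quasiGreedy_zero_pos
  · simp only
    rw [coordVec_of_bwd_eq_zero lam σ hbwd, fwdCoord, zero_add, hfwd, hat]

lemma ray_subset_image :
    (fun t : ℝ => torusProj (t • unstableVec lam σ)) '' Set.Ici 0 ⊆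
      h.coding '' betaSet r σ lam := by
  have key (k : ℕ) : ∀ s ∈ Set.Ico (0 : ℝ) 1,
      torusProj ((lam ^ k * s) • unstableVec lam σ) ∈ h.coding '' betaSet r σ lam := by
    induction k with
    | zero => intro s hs; simpa using h.smul_unstableVec_mem_image hs
    | succ k ih =>
      intro s hs
      obtain ⟨ε, hε, hεs⟩ := ih s hs
      refine ⟨ε.shift, shift_mem_betaSet.2 hε, ?_⟩
      rw [h.coding_shift, hεs, intMap_torusProj, Matrix.mulVec_smul, h.mulVec_unstableVec,
        smul_smul, pow_succ, mul_right_comm]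
  rintro _ ⟨t, ht : 0 ≤ t, rfl⟩
  obtain ⟨k, hk⟩ := pow_unbounded_of_one_lt t h.one_lt
  have hp : 0 < lam ^ k := pow_pos h.pos k
  have := key k (t / lam ^ k) ⟨by positivity, by rwa [div_lt_one hp]⟩
  rwa [mul_div_cancel₀ _ hp.ne'] at this

lemma dense_ray : Dense ((fun t : ℝ => torusProj (t • unstableVec lam σ)) '' Set.Ici 0) := by
  have hp := h.lam_sub_conj_pos
  refine (dense_torusProj_ray h.irrational_conj.neg).mono ?_
  rintro _ ⟨t, ht : 0 ≤ t, rfl⟩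
  refine ⟨t * (lam - σ * lam⁻¹), mul_nonneg ht hp.le, ?_⟩
  have hvec : (lam - σ * lam⁻¹) • unstableVec lam σ = ![-(σ * lam⁻¹), 1] := by
    funext i
    fin_cases i
    · simp only [unstableVec, eigenPoint, add_zero, one_div, Pi.smul_apply, Fin.zero_eta,
        Matrix.cons_val_zero, smul_eq_mul]
      rw [mul_sub, mul_one, mul_inv_cancel_left₀ hp.ne']
      ring
    · simp [unstableVec, eigenPoint, hp.ne']
  simp only [mul_smul, hvec]

lemma coding_surjOn : Set.SurjOn h.coding (betaSet r σ lam) Set.univ := fun x _ =>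
  h.isClosed_image_betaSet.closure_subset_iff.2 h.ray_subset_image (h.dense_ray x)

end IsQuadUnit

/-! ### Almost everywhere uniqueness -/

namespace IsQuadUnit

section AdmissibleSequence

variable {r σ : ℤ} {lam : ℝ} (h : IsQuadUnit r σ lam) {e : ℤ → ℕ}
  (he : ShiftAdmissible (quasiGreedy r σ) e)
include h he

lemma fwdCoord_mem (N : ℤ) : fwdCoord lam e N ∈ Set.Icc (0 : ℝ) 1 :=
  ⟨seqVal_nonneg h.inv_pos.le _, h.seqVal_le_one (he.lexAdmissible_fwdSeq _)⟩

lemma lam_mul_fwdCoord_of_admissible (N : ℤ) :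
    lam * fwdCoord lam e N = e (N + 1) + fwdCoord lam e (N + 1) :=
  h.lam_mul_fwdCoord (h.summable_of_le fun _ => he.le_head _)

lemma bwdCoord_succ_of_admissible (N : ℤ) :
    bwdCoord lam σ e (N + 1) = e (N + 1) + σ * lam⁻¹ * bwdCoord lam σ e N :=
  h.bwdCoord_succ (h.summable_of_le fun _ => he.le_head _)

lemma torusProj_coordVec_succ_of_admissible (N : ℤ) : torusProj (coordVec lam σ e (N + 1)) =
    intMap (companion r σ) (torusProj (coordVec lam σ e N)) :=
  h.torusProj_coordVec_succ (h.summable_of_le fun _ => he.le_head _)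
    (h.summable_of_le fun _ => he.le_head _)

lemma exists_abs_bwdCoord_le : ∃ C, ∀ N, |bwdCoord lam σ e N| ≤ C :=
  ⟨_, fun N => tsum_of_norm_bounded (h.summable_const_mul_inv_pow _).hasSum
    (h.norm_bwd_term_le he.le_head N)⟩

end AdmissibleSequence

end IsQuadUnit

/-- The upper boundary, over the point `x` of `[0, 1]`, of the domain of the natural extension of
the `λ`-expansions when `λ' = 1 / λ`. -/
noncomputable def domainTop (lam x : ℝ) : ℝ := if 1 - lam⁻¹ < x then lam - 1 else lam

namespace IsQuadUnit

variable {r σ : ℤ} {lam : ℝ}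

lemma add_inv_mul_domainTop_le (h : IsQuadUnit r 1 lam) {a : ℕ} {x x' : ℝ}
    (hx : x ≤ 1) (hx' : 0 ≤ x') (hxx' : lam * x = a + x') :
    a + lam⁻¹ * domainTop lam x ≤ domainTop lam x' := by
  have hone := h.one_lt
  have hinv := h.inv_pos
  have hlt := h.inv_lt_one
  have hmul := h.mul_inv
  have hconj : lam⁻¹ = r - lam := by simpa using h.conj_eq
  have hlx : lam * x ≤ lam := mul_le_of_le_one_right h.pos.le hx
  -- `s` is the digit deficit: the top over `x'` is `λ - s + 1` with `s ∈ {1, 2}`.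
  have bound (s : ℤ) (ha : (a : ℤ) ≤ r - s) (htop : (a : ℤ) = r - s → lam - 1 < lam * x) :
      a + lam⁻¹ * domainTop lam x ≤ lam - s + 1 := by
    rcases ha.eq_or_lt with heq | hlt'
    · have hcast : (a : ℝ) = r - s := by exact_mod_cast heq
      have hgt : 1 - lam⁻¹ < x := by
        refine lt_of_mul_lt_mul_left ?_ h.pos.le
        rw [mul_sub, mul_one, hmul]
        exact htop heq
      rw [domainTop, if_pos hgt]
      linarith
    · have hcast : (a : ℝ) ≤ r - s - 1 := by exact_mod_cast (by omega : (a : ℤ) ≤ r - s - 1)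
      have : domainTop lam x ≤ lam := by unfold domainTop; split_ifs <;> linarith
      have : lam⁻¹ * domainTop lam x ≤ lam⁻¹ * lam := by gcongr
      linarith
  by_cases htop : 1 - lam⁻¹ < x'
  · have ha : (a : ℤ) < r - 1 := by
      have : (a : ℝ) < r - 1 := by linarith
      exact_mod_cast this
    rw [show domainTop lam x' = lam - (2 : ℤ) + 1 by rw [domainTop, if_pos htop]; norm_num; ring]
    refine bound 2 (by omega) fun heq => ?_
    have : (a : ℝ) = r - 2 := by exact_mod_cast heq
    linarith
  · have ha : (a : ℤ) < r := by
      have : (a : ℝ) < r := by linarith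
      exact_mod_cast this
    rw [show domainTop lam x' = lam - (1 : ℤ) + 1 by rw [domainTop, if_neg htop]; norm_num]
    refine bound 1 (by omega) fun heq => ?_
    have : (a : ℝ) = r - 1 := by exact_mod_cast heq
    linarith

lemma bwdCoord_le_domainTop (h : IsQuadUnit r 1 lam) {e : ℤ → ℕ}
    (he : ShiftAdmissible (quasiGreedy r 1) e) (N : ℤ) :
    bwdCoord lam 1 e N ≤ domainTop lam (fwdCoord lam e N) := by
  obtain ⟨C, hC⟩ := h.exists_abs_bwdCoord_le he
  have hone := h.one_lt
  rw [← sub_nonpos]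
  refine nonpos_of_forall_exists_le_mul (C := C) h.inv_pos.le h.inv_lt_one
    (f := fun n => bwdCoord lam 1 e n - domainTop lam (fwdCoord lam e n)) (fun n => ?_)
    (fun n => ⟨n - 1, ?_⟩) N
  · have : 0 ≤ domainTop lam (fwdCoord lam e n) := by unfold domainTop; split_ifs <;> linarith
    linarith [(abs_le.1 (hC n)).2]
  · obtain ⟨m, rfl⟩ : ∃ m, n = m + 1 := ⟨n - 1, by ring⟩
    have hstep := h.add_inv_mul_domainTop_le (h.fwdCoord_mem he m).2 (h.fwdCoord_mem he (m + 1)).1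
      (h.lam_mul_fwdCoord_of_admissible he m)
    rw [h.bwdCoord_succ_of_admissible he m, add_sub_cancel_right, Int.cast_one, one_mul]
    calc (e (m + 1) : ℝ) + lam⁻¹ * bwdCoord lam 1 e m - domainTop lam (fwdCoord lam e (m + 1))
        ≤ lam⁻¹ * (bwdCoord lam 1 e m - domainTop lam (fwdCoord lam e m)) := by linarith
      _ ≤ _ := mul_le_mul_of_nonneg_left (le_max_left _ _) h.inv_pos.le

lemma digit_le (h : IsQuadUnit r (-1) lam) {e : ℤ → ℕ}
    (he : ShiftAdmissible (quasiGreedy r (-1)) e) (n : ℤ) : (e n : ℝ) ≤ r := by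
  have : (e n : ℝ) ≤ quasiGreedy r (-1) 0 := by exact_mod_cast he.le_head n
  simpa [h.cast_quasiGreedy_zero] using this

lemma bwdCoord_mem_Icc (h : IsQuadUnit r (-1) lam) {e : ℤ → ℕ}
    (he : ShiftAdmissible (quasiGreedy r (-1)) e) (N : ℤ) :
    bwdCoord lam (-1) e N ∈ Set.Icc (-1) lam := by
  obtain ⟨C, hC⟩ := h.exists_abs_bwdCoord_le he
  have hpos := h.pos
  have hconj : -lam⁻¹ = r - lam := by simpa using h.conj_eq
  -- Both excesses contract because `λ' = -1 / λ` exchanges the two ends of the interval.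
  have hexcess : max (bwdCoord lam (-1) e N - lam) (-1 - bwdCoord lam (-1) e N) ≤ 0 := by
    refine nonpos_of_forall_exists_le_mul (C := C) h.inv_pos.le h.inv_lt_one
      (f := fun n => max (bwdCoord lam (-1) e n - lam) (-1 - bwdCoord lam (-1) e n)) (fun n => ?_)
      (fun n => ⟨n - 1, ?_⟩) N
    · have := abs_le.1 (hC n)
      exact max_le (by linarith) (by linarith)
    · obtain ⟨m, rfl⟩ : ∃ m, n = m + 1 := ⟨n - 1, by ring⟩
      rw [add_sub_cancel_right]
      refine le_trans ?_ (mul_le_mul_of_nonneg_left (le_max_left _ _) h.inv_pos.le)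
      have hsucc : bwdCoord lam (-1) e (m + 1) = e (m + 1) - lam⁻¹ * bwdCoord lam (-1) e m := by
        simpa [sub_eq_add_neg] using h.bwdCoord_succ_of_admissible he m
      rw [hsucc, mul_max_of_nonneg _ _ h.inv_pos.le, max_comm (lam⁻¹ * _)]
      have hdigit := h.digit_le he (m + 1)
      refine max_le_max ?_ ?_
      · linarith
      · linarith [h.mul_inv]
  obtain ⟨hhigh, hlow⟩ := max_le_iff.1 hexcess
  exact ⟨by linarith, by linarith⟩

lemma bwdCoord_le_of_digit_ne (h : IsQuadUnit r (-1) lam) {e : ℤ → ℕ}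
    (he : ShiftAdmissible (quasiGreedy r (-1)) e) {N : ℤ} (hN : (e N : ℤ) ≠ r) :
    bwdCoord lam (-1) e N ≤ lam - 1 := by
  obtain ⟨M, rfl⟩ : ∃ M, N = M + 1 := ⟨N - 1, by ring⟩
  have hconj : -lam⁻¹ = r - lam := by simpa using h.conj_eq
  have hlow : lam⁻¹ * (-1) ≤ lam⁻¹ * bwdCoord lam (-1) e M :=
    mul_le_mul_of_nonneg_left (h.bwdCoord_mem_Icc he M).1 h.inv_pos.le
  have hdigit : (e (M + 1) : ℤ) ≤ r := by exact_mod_cast h.digit_le he (M + 1)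
  have hdigit' : (e (M + 1) : ℝ) ≤ r - 1 := by
    exact_mod_cast (by omega : (e (M + 1) : ℤ) ≤ r - 1)
  have hsucc := h.bwdCoord_succ_of_admissible he M
  push_cast at hsucc
  linarith

lemma digit_ne_of_digit_succ_eq (h : IsQuadUnit r (-1) lam) {e : ℤ → ℕ}
    (he : ShiftAdmissible (quasiGreedy r (-1)) e) {N : ℤ} (hN : (e (N + 1) : ℤ) = r) :
    (e N : ℤ) ≠ r := fun heq => by
  have hr : 1 ≤ r := by rcases h.sign with hs | hs <;> omega
  refine he N ⟨1, fun m hm => ?_, ?_⟩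
  · obtain rfl : m = 0 := by omega
    simp [quasiGreedy, fwdSeq, ← heq]
  · have : 0 < e (N + 1) := by omega
    simpa [quasiGreedy, fwdSeq] using this

lemma bounds_of_digit_eq (h : IsQuadUnit r (-1) lam) {e : ℤ → ℕ}
    (he : ShiftAdmissible (quasiGreedy r (-1)) e) {N : ℤ} (hN : (e N : ℤ) = r) :
    fwdCoord lam e N ≤ lam⁻¹ ∧ lam - 1 ≤ bwdCoord lam (-1) e N := by
  obtain ⟨M, rfl⟩ : ∃ M, N = M + 1 := ⟨N - 1, by ring⟩
  have hconj : -lam⁻¹ = r - lam := by simpa using h.conj_eq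
  have hcast : (e (M + 1) : ℝ) = r := by exact_mod_cast hN
  constructor
  · have hsucc := h.lam_mul_fwdCoord_of_admissible he M
    have : lam * fwdCoord lam e M ≤ lam :=
      mul_le_of_le_one_right h.pos.le (h.fwdCoord_mem he M).2
    linarith
  · have hsucc := h.bwdCoord_succ_of_admissible he M
    have : lam⁻¹ * bwdCoord lam (-1) e M ≤ lam⁻¹ * (lam - 1) := mul_le_mul_of_nonneg_left
      (h.bwdCoord_le_of_digit_ne he (h.digit_ne_of_digit_succ_eq he hN)) h.inv_pos.le
    push_cast at hsucc
    linarith [h.mul_inv]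

variable (h : IsQuadUnit r σ lam)
include h

-- The rectangles cover the domain of the natural extension of the beta-transformation; `λ - λ'` is
-- the covolume of `ℤ²` in eigenline coordinates.
lemma exists_rectangles : ∃ b c : ℝ, b ≤ lam - 1 ∧ 0 ≤ c ∧ lam - 1 - b + c = lam - σ * lam⁻¹ ∧
    ∀ e, ShiftAdmissible (quasiGreedy r σ) e → ∀ N,
      ![fwdCoord lam e N, bwdCoord lam σ e N] ∈
        Set.Icc ![0, b] ![1, lam - 1] ∪ Set.Icc ![0, lam - 1] ![c, lam] := by
  have hone := h.one_lt
  have hinv := h.inv_pos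
  have hlt := h.inv_lt_one
  have hmem (x y x₁ y₁ x₂ y₂ : ℝ) : ![x, y] ∈ Set.Icc ![x₁, y₁] ![x₂, y₂] ↔
      (x₁ ≤ x ∧ y₁ ≤ y) ∧ x ≤ x₂ ∧ y ≤ y₂ := by
    simp [Set.mem_Icc, Pi.le_def, Fin.forall_fin_two]
  simp only [Set.mem_union, hmem]
  rcases h.sign with ⟨rfl, -⟩ | ⟨rfl, -⟩
  · refine ⟨0, 1 - lam⁻¹, by linarith, by linarith, by push_cast; ring, fun e he N => ?_⟩
    obtain ⟨hx0, hx1⟩ := h.fwdCoord_mem he N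
    have hy := h.bwdCoord_le_domainTop he N
    have hy0 : 0 ≤ bwdCoord lam 1 e N := tsum_nonneg fun j => by push_cast; positivity
    by_cases hx : 1 - lam⁻¹ < fwdCoord lam e N
    · rw [domainTop, if_pos hx] at hy
      exact Or.inl ⟨⟨hx0, hy0⟩, hx1, hy⟩
    · rw [domainTop, if_neg hx] at hy
      rcases le_total (bwdCoord lam 1 e N) (lam - 1) with hy' | hy'
      · exact Or.inl ⟨⟨hx0, hy0⟩, hx1, hy'⟩
      · exact Or.inr ⟨⟨hx0, hy'⟩, not_lt.1 hx, hy⟩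
  · refine ⟨-1, lam⁻¹, by linarith, by linarith, by push_cast; ring, fun e he N => ?_⟩
    obtain ⟨hx0, hx1⟩ := h.fwdCoord_mem he N
    obtain ⟨hy0, hy1⟩ := h.bwdCoord_mem_Icc he N
    by_cases hN : (e N : ℤ) = r
    · obtain ⟨hx, hy⟩ := h.bounds_of_digit_eq he hN
      exact Or.inr ⟨⟨hx0, hy⟩, hx, hy1⟩
    · exact Or.inl ⟨⟨hx0, hy0⟩, hx1, h.bwdCoord_le_of_digit_ne he hN⟩

lemma exists_measurable_coordVec_mem : ∃ B : Set (Fin 2 → ℝ), MeasurableSet B ∧ volume B ≤ 1 ∧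
    ∀ e, ShiftAdmissible (quasiGreedy r σ) e → ∀ N, coordVec lam σ e N ∈ B := by
  obtain ⟨b, c, hb, hc, hbc, hmem⟩ := h.exists_rectangles
  set R : Set (Fin 2 → ℝ) := Set.Icc ![0, b] ![1, lam - 1] ∪ Set.Icc ![0, lam - 1] ![c, lam]
  set L := Matrix.toLin' !![1, lam; -1, -(σ * lam⁻¹)] with hL
  have hpos := h.lam_sub_conj_pos
  have hdet : LinearMap.det L = lam - σ * lam⁻¹ := by
    rw [hL, LinearMap.det_toLin', Matrix.det_fin_two_of]
    ring
  have hR : volume R ≤ ENNReal.ofReal (lam - σ * lam⁻¹) := by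
    refine (measure_union_le _ _).trans ?_
    rw [Real.volume_Icc_pi, Real.volume_Icc_pi, ← hbc, Fin.prod_univ_two, Fin.prod_univ_two,
      ENNReal.ofReal_add (by linarith) hc]
    simp
  refine ⟨L ⁻¹' R, ?_, ?_, fun e he N => ?_⟩
  · exact (measurableSet_Icc.union measurableSet_Icc).preimage
      L.continuous_of_finiteDimensional.measurable
  · rw [Measure.addHaar_preimage_linearMap _ (by rw [hdet]; exact hpos.ne'), hdet]
    calc _ ≤ ENNReal.ofReal |(lam - σ * lam⁻¹)⁻¹| * ENNReal.ofReal (lam - σ * lam⁻¹) := by gcongr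
      _ = 1 := by
        rw [← ENNReal.ofReal_mul (abs_nonneg _), abs_of_pos (by positivity),
          inv_mul_cancel₀ hpos.ne', ENNReal.ofReal_one]
  · have hLv : L (coordVec lam σ e N) = ![fwdCoord lam e N, bwdCoord lam σ e N] := by
      have hfwd := eigenPoint_fwd lam σ (fwdCoord lam e N) (bwdCoord lam σ e N)
      have hbwd := h.eigenPoint_bwd (fwdCoord lam e N) (bwdCoord lam σ e N)
      funext i
      fin_cases i <;> simp [hL, Matrix.mulVec, dotProduct, Fin.sum_univ_two, coordVec] <;> linarith
    rw [Set.mem_preimage, hLv]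
    exact hmem e he N

lemma torusProj_coordVec {e : ℤ → ℕ} (he : ShiftAdmissible (quasiGreedy r σ) e) (N : ℤ) :
    torusProj (coordVec lam σ e N) =
      intMap (companion r σ ^ N) (torusProj (coordVec lam σ e 0)) := by
  have hu := h.isUnit_det_companion
  have hsucc (n : ℤ) : companion r σ ^ (n + 1) = companion r σ * companion r σ ^ n := by
    rw [add_comm, Matrix.zpow_one_add hu]
  induction N using Int.induction_on with
  | zero => rw [zpow_zero, intMap_one]
  | succ n ih =>
    rw [h.torusProj_coordVec_succ_of_admissible he, ih, hsucc, intMap_mul]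
  | pred n ih =>
    apply intMap_injective hu
    rw [← h.torusProj_coordVec_succ_of_admissible he, ← intMap_mul, ← hsucc, sub_add_cancel, ih]

lemma digit_eq_of_fwdCoord_eq {ε ε' : PrimarySpace lam} (hε : ε ∈ betaSet r σ lam)
    (hε' : ε' ∈ betaSet r σ lam)
    (hfwd : ∀ N, fwdCoord lam ε.digit N = fwdCoord lam ε'.digit N) : ε = ε' := by
  ext n
  have hstep := h.lam_mul_fwdCoord_of_admissible hε (n - 1)
  have hstep' := h.lam_mul_fwdCoord_of_admissible hε' (n - 1)
  rw [sub_add_cancel] at hstep hstep'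
  rw [hfwd, hfwd n, hstep'] at hstep
  exact_mod_cast (add_right_cancel hstep).symm

lemma ae_coding_injOn : ∀ᵐ x, ∀ ε ∈ betaSet r σ lam, ∀ ε' ∈ betaSet r σ lam,
    h.coding ε = x → h.coding ε' = x → ε = ε' := by
  obtain ⟨B, hBm, hB1, hB⟩ := h.exists_measurable_coordVec_mem
  have hcov (x) : ∃ p ∈ B, torusProj p = x := by
    obtain ⟨ε, hε, hx⟩ := h.coding_surjOn (Set.mem_univ x)
    exact ⟨_, hB ε.digit hε 0, hx⟩
  have hunique : ∀ᵐ x, ∀ N : ℤ, ∀ p ∈ B, ∀ q ∈ B, torusProj p = intMap (companion r σ ^ N) x →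
      torusProj q = intMap (companion r σ ^ N) x → p = q :=
    ae_all_iff.2 fun N => (measurePreserving_intMap
      (h.isUnit_det_companion.det_zpow N)).quasiMeasurePreserving.ae
        (ae_unique_of_cover hBm hB1 hcov)
  filter_upwards [hunique] with x hx ε hε ε' hε' hεx hεx'
  refine h.digit_eq_of_fwdCoord_eq hε hε' fun N => ?_
  have hcoord : coordVec lam σ ε.digit N = coordVec lam σ ε'.digit N := by
    refine hx N _ (hB _ hε _) _ (hB _ hε' _) ?_ ?_
    · rw [h.torusProj_coordVec hε, ← h.coding_apply, hεx]
    · rw [h.torusProj_coordVec hε', ← h.coding_apply, hεx']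
  rw [← eigenPoint_fwd lam σ (fwdCoord lam ε.digit N), ← coordVec, hcoord, coordVec, eigenPoint_fwd]

lemma eq_zero_of_smul_unstableVec_eq_intVec {s : ℝ} {k : Fin 2 → ℤ}
    (hs : s • unstableVec lam σ = intVec k) : s = 0 := by
  rw [unstableVec, ← eigenPoint_smul, mul_one, mul_zero] at hs
  have hfwd := eigenPoint_fwd lam σ s 0
  have hbwd := h.eigenPoint_bwd s 0
  simp only [hs, intVec, neg_zero] at hfwd hbwd
  have hk1 : k 1 = 0 := by
    by_contra hne
    refine h.irrational_conj ⟨-(k 0 : ℚ) / k 1, ?_⟩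
    have : (k 1 : ℝ) ≠ 0 := by exact_mod_cast hne
    push_cast
    rw [div_eq_iff this]
    linarith
  simp only [hk1, Int.cast_zero, zero_mul, add_zero] at hfwd hbwd
  rw [← hfwd, hbwd]

lemma seqVal_tail_lt_one {ε : PrimarySpace lam} (hε : ε ∈ betaSet r σ lam) {U : ℤ}
    (hU : ∀ n > U, ε.digit n = 0) (N : ℤ) : seqVal lam⁻¹ (ε.tail N) < 1 :=
  h.seqVal_lt_one (hε.lexAdmissible_fwdSeq N) (n := (U - N + 1).toNat) fun m hm =>
    hU (N + m) (by omega)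

lemma coding_injOn_finite : Set.InjOn h.coding {ε | ε ∈ betaSet r σ lam ∧ ε.IsFiniteSeq} := by
  rintro ε ⟨hε, hfin⟩ ε' ⟨hε', hfin'⟩ heq
  obtain ⟨K, hK⟩ := (hfin.union hfin').bddBelow
  obtain ⟨U, hU⟩ := (hfin.union hfin').bddAbove
  set N := K - 1
  have hlow {n : ℤ} (hn : n ≤ N) : ε.digit n = 0 ∧ ε'.digit n = 0 := by
    by_contra hne
    have := hK (not_and_or.1 hne)
    omega
  have hhigh {n : ℤ} (hn : n > U) : ε.digit n = 0 ∧ ε'.digit n = 0 := by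
    by_contra hne
    have := hU (not_and_or.1 hne)
    omega
  have hproj : torusProj (coordVec lam σ ε.digit N) = torusProj (coordVec lam σ ε'.digit N) := by
    rw [h.torusProj_coordVec hε, h.torusProj_coordVec hε', ← h.coding_apply, ← h.coding_apply, heq]
  rw [coordVec_of_bwd_eq_zero lam σ fun _ hn => (hlow hn).1,
    coordVec_of_bwd_eq_zero lam σ fun _ hn => (hlow hn).2, torusProj_eq_iff] at hproj
  obtain ⟨k, hk⟩ := hproj
  have hval := h.eq_zero_of_smul_unstableVec_eq_intVec
    (s := fwdCoord lam ε.digit N - fwdCoord lam ε'.digit N) (k := k)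
    (by rw [sub_smul, hk, add_sub_cancel_left])
  have htail : ε.tail (N + 1) = ε'.tail (N + 1) := by
    refine eq_of_seqVal_eq h.inv_pos (ε.seqSummable_tail h.one_lt _)
      (ε'.seqSummable_tail h.one_lt _) (fun k => ?_) (fun k => ?_) (sub_eq_zero.1 hval)
    · rw [PrimarySpace.dropSeq_tail]
      exact h.seqVal_tail_lt_one hε (fun _ hn => (hhigh hn).1) _
    · rw [PrimarySpace.dropSeq_tail]
      exact h.seqVal_tail_lt_one hε' (fun _ hn => (hhigh hn).2) _
  ext n
  rcases le_or_gt n N with hn | hn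
  · rw [(hlow hn).1, (hlow hn).2]
  · obtain ⟨j, rfl⟩ : ∃ j : ℕ, n = N + 1 + j := ⟨(n - (N + 1)).toNat, by omega⟩
    exact congrFun htail j

end IsQuadUnit

/-! ### Arithmetic codings contain all admissible sequences -/

lemma toLex_le_of_cons_zero {a b : ℕ → ℕ} (h0 : b 0 = 0) (hs : ∀ j, b (j + 1) = a j) :
    toLex b ≤ toLex a := by
  rw [← not_lexLess_iff]
  rintro ⟨n, hn, hlt⟩
  have hz : ∀ m < n, a m = 0 := by
    intro m
    induction m with
    | zero => intro hm; rw [hn 0 hm, h0]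
    | succ m ih => intro hm; rw [hn _ hm, hs, ih (by omega)]
  cases n with
  | zero => omega
  | succ n => rw [hs, hz n (by omega)] at hlt; omega

lemma toLex_fwdSeq_sub_le {f : ℤ → ℕ} {a : ℤ} (hlow : ∀ n < a, f n = 0) (j : ℕ) :
    toLex (fwdSeq f (a - j)) ≤ toLex (fwdSeq f a) := by
  induction j with
  | zero => simp
  | succ j ih =>
    refine le_trans (toLex_le_of_cons_zero (hlow _ (by omega)) fun i => ?_) ih
    simp only [fwdSeq]
    congr 1
    push_cast
    ring

lemma exists_max_fwdSeq {f : ℤ → ℕ} {a b : ℤ} (hab : a ≤ b) (hlow : ∀ n < a, f n = 0)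
    (hhigh : ∀ n > b, f n = 0) : ∃ K₀, ∀ K, toLex (fwdSeq f K) ≤ toLex (fwdSeq f K₀) := by
  obtain ⟨K₀, -, hK₀⟩ := Finset.exists_max_image (Finset.Icc a b) (fun K => toLex (fwdSeq f K))
    ⟨a, Finset.left_mem_Icc.2 hab⟩
  refine ⟨K₀, fun K => ?_⟩
  rcases lt_or_ge K a with hK | hK
  · obtain ⟨j, rfl⟩ : ∃ j : ℕ, K = a - j := ⟨(a - K).toNat, by omega⟩
    exact (toLex_fwdSeq_sub_le hlow j).trans (hK₀ a (Finset.left_mem_Icc.2 hab))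
  · rcases le_or_gt K b with hKb | hKb
    · exact hK₀ K (Finset.mem_Icc.2 ⟨hK, hKb⟩)
    · refine Pi.toLex_monotone fun j => ?_
      rw [fwdSeq, hhigh _ (by omega)]
      exact zero_le

lemma PrimarySpace.digit_trunc_of_lt_natAbs {lam : ℝ} (ε : PrimarySpace lam) {N : ℕ} {n : ℤ}
    (hn : N < n.natAbs) : (trunc N ε).digit n = 0 := by
  rw [digit_trunc, if_neg]
  rw [Finset.mem_Icc]
  omega

lemma trunc_mem_betaSet {r σ : ℤ} {lam : ℝ} {ε : PrimarySpace lam} (hε : ε ∈ betaSet r σ lam)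
    (n : ℕ) : PrimarySpace.trunc n ε ∈ betaSet r σ lam := fun N =>
  not_lexLess_iff.2 ((Pi.toLex_monotone fun _ => PrimarySpace.digit_trunc_le n ε _).trans
    (not_lexLess_iff.1 (hε N)))

lemma IsTotal.exists_not_lexLess_tail {lam : ℝ} {X : Set (PrimarySpace lam)} (hX : IsTotal X)
    {ε ε' : PrimarySpace lam} (hε : ε ∈ X) (hε' : ε' ∉ X) (N : ℤ) :
    ∃ K, ¬ LexLess (ε'.tail K) (ε.tail N) := by
  by_contra! hall
  exact hε' (hX ε hε ε' ⟨N, fun k => hall (N + k)⟩)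

namespace IsQuadUnit

variable {r σ : ℤ} {lam : ℝ} (h : IsQuadUnit r σ lam)
include h

lemma volume_image_eq_zero {X : Set (PrimarySpace lam)} {w : ℕ → ℕ} (hw : SeqSummable lam⁻¹ w)
    (hw1 : seqVal lam⁻¹ w < 1) (hX : ∀ ε ∈ X, ShiftAdmissible w ε.digit)
    (C : Matrix (Fin 2) (Fin 2) ℤ) : volume ((fun ε => intMap C (h.coding ε)) '' X) = 0 := by
  have hnull : volume (valueSet lam⁻¹ w) = 0 :=
    volume_valueSet_eq_zero h.inv_pos h.inv_lt_one hw hw1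
  set L := Matrix.toLin' !![1, lam; 0, 1] with hL
  have hdet : LinearMap.det L = 1 := by
    rw [hL, LinearMap.det_toLin', Matrix.det_fin_two_of]
    simp
  set S := L ⁻¹' ((fun v : Fin 2 → ℝ => v 0) ⁻¹' valueSet lam⁻¹ w)
  have hS : volume S = 0 := by
    have hcyl : volume ((fun v : Fin 2 → ℝ => v 0) ⁻¹' valueSet lam⁻¹ w) = 0 :=
      Measure.pi_eval_preimage_null _ hnull
    rw [Measure.addHaar_preimage_linearMap _ (by rw [hdet]; exact one_ne_zero), hcyl, mul_zero]
  have hCS : volume (Matrix.toLin' (realMat C) '' S) = 0 := by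
    rw [Measure.addHaar_image_linearMap, hS, mul_zero]
  refine measure_mono_null ?_ (volume_image_torusProj_eq_zero hCS)
  rintro _ ⟨ε, hε, rfl⟩
  refine ⟨_, ⟨coordVec lam σ ε.digit 0, ?_, rfl⟩, ?_⟩
  · refine ⟨fwdSeq ε.digit (0 + 1), (hX ε hε).lexAdmissible_fwdSeq _, ?_⟩
    have hfwd := eigenPoint_fwd lam σ (fwdCoord lam ε.digit 0) (bwdCoord lam σ ε.digit 0)
    rw [← fwdCoord, ← hfwd]
    simp [hL, Matrix.mulVec, dotProduct, Fin.sum_univ_two, coordVec, mul_comm]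
  · rw [Matrix.toLin'_apply, ← intMap_torusProj, ← h.coding_apply]

lemma betaSet_subset {X : Set (PrimarySpace lam)} (hcl : IsClosed X) (htot : IsTotal X)
    {C : Matrix (Fin 2) (Fin 2) ℤ}
    (hsurj : Set.SurjOn (fun ε => intMap C (h.coding ε)) X Set.univ) : betaSet r σ lam ⊆ X := by
  intro ε hε
  refine hcl.mem_of_tendsto ε.tendsto_trunc (Eventually.of_forall fun n => ?_)
  by_contra hn
  -- If the truncation is missing, its greatest tail bounds every tail of every member of `X`.
  obtain ⟨K₀, hK₀⟩ := exists_max_fwdSeq (f := (PrimarySpace.trunc n ε).digit) (a := -n) (b := n)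
    (by omega) (fun _ hk => ε.digit_trunc_of_lt_natAbs (by omega))
    (fun _ hk => ε.digit_trunc_of_lt_natAbs (by omega))
  have hlt : seqVal lam⁻¹ ((PrimarySpace.trunc n ε).tail K₀) < 1 :=
    h.seqVal_tail_lt_one (trunc_mem_betaSet hε n) (U := n)
      (fun _ hk => ε.digit_trunc_of_lt_natAbs (by omega)) K₀
  have hbound (ε') (hε' : ε' ∈ X) :
      ShiftAdmissible ((PrimarySpace.trunc n ε).tail K₀) ε'.digit := fun N => by
    obtain ⟨K, hK⟩ := htot.exists_not_lexLess_tail hε' hn N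
    exact not_lexLess_iff.2 ((not_lexLess_iff.1 hK).trans (hK₀ K))
  have hnull := h.volume_image_eq_zero (PrimarySpace.seqSummable_tail h.one_lt _ K₀) hlt hbound C
  rw [Set.univ_subset_iff.1 hsurj, volume_pi, Measure.pi_univ] at hnull
  simp at hnull

end IsQuadUnit

/-! ### Homoclinic points -/

lemma exists_coe_eq_abs_eq_norm (x : UnitAddCircle) :
    ∃ y : ℝ, (y : UnitAddCircle) = x ∧ |y| = ‖x‖ := by
  induction x using QuotientAddGroup.induction_on with
  | H y =>
    refine ⟨y - round y, ?_, UnitAddCircle.norm_eq.symm⟩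
    rw [AddCircle.coe_sub, sub_eq_self]
    exact (AddCircle.coe_eq_zero_iff (1 : ℝ)).2 ⟨round y, by simp⟩

lemma exists_torusProj_eq_abs_eq_norm (t : UnitAddTorus (Fin 2)) :
    ∃ w, torusProj w = t ∧ ∀ i, |w i| = ‖t i‖ := by
  choose w hw hnorm using fun i => exists_coe_eq_abs_eq_norm (t i)
  exact ⟨w, funext hw, hnorm⟩

lemma eq_of_torusProj_eq {v w : Fin 2 → ℝ} (h : torusProj v = torusProj w)
    (hvw : ∀ i, |v i| + |w i| < 1) : v = w := by
  obtain ⟨k, hk⟩ := (torusProj_eq_iff _ _).1 h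
  suffices hk0 : k = 0 by
    rw [hk, hk0]
    funext i
    simp [intVec]
  funext i
  have hki : (k i : ℝ) = v i - w i := by rw [hk]; simp [intVec]
  have hlt : |(k i : ℝ)| < 1 := hki ▸ (abs_sub _ _).trans_lt (hvw i)
  exact Int.abs_lt_one_iff.1 (by exact_mod_cast hlt)

lemma abs_mulVec_le {m n : Type*} [Fintype m] [Fintype n] (A : Matrix m n ℝ) {w : n → ℝ} {δ : ℝ}
    (hδ : 0 ≤ δ) (hw : ∀ j, |w j| ≤ δ) (i : m) :
    |A.mulVec w i| ≤ (∑ i, ∑ j, |A i j|) * δ :=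
  calc |A.mulVec w i| ≤ ∑ j, |A i j * w j| := Finset.abs_sum_le_sum_abs _ _
    _ ≤ ∑ j, |A i j| * δ := Finset.sum_le_sum fun j _ => by
        rw [abs_mul]
        gcongr
        exact hw j
    _ = (∑ j, |A i j|) * δ := (Finset.sum_mul _ _ _).symm
    _ ≤ (∑ i, ∑ j, |A i j|) * δ := by
        gcongr
        exact Finset.single_le_sum (f := fun i => ∑ j, |A i j|)
          (fun i _ => Finset.sum_nonneg fun j _ => abs_nonneg _) (Finset.mem_univ i)

lemma exists_bounded_orbit (A : Matrix (Fin 2) (Fin 2) ℤ) {t : ℕ → UnitAddTorus (Fin 2)}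
    (hA : ∀ n, t (n + 1) = intMap A (t n)) (ht : Tendsto t atTop (𝓝 0)) :
    ∃ (N : ℕ) (w : ℕ → Fin 2 → ℝ), torusProj (w 0) = t N ∧
      (∀ n, w (n + 1) = (realMat A).mulVec (w n)) ∧ ∀ n i, |w n i| ≤ 1 := by
  choose w hw hnorm using fun n => exists_torusProj_eq_abs_eq_norm (t n)
  set S : ℝ := ∑ i, ∑ j, |realMat A i j|
  have hS : 0 ≤ S := Finset.sum_nonneg fun i _ => Finset.sum_nonneg fun j _ => abs_nonneg _
  have hδ : 0 < 1 / (S + 2) := by positivity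
  have hsmall : ∀ᶠ n in atTop, ∀ i, ‖t n i‖ < 1 / (S + 2) := eventually_all.2 fun i =>
    (tendsto_zero_iff_norm_tendsto_zero.1 (tendsto_pi_nhds.1 ht i)).eventually_lt_const hδ
  obtain ⟨N, hN⟩ := eventually_atTop.1 hsmall
  have hlt : ∀ n i, |w (N + n) i| < 1 / (S + 2) := fun n i => by
    rw [hnorm]
    exact hN _ (by omega) i
  refine ⟨N, fun n => w (N + n), by simp [hw], fun n => ?_, fun n i => (hlt n i).le.trans ?_⟩
  · refine eq_of_torusProj_eq (by rw [← intMap_torusProj, hw, hw, ← hA, add_assoc]) fun i => ?_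
    calc |w (N + (n + 1)) i| + |(realMat A).mulVec (w (N + n)) i|
        < 1 / (S + 2) + S * (1 / (S + 2)) :=
          add_lt_add_of_lt_of_le (hlt _ i) (abs_mulVec_le _ hδ.le (fun j => (hlt n j).le) i)
      _ = (S + 1) / (S + 2) := by ring
      _ < 1 := by
        rw [div_lt_one (by positivity)]
        linarith
  · rw [div_le_one (by positivity)]
    linarith

lemma eq_zero_of_pow_mul_le {α x C : ℝ} (hα : 1 < |α|) (h : ∀ n : ℕ, |α ^ n * x| ≤ C) : x = 0 := by
  by_contra hx
  obtain ⟨n, hn⟩ := pow_unbounded_of_one_lt (C / |x|) hα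
  rw [div_lt_iff₀ (abs_pos.2 hx), ← abs_pow, ← abs_mul] at hn
  exact hn.not_ge (h n)

lemma realMat_pow_mulVec {A : Matrix (Fin 2) (Fin 2) ℤ} {β : ℝ} {w : Fin 2 → ℝ}
    (hw : (realMat A).mulVec w = β • w) (k : ℕ) : (realMat (A ^ k)).mulVec w = β ^ k • w := by
  induction k with
  | zero => simp [realMat_one]
  | succ k ih =>
    rw [pow_succ, realMat_mul, ← Matrix.mulVec_mulVec, hw, Matrix.mulVec_smul, ih, smul_smul,
      pow_succ']

-- The hypothesis `hαβ` is the Cayley–Hamilton identity `(A - α) (A - β) = 0`.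
lemma exists_eigenvector_of_tendsto {A : Matrix (Fin 2) (Fin 2) ℤ} (hA : IsUnit A.det) {α β : ℝ}
    (hα : 1 < |α|) (hβ : β ≠ 0)
    (hαβ : ∀ w, (realMat A).mulVec ((realMat A).mulVec w - β • w) =
      α • ((realMat A).mulVec w - β • w)) {t : ℕ → UnitAddTorus (Fin 2)}
    (htA : ∀ n, t (n + 1) = intMap A (t n)) (ht : Tendsto t atTop (𝓝 0)) :
    ∃ w, (realMat A).mulVec w = β • w ∧ torusProj w = t 0 := by
  obtain ⟨N, w, hw0, hw, hbound⟩ := exists_bounded_orbit A htA ht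
  set u : ℕ → Fin 2 → ℝ := fun n => (realMat A).mulVec (w n) - β • w n with hu
  have hpow : ∀ n, u n = α ^ n • u 0 := fun n => by
    induction n with
    | zero => simp
    | succ n ih =>
      rw [pow_succ', mul_smul, ← ih]
      simp only [hu]
      rw [hw n, ← hαβ, Matrix.mulVec_sub, Matrix.mulVec_smul]
  have hu0 : u 0 = 0 := funext fun i => eq_zero_of_pow_mul_le (C := 1 + |β|) hα fun n => by
    calc |α ^ n * u 0 i| = |w (n + 1) i - β * w n i| := by
          rw [← smul_eq_mul, ← Pi.smul_apply, ← hpow, hw]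
          rfl
      _ ≤ |w (n + 1) i| + |β| * |w n i| := (abs_sub _ _).trans_eq (by rw [abs_mul])
      _ ≤ 1 + |β| * 1 := by
        gcongr
        exacts [hbound _ i, hbound n i]
      _ = 1 + |β| := by rw [mul_one]
  have heig : (realMat A).mulVec (w 0) = β • w 0 := sub_eq_zero.1 hu0
  have htk : ∀ k, t k = intMap (A ^ k) (t 0) := fun k => by
    induction k with
    | zero => simp [intMap_one]
    | succ k ih => rw [htA, ih, ← intMap_mul, pow_succ']
  refine ⟨(β ^ N)⁻¹ • w 0, by rw [Matrix.mulVec_smul, heig, smul_comm], ?_⟩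
  apply intMap_injective (C := A ^ N) (by rw [Matrix.det_pow]; exact hA.pow N)
  rw [← htk, intMap_torusProj, Matrix.mulVec_smul, realMat_pow_mulVec heig,
    inv_smul_smul₀ (pow_ne_zero _ hβ), hw0]

/-! ### The codings of a toral automorphism -/

/-- The matrix with columns `m` and `M m`; it intertwines the companion matrix of `M` with `M`. -/
def cyclicMat (M : GL (Fin 2) ℤ) (m : Fin 2 → ℤ) : Matrix (Fin 2) (Fin 2) ℤ :=
  !![m 0, M.1.mulVec m 0; m 1, M.1.mulVec m 1]

/-- The representative, on the expanding eigenline of `M`, of the homoclinic point attached to the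
integer vector `m`. -/
noncomputable def homVec (M : GL (Fin 2) ℤ) (m : Fin 2 → ℤ) : Fin 2 → ℝ :=
  (realMat (cyclicMat M m)).mulVec (unstableVec (eigen M) M.1.det)

section
variable (M : GL (Fin 2) ℤ)

lemma mul_cyclicMat (m : Fin 2 → ℤ) :
    M.1 * cyclicMat M m = cyclicMat M m * companion M.1.trace M.1.det := by
  ext i j
  fin_cases i <;> fin_cases j <;>
    simp [cyclicMat, companion, Matrix.mul_apply, Fin.sum_univ_two, Matrix.mulVec, dotProduct,
      Matrix.trace_fin_two, Matrix.det_fin_two] <;> ring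

lemma isUnit_det_coe : IsUnit M.1.det := Matrix.isUnits_det_units M

lemma toralMap_mul (A : GL (Fin 2) ℤ) (x : UnitAddTorus (Fin 2)) :
    toralMap (A * M) x = toralMap A (toralMap M x) := by
  simp only [toralMap_eq, Units.val_mul, intMap_mul]

lemma toralMap_injective : Function.Injective (toralMap M) :=
  intMap_injective (isUnit_det_coe M)

end

lemma PrimarySpace.hom_ext {lam : ℝ} {φ ψ : PrimarySpace lam →+ UnitAddTorus (Fin 2)}
    (hφ : Continuous φ) (hψ : Continuous ψ) (h : ∀ n, φ (single lam n) = ψ (single lam n)) :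
    φ = ψ := by
  ext1 ε
  have htrunc (N) : φ (trunc N ε) = ψ (trunc N ε) := by simp only [trunc, map_sum, map_nsmul, h]
  refine tendsto_nhds_unique ((hφ.tendsto ε).comp ε.tendsto_trunc) ?_
  exact ((hψ.tendsto ε).comp ε.tendsto_trunc).congr fun N => (htrunc N).symm

section
variable {M : GL (Fin 2) ℤ} {φ ψ : PrimarySpace (eigen M) →+ UnitAddTorus (Fin 2)} {v : Fin 2 → ℝ}

lemma IsGivenBy.unique (hφ : IsGivenBy M φ v) (hψ : IsGivenBy M ψ v) : φ = ψ := by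
  ext1 ε
  exact tendsto_nhds_unique (hφ ε) (hψ ε)

lemma IsGivenBy.apply_single_zero (hφ : IsGivenBy M φ v) :
    φ (PrimarySpace.single (eigen M) 0) = torusProj v := by
  refine tendsto_nhds_unique (hφ _) (tendsto_const_nhds.congr fun N => ?_)
  rw [Finset.sum_eq_single 0]
  · simp
  · intro n _ hn
    simp [hn]
  · intro h0
    rw [Finset.mem_Icc] at h0
    omega

lemma apply_single_sub_one (hφ : ∀ ε, φ ε.shift = toralMap M (φ ε)) (n : ℤ) :
    φ (PrimarySpace.single _ (n - 1)) = toralMap M (φ (PrimarySpace.single _ n)) := by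
  rw [← PrimarySpace.shift_single, hφ]

lemma toralMap_zpow_apply_single_zero (hφ : ∀ ε, φ ε.shift = toralMap M (φ ε)) (n : ℤ) :
    toralMap (M ^ n) (φ (PrimarySpace.single _ 0)) = φ (PrimarySpace.single _ (-n)) := by
  induction n using Int.induction_on with
  | zero => simp [toralMap_eq, intMap_one]
  | succ n ih =>
    rw [add_comm, zpow_add, zpow_one, toralMap_mul, ih, ← apply_single_sub_one hφ]
    congr 2
    ring
  | pred n ih =>
    apply toralMap_injective M
    rw [← toralMap_mul, ← zpow_one_add, ← apply_single_sub_one hφ, add_sub_cancel, ih]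
    congr 2
    ring

lemma tendsto_apply_single {ι : Type*} (hM : 1 < eigen M) (hφ : Continuous φ) {l : Filter ι}
    {n : ι → ℤ} (hn : Tendsto (fun i => (n i).natAbs) l atTop) :
    Tendsto (fun i => φ (PrimarySpace.single _ (n i))) l (𝓝 0) := by
  have hsingle := PrimarySpace.tendsto_single hM (l := l.map n) (tendsto_map'_iff.2 hn)
  simpa [Function.comp_def] using (hφ.tendsto 0).comp (hsingle.comp tendsto_map)

end

section
variable {M : GL (Fin 2) ℤ} (hq : IsQuadUnit M.1.trace M.1.det (eigen M))
include hq

/-- The coding attached to the integer vector `m`: the coding of the companion matrix of `M`,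
followed by the endomorphism of the torus with matrix `cyclicMat M m`. -/
noncomputable def matrixCoding (m : Fin 2 → ℤ) :
    PrimarySpace (eigen M) →+ UnitAddTorus (Fin 2) :=
  (intMap (cyclicMat M m)).comp hq.coding

lemma matrixCoding_apply (m : Fin 2 → ℤ) (ε : PrimarySpace (eigen M)) :
    matrixCoding hq m ε = intMap (cyclicMat M m) (hq.coding ε) := rfl

lemma continuous_matrixCoding (m : Fin 2 → ℤ) : Continuous (matrixCoding hq m) :=
  (continuous_intMap _).comp hq.continuous_coding

lemma matrixCoding_shift (m : Fin 2 → ℤ) (ε : PrimarySpace (eigen M)) :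
    matrixCoding hq m ε.shift = toralMap M (matrixCoding hq m ε) := by
  rw [matrixCoding_apply, matrixCoding_apply, hq.coding_shift, ← intMap_mul, ← mul_cyclicMat,
    intMap_mul, toralMap_eq]

lemma isGivenBy_matrixCoding (m : Fin 2 → ℤ) :
    IsGivenBy M (matrixCoding hq m) (homVec M m) := fun ε => by
  refine (((continuous_matrixCoding hq m).tendsto ε).comp ε.tendsto_trunc).congr fun N => ?_
  rw [Function.comp, matrixCoding_apply, hq.coding_trunc, intMap_torusProj, Matrix.mulVec_smul]
  rfl

lemma mulVec_homVec (m : Fin 2 → ℤ) :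
    (realMat M.1).mulVec (homVec M m) = eigen M • homVec M m := by
  unfold homVec
  rw [Matrix.mulVec_mulVec, ← realMat_mul, mul_cyclicMat, realMat_mul, ← Matrix.mulVec_mulVec,
    hq.mulVec_unstableVec, Matrix.mulVec_smul]

lemma isHomoclinicCoord_homVec (m : Fin 2 → ℤ) : IsHomoclinicCoord M (homVec M m) := by
  have hlim {l : Filter ℤ} (hl : Tendsto Int.natAbs l atTop) :
      Tendsto (fun n : ℤ => toralMap (M ^ n) (torusProj (homVec M m))) l (𝓝 0) := by
    refine (tendsto_apply_single hq.one_lt (continuous_matrixCoding hq m) (n := Neg.neg)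
      (by simpa using hl)).congr fun n => ?_
    rw [← (isGivenBy_matrixCoding hq m).apply_single_zero,
      toralMap_zpow_apply_single_zero (matrixCoding_shift hq m)]
  exact ⟨mulVec_homVec hq m,
    hlim (tendsto_atTop.2 fun b => (eventually_ge_atTop (b : ℤ)).mono fun n hn => by omega),
    hlim (tendsto_atTop.2 fun b => (eventually_le_atBot (-(b : ℤ))).mono fun n hn => by omega)⟩

end

lemma realMat_mulVec_mulVec (A : Matrix (Fin 2) (Fin 2) ℤ) (w : Fin 2 → ℝ) :
    (realMat A).mulVec ((realMat A).mulVec w) =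
      (A.trace : ℝ) • (realMat A).mulVec w - (A.det : ℝ) • w := by
  funext i
  fin_cases i <;>
    simp [realMat, Matrix.mulVec, dotProduct, Fin.sum_univ_two, Matrix.trace_fin_two,
      Matrix.det_fin_two] <;> ring

section
variable {A : Matrix (Fin 2) (Fin 2) ℤ} (hA : IsUnit A.det)
include hA

lemma realMat_mulVec_inv_mulVec (w : Fin 2 → ℝ) :
    (realMat A).mulVec ((realMat A⁻¹).mulVec w) = w := by
  rw [Matrix.mulVec_mulVec, ← realMat_mul, Matrix.mul_nonsing_inv _ hA, realMat_one,
    Matrix.one_mulVec]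

lemma realMat_inv_mulVec_mulVec (w : Fin 2 → ℝ) :
    (realMat A⁻¹).mulVec ((realMat A).mulVec w) = w := by
  rw [Matrix.mulVec_mulVec, ← realMat_mul, Matrix.nonsing_inv_mul _ hA, realMat_one,
    Matrix.one_mulVec]

end

section
variable {A : Matrix (Fin 2) (Fin 2) ℤ} {lam : ℝ} (hq : IsQuadUnit A.trace A.det lam)
  {t : ℕ → UnitAddTorus (Fin 2)}
include hq

lemma IsQuadUnit.trace_eq : (A.trace : ℝ) = lam + A.det * lam⁻¹ := by rw [hq.conj_eq]; ring

lemma IsQuadUnit.conj_ne_zero : (A.det : ℝ) * lam⁻¹ ≠ 0 :=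
  mul_ne_zero (Int.cast_ne_zero.2 hq.isUnit_sign.ne_zero) hq.inv_pos.ne'

lemma IsQuadUnit.exists_stable_rep (htA : ∀ n, t (n + 1) = intMap A (t n))
    (ht : Tendsto t atTop (𝓝 0)) :
    ∃ s, (realMat A).mulVec s = (A.det * lam⁻¹) • s ∧ torusProj s = t 0 := by
  refine exists_eigenvector_of_tendsto hq.isUnit_sign (α := lam)
    (by rw [abs_of_pos hq.pos]; exact hq.one_lt) hq.conj_ne_zero (fun w => ?_) htA ht
  have hdet : (A.det : ℝ) = lam * (A.det * lam⁻¹) := by rw [mul_left_comm, hq.mul_inv, mul_one]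
  rw [Matrix.mulVec_sub, Matrix.mulVec_smul, realMat_mulVec_mulVec, hq.trace_eq]
  nth_rw 2 [hdet]
  module

lemma IsQuadUnit.exists_unstable_rep (htA : ∀ n, t n = intMap A (t (n + 1)))
    (ht : Tendsto t atTop (𝓝 0)) :
    ∃ v, (realMat A).mulVec v = lam • v ∧ torusProj v = t 0 := by
  have hA := hq.isUnit_sign
  have hα : 1 < |((A.det : ℝ) * lam⁻¹)⁻¹| := by
    rw [abs_inv, abs_mul, hq.abs_sign, one_mul, abs_of_pos hq.inv_pos, inv_inv]
    exact hq.one_lt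
  obtain ⟨v, hv, hvt⟩ := exists_eigenvector_of_tendsto (A := A⁻¹)
    (Matrix.isUnit_nonsing_inv_det _ hA) hα hq.inv_pos.ne' (fun w => by
      obtain ⟨x, rfl⟩ : ∃ x, w = (realMat A).mulVec ((realMat A).mulVec x) :=
        ⟨(realMat A⁻¹).mulVec ((realMat A⁻¹).mulVec w), by simp only [realMat_mulVec_inv_mulVec hA]⟩
      have hdet := left_ne_zero_of_mul hq.conj_ne_zero
      have hlam := hq.pos.ne'
      rw [Matrix.mulVec_sub, Matrix.mulVec_smul, realMat_inv_mulVec_mulVec hA,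
        realMat_inv_mulVec_mulVec hA, realMat_mulVec_mulVec, hq.trace_eq]
      generalize (A.det : ℝ) = d at hdet ⊢
      match_scalars <;> field_simp
      ring)
    (fun n => by rw [htA n, intMap_inv_intMap hA]) ht
  refine ⟨v, ?_, hvt⟩
  rw [← inv_smul_eq_iff₀ hq.pos.ne', ← Matrix.mulVec_smul, ← hv, realMat_mulVec_inv_mulVec hA]

end

section
variable {M : GL (Fin 2) ℤ} (hq : IsQuadUnit M.1.trace M.1.det (eigen M))
include hq

lemma homVec_eq_of_eq_add_intVec {v s : Fin 2 → ℝ} {m : Fin 2 → ℤ}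
    (hv : (realMat M.1).mulVec v = eigen M • v)
    (hs : (realMat M.1).mulVec s = (M.1.det * (eigen M)⁻¹) • s) (hvs : v = s + intVec m) :
    homVec M m = v := by
  set c : ℝ := M.1.det * (eigen M)⁻¹ with hc
  have hm (i) : (m i : ℝ) = v i - s i := by simp [hvs, intVec]
  have hMm (i) : ((M.1.mulVec m i : ℤ) : ℝ) = eigen M * v i - c * s i := by
    have heq : intVec (M.1.mulVec m) = eigen M • v - c • s := by
      rw [← realMat_mulVec_intVec, ← hv, ← hs, ← Matrix.mulVec_sub, hvs, add_sub_cancel_left]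
    exact congrFun heq i
  have hne : eigen M - c ≠ 0 := hq.lam_sub_conj_pos.ne'
  have hhom (i) : homVec M m i = (-c * m i + M.1.mulVec m i) / (eigen M - c) := by
    fin_cases i <;>
    · simp only [homVec, cyclicMat, unstableVec, eigenPoint, realMat, Matrix.mulVec, dotProduct,
        Fin.sum_univ_two, Matrix.map_apply]
      simp [← hc]
      field_simp
      ring
  funext i
  rw [hhom, hMm, hm, div_eq_iff hne]
  ring

lemma exists_eq_matrixCoding {φ : PrimarySpace (eigen M) →+ UnitAddTorus (Fin 2)}
    (hc : Continuous φ) (hφ : ∀ ε, φ ε.shift = toralMap M (φ ε)) :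
    ∃ m, φ = matrixCoding hq m := by
  have hstep (n : ℤ) := (apply_single_sub_one hφ n).trans (toralMap_eq M _)
  obtain ⟨s, hs, hsφ⟩ := hq.exists_stable_rep (t := fun n => φ (PrimarySpace.single _ (-n)))
    (fun n => by rw [← hstep, Nat.cast_succ, neg_add'])
    (tendsto_apply_single hq.one_lt hc (tendsto_id.congr fun n => by simp))
  obtain ⟨v, hv, hvφ⟩ := hq.exists_unstable_rep (t := fun n => φ (PrimarySpace.single _ n))
    (fun n => by rw [← hstep, Nat.cast_succ, add_sub_cancel_right])
    (tendsto_apply_single hq.one_lt hc (tendsto_id.congr fun n => by simp))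
  rw [Nat.cast_zero] at hsφ hvφ
  rw [neg_zero] at hsφ
  obtain ⟨m, hm⟩ := (torusProj_eq_iff v s).1 (hvφ.trans hsφ.symm)
  refine ⟨m, PrimarySpace.hom_ext hc (continuous_matrixCoding hq m) fun n => ?_⟩
  rw [← neg_neg n, ← toralMap_zpow_apply_single_zero hφ,
    ← toralMap_zpow_apply_single_zero (matrixCoding_shift hq m),
    (isGivenBy_matrixCoding hq m).apply_single_zero, homVec_eq_of_eq_add_intVec hq hv hs hm, hvφ]

lemma isArithmeticCoding_matrixCoding {m : Fin 2 → ℤ} (hm : IsUnit (cyclicMat M m).det) :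
    IsArithmeticCoding M (matrixCoding hq m) (betaSet M.1.trace M.1.det (eigen M)) where
  continuous := continuous_matrixCoding hq m
  equivariant := matrixCoding_shift hq m
  closed := PrimarySpace.isClosed_shiftAdmissible hq.pos.ne' _
  shift_invariant _ := shift_mem_betaSet
  total := by
    rintro ε hε ε' ⟨N, hN⟩ K hK
    have hlt := hN (K - N)
    rw [add_sub_cancel] at hlt
    exact hε N (LexLess.trans hK hlt)
  surjOn := by
    intro x _
    obtain ⟨ε, hε, hx⟩ := hq.coding_surjOn (Set.mem_univ (intMap (cyclicMat M m)⁻¹ x))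
    refine ⟨ε, hε, ?_⟩
    rw [matrixCoding_apply, hx, intMap_intMap_inv hm]
  injOn_finite := fun _ hε _ hε' h =>
    hq.coding_injOn_finite hε hε' (intMap_injective hm h)

lemma isBAC_matrixCoding {m : Fin 2 → ℤ} (hm : IsUnit (cyclicMat M m).det) :
    IsBAC M (matrixCoding hq m) := by
  refine ⟨_, isArithmeticCoding_matrixCoding hq hm, ?_⟩
  have hinv := measurePreserving_intMap (Matrix.isUnit_nonsing_inv_det _ hm)
  filter_upwards [hinv.quasiMeasurePreserving.ae hq.ae_coding_injOn] with x hx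
  obtain ⟨ε, hε, hεx⟩ := hq.coding_surjOn (Set.mem_univ (intMap (cyclicMat M m)⁻¹ x))
  refine ⟨ε, ⟨hε, ?_⟩, ?_⟩
  · rw [matrixCoding_apply, hεx, intMap_intMap_inv hm]
  · rintro ε' ⟨hε', hεx'⟩
    refine hx ε' hε' ε hε ?_ hεx
    rw [← hεx', matrixCoding_apply, intMap_inv_intMap hm]

lemma IsBAC.exists_eq_matrixCoding {φ : PrimarySpace (eigen M) →+ UnitAddTorus (Fin 2)}
    (hφ : IsBAC M φ) : ∃ m, IsUnit (cyclicMat M m).det ∧ φ = matrixCoding hq m := by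
  obtain ⟨X, hX, hae⟩ := hφ
  obtain ⟨m, rfl⟩ := ArithmeticCoding.exists_eq_matrixCoding hq hX.continuous hX.equivariant
  refine ⟨m, isUnit_det_of_injective fun a b hab => ?_, rfl⟩
  have hsub := hq.betaSet_subset hX.closed hX.total (C := cyclicMat M m) hX.surjOn
  obtain ⟨x, ε, ⟨-, hεx⟩, huniq⟩ := hae.exists
  have hfiber {c} (hc : intMap (cyclicMat M m) c = x) : hq.coding ε = c := by
    obtain ⟨ε', hε', rfl⟩ := hq.coding_surjOn (Set.mem_univ c)
    rw [← huniq ε' ⟨hsub hε', hc⟩]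
  have hshift := hfiber (c := hq.coding ε + (a - b)) (by
    rw [map_add, map_sub, hab, sub_self, add_zero]
    exact hεx)
  exact sub_eq_zero.1 (left_eq_add.1 hshift)

end

/-! ### The Dirichlet group -/

/-- The norm of `a + b λ`, where `λ ^ 2 = r λ - σ`. -/
def quadNorm (r σ a b : ℤ) : ℤ := a ^ 2 + a * b * r + b ^ 2 * σ

lemma neg_mem_signedPowers {μ u : ℝ} (hu : -u ∈ signedPowers μ) : u ∈ signedPowers μ := by
  obtain ⟨k, hk | hk⟩ := hu
  · exact ⟨k, Or.inr (by rw [← hk, neg_neg])⟩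
  · exact ⟨k, Or.inl (neg_injective hk)⟩

section
variable {D : ℤ} {u : ℝ}

lemma neg_mem_dirichletGroup (hu : u ∈ dirichletGroup D) : -u ∈ dirichletGroup D := by
  obtain ⟨x, y, hxy, rfl⟩ := hu
  exact ⟨-x, -y, by simpa using hxy, by push_cast; ring⟩

lemma one_mem_dirichletGroup : (1 : ℝ) ∈ dirichletGroup D :=
  ⟨2, 0, Or.inl (by norm_num), by simp⟩

lemma mul_conj_sqrt (hD : 0 ≤ D) (x y : ℤ) :
    ((x : ℝ) + y * √D) / 2 * ((x - y * √D) / 2) = ((x ^ 2 - D * y ^ 2 : ℤ) : ℝ) / 4 := by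
  have hsq : √(D : ℝ) ^ 2 = D := Real.sq_sqrt (by exact_mod_cast hD)
  push_cast
  linear_combination (-(y : ℝ) ^ 2 / 4) * hsq

lemma zero_notMem_dirichletGroup (hD : 0 ≤ D) : (0 : ℝ) ∉ dirichletGroup D := by
  rintro ⟨x, y, hxy, h0⟩
  have hmul := mul_conj_sqrt hD x y
  rw [← h0, zero_mul] at hmul
  rcases hxy with hxy | hxy <;> norm_num [hxy] at hmul

lemma pos_of_one_lt_unit (hD : 0 < D) {x y : ℤ}
    (hxy : x ^ 2 - D * y ^ 2 = 4 ∨ x ^ 2 - D * y ^ 2 = -4)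
    (hgt : 1 < (x + y * √D) / 2) : 0 < x ∧ 0 < y := by
  have hconj : |(x - y * √D) / 2| < 1 := by
    have hnorm : |(x + y * √D) / 2| * |(x - y * √D) / 2| = 1 := by
      rw [← abs_mul, mul_conj_sqrt hD.le]
      rcases hxy with hxy | hxy <;> rw [hxy] <;> norm_num
    rw [abs_of_pos (zero_lt_one.trans hgt)] at hnorm
    by_contra! hge
    exact (one_lt_mul_of_lt_of_le hgt hge).ne' hnorm
  rw [abs_lt] at hconj
  have hx : (0 : ℝ) < x := by linarith
  have hy : (0 : ℝ) < y := pos_of_mul_pos_left (by linarith) (Real.sqrt_nonneg D)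
  exact ⟨by exact_mod_cast hx, by exact_mod_cast hy⟩

end

namespace IsQuadUnit

variable {r σ : ℤ} {lam : ℝ} (h : IsQuadUnit r σ lam)
include h

lemma discrim_pos : 0 < r ^ 2 - 4 * σ := by
  have hpos := h.lam_sub_conj_pos
  rw [h.sqrt_discrim, Real.sqrt_pos] at hpos
  exact_mod_cast hpos

lemma eq_add_sqrt : lam = (r + √((r ^ 2 - 4 * σ : ℤ) : ℝ)) / 2 := by
  rw [← h.sqrt_discrim, h.conj_eq]
  ring

lemma mem_dirichletGroup_iff (u : ℝ) : u ∈ dirichletGroup (r ^ 2 - 4 * σ) ↔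
    ∃ a b : ℤ, IsUnit (quadNorm r σ a b) ∧ u = a + b * lam := by
  have hlam := h.eq_add_sqrt
  simp only [Int.isUnit_iff, quadNorm]
  constructor
  · rintro ⟨x, y, hxy, rfl⟩
    have hev : Even (x - r * y) := by
      suffices Even ((x - r * y) ^ 2) from (Int.even_pow.1 this).1
      rcases hxy with hxy | hxy
      · exact ⟨r ^ 2 * y ^ 2 - 2 * σ * y ^ 2 + 2 - r * x * y, by linear_combination hxy⟩
      · exact ⟨r ^ 2 * y ^ 2 - 2 * σ * y ^ 2 - 2 - r * x * y, by linear_combination hxy⟩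
    obtain ⟨a, ha⟩ := hev
    obtain rfl : x = 2 * a + r * y := by linarith
    refine ⟨a, y, hxy.imp (fun _ => by linarith) (fun _ => by linarith), ?_⟩
    push_cast at hlam ⊢
    linear_combination (-(y : ℝ)) * hlam
  · rintro ⟨a, b, hab, rfl⟩
    refine ⟨2 * a + r * b, b, hab.imp (fun _ => by linarith) (fun _ => by linarith), ?_⟩
    push_cast at hlam ⊢
    linear_combination (b : ℝ) * hlam

lemma mul_mem_dirichletGroup {u v : ℝ} (hu : u ∈ dirichletGroup (r ^ 2 - 4 * σ))
    (hv : v ∈ dirichletGroup (r ^ 2 - 4 * σ)) : u * v ∈ dirichletGroup (r ^ 2 - 4 * σ) := by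
  rw [h.mem_dirichletGroup_iff] at hu hv ⊢
  obtain ⟨a, b, hab, rfl⟩ := hu
  obtain ⟨a', b', hab', rfl⟩ := hv
  refine ⟨a * a' - σ * (b * b'), a * b' + b * a' + r * (b * b'), ?_, ?_⟩
  · convert hab.mul hab' using 1
    unfold quadNorm
    ring
  · push_cast
    linear_combination (b : ℝ) * b' * h.eqn

lemma mem_dirichletGroup : lam ∈ dirichletGroup (r ^ 2 - 4 * σ) :=
  (h.mem_dirichletGroup_iff _).2 ⟨0, 1, by simpa [quadNorm] using h.isUnit_sign, by simp⟩

lemma inv_mem_dirichletGroup : lam⁻¹ ∈ dirichletGroup (r ^ 2 - 4 * σ) := by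
  refine (h.mem_dirichletGroup_iff _).2 ⟨σ * r, -σ, ?_, ?_⟩
  · convert h.isUnit_sign.pow 3 using 1
    unfold quadNorm
    ring
  · have hσ : (σ : ℝ) * σ = 1 := by exact_mod_cast Int.isUnit_mul_self h.isUnit_sign
    push_cast
    linear_combination (σ : ℝ) * h.conj_eq - lam⁻¹ * hσ

lemma zpow_mem_dirichletGroup (k : ℤ) : lam ^ k ∈ dirichletGroup (r ^ 2 - 4 * σ) := by
  induction k using Int.induction_on with
  | zero => simpa using one_mem_dirichletGroup
  | succ k ih =>
    rw [zpow_add_one₀ h.pos.ne']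
    exact h.mul_mem_dirichletGroup ih h.mem_dirichletGroup
  | pred k ih =>
    rw [zpow_sub_one₀ h.pos.ne']
    exact h.mul_mem_dirichletGroup ih h.inv_mem_dirichletGroup

lemma eq_one_of_mem_dirichletGroup (hne : ¬ (r = 3 ∧ σ = 1)) {w : ℝ}
    (hw : w ∈ dirichletGroup (r ^ 2 - 4 * σ)) (hge : 1 ≤ w) (hlt : w < lam) : w = 1 := by
  by_contra hw1
  obtain ⟨x, y, hxy, rfl⟩ := hw
  obtain ⟨hx, hy⟩ := pos_of_one_lt_unit h.discrim_pos hxy (lt_of_le_of_ne hge (Ne.symm hw1))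
  rw [h.eq_add_sqrt] at hlt
  have hsq : √((r ^ 2 - 4 * σ : ℤ) : ℝ) ^ 2 = (r ^ 2 - 4 * σ : ℤ) :=
    Real.sq_sqrt (by exact_mod_cast h.discrim_pos.le)
  have hs := Real.sqrt_nonneg ((r ^ 2 - 4 * σ : ℤ) : ℝ)
  generalize √((r ^ 2 - 4 * σ : ℤ) : ℝ) = s at *
  have hyR : (1 : ℝ) ≤ y := by exact_mod_cast hy
  obtain rfl : y = 1 := by
    by_contra hy1
    have hy2 : (2 : ℝ) ≤ y := by exact_mod_cast (show 2 ≤ y by omega)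
    have hxR : (1 : ℝ) ≤ x := by exact_mod_cast hx
    have hsr : s ^ 2 < (r - 1) ^ 2 := by
      have : s < r - 1 := by nlinarith
      gcongr
    rw [hsq] at hsr
    have hsr : r ^ 2 - 4 * σ < (r - 1) ^ 2 := by exact_mod_cast hsr
    rcases h.sign with ⟨rfl, hr⟩ | ⟨rfl, hr⟩ <;> linarith
  have hxr : x < r := by
    have : (x : ℝ) < r := by push_cast at hlt; linarith
    exact_mod_cast this
  rcases h.sign with ⟨rfl, hr⟩ | ⟨rfl, -⟩
  · rcases hxy with hxy | hxy
    · nlinarith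
    · have hr4 : r ≤ 4 := by nlinarith
      obtain rfl : r = 4 := by
        by_contra
        exact hne ⟨by omega, rfl⟩
      interval_cases x <;> omega
  · rcases hxy with hxy | hxy <;> nlinarith

lemma mem_signedPowers_of_pos (hne : ¬ (r = 3 ∧ σ = 1)) {u : ℝ}
    (hu : u ∈ dirichletGroup (r ^ 2 - 4 * σ)) (hpos : 0 < u) : u ∈ signedPowers lam := by
  obtain ⟨k, hle, hlt⟩ := exists_mem_Ico_zpow hpos h.one_lt
  have hk : 0 < lam ^ k := zpow_pos h.pos k
  have hone : u * lam ^ (-k) = 1 := by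
    refine h.eq_one_of_mem_dirichletGroup hne
      (h.mul_mem_dirichletGroup hu (h.zpow_mem_dirichletGroup _)) ?_ ?_ <;>
      rw [zpow_neg, ← div_eq_mul_inv]
    · rwa [one_le_div hk]
    · rwa [div_lt_iff₀ hk, ← zpow_one_add₀ h.pos.ne', add_comm]
  rw [zpow_neg, mul_inv_eq_one₀ hk.ne'] at hone
  exact ⟨k, Or.inl hone⟩

lemma dirichletGroup_eq (hne : ¬ (r = 3 ∧ σ = 1)) :
    dirichletGroup (r ^ 2 - 4 * σ) = signedPowers lam := by
  refine Set.Subset.antisymm (fun u hu => ?_) ?_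
  · rcases lt_trichotomy u 0 with hneg | rfl | hpos
    · exact neg_mem_signedPowers
        (h.mem_signedPowers_of_pos hne (neg_mem_dirichletGroup hu) (neg_pos.2 hneg))
    · exact absurd hu (zero_notMem_dirichletGroup h.discrim_pos.le)
    · exact h.mem_signedPowers_of_pos hne hu hpos
  · rintro u ⟨k, rfl | rfl⟩
    · exact h.zpow_mem_dirichletGroup k
    · exact neg_mem_dirichletGroup (h.zpow_mem_dirichletGroup k)

end IsQuadUnit

lemma isQuadUnit_goldenRatio : IsQuadUnit 1 (-1) ((1 + √5) / 2) := by
  have h5 : √5 ^ 2 = (5 : ℝ) := Real.sq_sqrt (by norm_num)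
  have h1 : 1 < √5 := by rw [Real.lt_sqrt] <;> norm_num
  refine ⟨by linarith, ?_, Or.inr ⟨rfl, le_rfl⟩⟩
  push_cast
  linear_combination h5 / 4

/-! ### Hyperbolic matrices -/

section
variable {M : GL (Fin 2) ℤ} (hM : IsHyperbolicMatrix M)
include hM

lemma IsHyperbolicMatrix.norm_ne_one {μ : ℂ} (hμ : μ ^ 2 - M.1.trace * μ + M.1.det = 0) :
    ‖μ‖ ≠ 1 := by
  refine hM μ ?_
  rw [spectrum.mem_iff, Matrix.isUnit_iff_isUnit_det, isUnit_iff_ne_zero, not_not,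
    Matrix.det_fin_two, ← hμ, Matrix.trace_fin_two, Matrix.det_fin_two]
  simp [Matrix.algebraMap_matrix_apply]
  ring

lemma IsHyperbolicMatrix.trace_ne_one (hdet : M.1.det = 1) : M.1.trace ≠ 1 := by
  intro htr
  have h3 : √3 ^ 2 = (3 : ℝ) := Real.sq_sqrt (by norm_num)
  refine hM.norm_ne_one (μ := ⟨1 / 2, √3 / 2⟩) ?_ ?_
  · rw [hdet, htr]
    apply Complex.ext
    · simp only [pow_two, Complex.add_re, Complex.sub_re, Complex.mul_re, Complex.one_re,
        Complex.one_im, Int.cast_one, Complex.zero_re]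
      linear_combination -h3 / 4
    · simp only [pow_two, Complex.add_im, Complex.sub_im, Complex.mul_im, Complex.one_re,
        Complex.one_im, Int.cast_one, Complex.zero_im]
      ring
  · rw [Complex.norm_def, Complex.normSq_mk, Real.sqrt_eq_one]
    linear_combination h3 / 4

lemma IsHyperbolicMatrix.trace_ne_two (hdet : M.1.det = 1) : M.1.trace ≠ 2 := fun htr =>
  hM.norm_ne_one (μ := 1) (by rw [hdet, htr]; norm_num) norm_one

lemma IsHyperbolicMatrix.isQuadUnit (htr : 0 < M.1.trace) :
    IsQuadUnit M.1.trace M.1.det (eigen M) := by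
  have hsign : (M.1.det = 1 ∧ 3 ≤ M.1.trace) ∨ (M.1.det = -1 ∧ 1 ≤ M.1.trace) := by
    refine (Int.isUnit_iff.1 (isUnit_det_coe M)).imp (fun hdet => ⟨hdet, ?_⟩) (⟨·, htr⟩)
    have := hM.trace_ne_one hdet
    have := hM.trace_ne_two hdet
    omega
  have hD : 1 < discrim M := by
    unfold discrim
    rcases hsign with ⟨hdet, htr⟩ | ⟨hdet, -⟩ <;> rw [hdet] <;> nlinarith
  have hDR : (1 : ℝ) < discrim M := by exact_mod_cast hD
  have hsq : √(discrim M : ℝ) ^ 2 = M.1.trace ^ 2 - 4 * M.1.det := by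
    rw [Real.sq_sqrt (zero_le_one.trans hDR.le)]
    unfold discrim
    push_cast
    rfl
  have hsqrt : 1 < √(discrim M : ℝ) := by rwa [Real.lt_sqrt zero_le_one, one_pow]
  have htrR : (1 : ℝ) ≤ M.1.trace := by exact_mod_cast htr
  unfold eigen
  exact ⟨by linarith, by linear_combination hsq / 4, hsign⟩

end

/-! ### Unimodular cyclic matrices and the form `f_T` -/

lemma representsUnit_iff (M : GL (Fin 2) ℤ) :
    RepresentsUnit M ↔ ∃ m, IsUnit (cyclicMat M m).det := by
  have hform (x y : ℤ) : (cyclicMat M ![-y, x]).det = -assocForm M x y := by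
    simp [cyclicMat, assocForm, Matrix.det_fin_two, Matrix.mulVec, dotProduct, Fin.sum_univ_two]
    ring
  have hunit (x y : ℤ) : IsUnit (cyclicMat M ![-y, x]).det ↔
      assocForm M x y = 1 ∨ assocForm M x y = -1 := by
    rw [hform, IsUnit.neg_iff, Int.isUnit_iff]
  simp only [RepresentsUnit, ← hunit]
  constructor
  · rintro ⟨x, y, hxy⟩
    exact ⟨_, hxy⟩
  · rintro ⟨m, hm⟩
    refine ⟨m 1, -m 0, ?_⟩
    convert hm
    funext i
    fin_cases i <;> simp

section
variable {M : GL (Fin 2) ℤ} {m : Fin 2 → ℤ}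

lemma exists_coords (hm : IsUnit (cyclicMat M m).det) (k : Fin 2 → ℤ) :
    ∃ a b : ℤ, k = a • m + b • M.1.mulVec m := by
  set c := (cyclicMat M m)⁻¹.mulVec k with hc
  have hk : (cyclicMat M m).mulVec c = k := by
    rw [hc, Matrix.mulVec_mulVec, Matrix.mul_nonsing_inv _ hm, Matrix.one_mulVec]
  refine ⟨c 0, c 1, ?_⟩
  rw [← hk]
  funext i
  fin_cases i <;> simp [cyclicMat, Matrix.mulVec, dotProduct, Fin.sum_univ_two] <;> ring

variable (M m)

lemma det_cyclicMat_comb (a b : ℤ) : (cyclicMat M (a • m + b • M.1.mulVec m)).det =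
    quadNorm M.1.trace M.1.det a b * (cyclicMat M m).det := by
  simp [cyclicMat, Matrix.det_fin_two, Matrix.mulVec, dotProduct, Fin.sum_univ_two, quadNorm,
    Matrix.trace_fin_two]
  ring

lemma realMat_cyclicMat_comb (a b : ℤ) : realMat (cyclicMat M (a • m + b • M.1.mulVec m)) =
    (a : ℝ) • realMat (cyclicMat M m) + (b : ℝ) • (realMat M.1 * realMat (cyclicMat M m)) := by
  ext i j
  fin_cases i <;> fin_cases j <;>
    simp [realMat, cyclicMat, Matrix.mulVec, dotProduct, Fin.sum_univ_two, Matrix.mul_apply] <;>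
    ring

lemma cyclicMat_mulVec {K : Matrix (Fin 2) (Fin 2) ℤ} (hK : Commute K M.1) :
    cyclicMat M (K.mulVec m) = K * cyclicMat M m := by
  have hMK : M.1.mulVec (K.mulVec m) = K.mulVec (M.1.mulVec m) := by
    rw [Matrix.mulVec_mulVec, Matrix.mulVec_mulVec, hK.eq]
  unfold cyclicMat
  rw [hMK]
  ext i j
  fin_cases i <;> fin_cases j <;>
    simp [Matrix.mul_apply, Matrix.mulVec, dotProduct, Fin.sum_univ_two]

end

section
variable {M : GL (Fin 2) ℤ} (hq : IsQuadUnit M.1.trace M.1.det (eigen M)) {m : Fin 2 → ℤ}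
include hq

lemma admitsBAC_iff : AdmitsBAC M ↔ RepresentsUnit M := by
  rw [representsUnit_iff]
  constructor
  · rintro ⟨φ, hφ⟩
    obtain ⟨m, hm, -⟩ := hφ.exists_eq_matrixCoding hq
    exact ⟨m, hm⟩
  · rintro ⟨m, hm⟩
    exact ⟨_, isBAC_matrixCoding hq hm⟩

lemma homVec_comb (m : Fin 2 → ℤ) (a b : ℤ) :
    homVec M (a • m + b • M.1.mulVec m) = ((a : ℝ) + b * eigen M) • homVec M m := by
  have heig := mulVec_homVec hq m
  unfold homVec at heig ⊢
  rw [realMat_cyclicMat_comb, Matrix.add_mulVec, Matrix.smul_mulVec, Matrix.smul_mulVec,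
    ← Matrix.mulVec_mulVec, heig, smul_smul, add_smul]

lemma eq_zero_of_smul_homVec_eq_intVec (hm : IsUnit (cyclicMat M m).det) {s : ℝ} {k : Fin 2 → ℤ}
    (hs : s • homVec M m = intVec k) : s = 0 := by
  refine hq.eq_zero_of_smul_unstableVec_eq_intVec (k := (cyclicMat M m)⁻¹.mulVec k) ?_
  rw [← realMat_mulVec_intVec, ← hs, Matrix.mulVec_smul, homVec, realMat_inv_mulVec_mulVec hm]

lemma eq_of_isGivenBy_smul (hm : IsUnit (cyclicMat M m).det) {u w : ℝ}
    {φ : PrimarySpace (eigen M) →+ UnitAddTorus (Fin 2)} (hu : IsGivenBy M φ (u • homVec M m))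
    (hw : IsGivenBy M φ (w • homVec M m)) : u = w := by
  obtain ⟨k, hk⟩ := (torusProj_eq_iff _ _).1 (hu.apply_single_zero.symm.trans hw.apply_single_zero)
  refine sub_eq_zero.1 (eq_zero_of_smul_homVec_eq_intVec hq hm (k := k) ?_)
  rw [sub_smul, hk, add_sub_cancel_left]

lemma parametrizesBACs (hm : IsUnit (cyclicMat M m).det) :
    ParametrizesBACs M (dirichletGroup (discrim M)) (homVec M m) := by
  constructor
  · intro u hu
    obtain ⟨a, b, hab, rfl⟩ := (hq.mem_dirichletGroup_iff u).1 hu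
    rw [← homVec_comb hq]
    refine ⟨matrixCoding hq (a • m + b • M.1.mulVec m), ⟨isBAC_matrixCoding hq ?_,
      isGivenBy_matrixCoding hq _⟩, fun ψ hψ => hψ.2.unique (isGivenBy_matrixCoding hq _)⟩
    rw [det_cyclicMat_comb]
    exact hab.mul hm
  · intro φ hφ
    obtain ⟨m', hm', rfl⟩ := hφ.exists_eq_matrixCoding hq
    obtain ⟨a, b, rfl⟩ := exists_coords hm m'
    have hgiven := isGivenBy_matrixCoding hq (a • m + b • M.1.mulVec m)
    rw [homVec_comb hq] at hgiven
    rw [det_cyclicMat_comb] at hm'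
    exact ⟨(a : ℝ) + b * eigen M,
      ⟨(hq.mem_dirichletGroup_iff _).2 ⟨a, b, isUnit_of_mul_isUnit_left hm', rfl⟩, hgiven⟩,
      fun u hu => eq_of_isGivenBy_smul hq hm hu.2 hgiven⟩

/-! ### Primitivity -/

lemma exists_mem_dirichletGroup_of_commute (hm : IsUnit (cyclicMat M m).det) {K : GL (Fin 2) ℤ}
    (hK : Commute K.1 M.1) :
    ∃ κ ∈ dirichletGroup (discrim M), (realMat K.1).mulVec (homVec M m) = κ • homVec M m := by
  obtain ⟨a, b, hab⟩ := exists_coords hm (K.1.mulVec m)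
  have hcyc := cyclicMat_mulVec M m hK
  have hnorm : quadNorm M.1.trace M.1.det a b = K.1.det := by
    have hdet := det_cyclicMat_comb M m a b
    rw [← hab, hcyc, Matrix.det_mul] at hdet
    exact (mul_right_cancel₀ hm.ne_zero hdet).symm
  refine ⟨a + b * eigen M, (hq.mem_dirichletGroup_iff _).2 ⟨a, b, ?_, rfl⟩, ?_⟩
  · rw [hnorm]
    exact isUnit_det_coe K
  · rw [← homVec_comb hq, ← hab, homVec, homVec, hcyc, realMat_mul, Matrix.mulVec_mulVec]

lemma isPrimitiveMatrix_of_ne (hr : RepresentsUnit M) (hne : ¬ (M.1.trace = 3 ∧ M.1.det = 1)) :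
    IsPrimitiveMatrix M := by
  rintro ⟨K, n, hn, hK⟩
  obtain ⟨m, hm⟩ := (representsUnit_iff M).1 hr
  have hMK : M.1 = K.1 ^ n := by rw [hK, Units.val_pow_eq_pow_val]
  obtain ⟨κ, hκ, heig⟩ :=
    exists_mem_dirichletGroup_of_commute hq hm (hMK ▸ Commute.self_pow K.1 n)
  have hpow : eigen M = κ ^ n := by
    refine sub_eq_zero.1 (eq_zero_of_smul_homVec_eq_intVec hq hm (k := 0) ?_)
    rw [sub_smul, ← mulVec_homVec hq, ← realMat_pow_mulVec heig, hMK, sub_self]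
    funext
    simp [intVec]
  obtain ⟨k, hk⟩ : ∃ k : ℤ, |κ| = eigen M ^ k := by
    obtain ⟨k, hk⟩ := hq.dirichletGroup_eq hne ▸ hκ
    refine ⟨k, ?_⟩
    rw [← abs_of_pos (zpow_pos hq.pos k)]
    exact abs_eq_abs.2 hk
  have hexp : eigen M ^ (1 : ℤ) = eigen M ^ (k * n) := by
    rw [zpow_one, zpow_mul, ← hk, zpow_natCast, ← abs_pow, ← hpow, abs_of_pos hq.pos]
  have hkn : 1 = k * n := zpow_right_injective₀ hq.pos hq.one_lt.ne' hexp
  have hle := Int.le_of_dvd one_pos (Dvd.intro_left k hkn.symm)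
  omega

end

/-! ### Trace `3` and determinant `1` -/

lemma coe_fibMatrix_sq : (fibMatrix ^ 2).1 = !![2, 1; 1, 1] := by
  rw [Units.val_pow_eq_pow_val, show fibMatrix.1 = !![1, 1; 1, 0] from rfl, pow_two]
  simp

section
variable {M : GL (Fin 2) ℤ} (ht : M.1.trace = 3) (hd : M.1.det = 1)
include ht hd

lemma eigen_of_trace_det : eigen M = (3 + √5) / 2 := by
  unfold eigen discrim
  rw [ht, hd]
  norm_num

lemma sqrt_eigen_of_trace_det : √(eigen M) = (1 + √5) / 2 := by
  rw [eigen_of_trace_det ht hd, Real.sqrt_eq_iff_mul_self_eq_of_pos (by positivity)]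
  have h5 : √5 ^ 2 = (5 : ℝ) := Real.sq_sqrt (by norm_num)
  linear_combination h5 / 4

lemma dirichletGroup_of_trace_det : dirichletGroup (discrim M) = signedPowers ((1 + √5) / 2) := by
  rw [← isQuadUnit_goldenRatio.dirichletGroup_eq (by norm_num), discrim, ht, hd]
  norm_num

lemma det_sub_one_of_trace_det : (M.1 - 1).det = -1 := by
  rw [Matrix.trace_fin_two] at ht
  rw [Matrix.det_fin_two] at hd ⊢
  simp only [Matrix.sub_apply, Matrix.one_apply_eq, ne_eq, zero_ne_one, one_ne_zero,
    not_false_eq_true, Matrix.one_apply_ne, sub_zero]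
  linear_combination hd - ht

lemma sub_one_sq_of_trace_det : (M.1 - 1) ^ 2 = M.1 := by
  rw [Matrix.trace_fin_two] at ht
  rw [Matrix.det_fin_two] at hd
  ext i j
  fin_cases i <;> fin_cases j <;> simp [pow_two, Matrix.mul_apply, Fin.sum_univ_two]
  · linear_combination M.1 0 0 * ht - hd
  · linear_combination M.1 0 1 * ht
  · linear_combination M.1 1 0 * ht
  · linear_combination M.1 1 1 * ht - hd

/-- The square root `M - 1` of a matrix `M` with trace `3` and determinant `1`. -/
noncomputable def sqrtMatrix : GL (Fin 2) ℤ :=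
  Matrix.GeneralLinearGroup.mk'' (M.1 - 1) (by simp [det_sub_one_of_trace_det ht hd])

lemma sqrtMatrix_sq : sqrtMatrix ht hd ^ 2 = M := by
  apply Units.ext
  rw [Units.val_pow_eq_pow_val]
  exact sub_one_sq_of_trace_det ht hd

lemma not_isPrimitiveMatrix_of_trace_det : ¬ IsPrimitiveMatrix M := fun hM =>
  hM ⟨sqrtMatrix ht hd, 2, le_rfl, (sqrtMatrix_sq ht hd).symm⟩

lemma isFibSquare_of_trace_det (hr : RepresentsUnit M) : IsFibSquare M := by
  obtain ⟨m, hm⟩ := (representsUnit_iff M).1 hr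
  -- In the basis `M m - m`, `m` the matrix `M - 1` becomes the Fibonacci matrix.
  set P : Matrix (Fin 2) (Fin 2) ℤ :=
    !![M.1.mulVec m 0 - m 0, m 0; M.1.mulVec m 1 - m 1, m 1] with hP
  have hPdet : IsUnit P.det := by
    have hdet : P.det = -(cyclicMat M m).det := by
      simp only [hP, cyclicMat, Matrix.det_fin_two_of]
      ring
    rw [hdet]
    exact hm.neg
  have hconj : P * !![1, 1; 1, 0] = (M.1 - 1) * P := by
    rw [Matrix.trace_fin_two] at ht
    rw [Matrix.det_fin_two] at hd
    ext i j
    fin_cases i <;> fin_cases j <;>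
      simp [hP, Matrix.mul_apply, Fin.sum_univ_two, Matrix.mulVec, dotProduct]
    · linear_combination (-(M.1 0 0) * m 0 - M.1 0 1 * m 1) * ht + m 0 * hd
    · ring
    · linear_combination (-(M.1 1 0) * m 0 - M.1 1 1 * m 1) * ht + m 1 * hd
    · ring
  exact ⟨sqrtMatrix ht hd, IsConj.symm ⟨toUnits (Matrix.GeneralLinearGroup.mk'' P hPdet),
    Units.ext hconj⟩, (sqrtMatrix_sq ht hd).symm⟩

end

namespace IsFibSquare

variable {M : GL (Fin 2) ℤ} (hM : IsFibSquare M)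
include hM

lemma exists_eq_conj : ∃ C : GL (Fin 2) ℤ, M = C * fibMatrix ^ 2 * C⁻¹ := by
  obtain ⟨K, hK, rfl⟩ := hM
  obtain ⟨C, hC⟩ := isConj_iff.1 hK.symm
  exact ⟨C, by rw [← conj_pow, hC]⟩

lemma trace_eq : M.1.trace = 3 := by
  obtain ⟨C, rfl⟩ := hM.exists_eq_conj
  rw [Units.val_mul, Units.val_mul, Matrix.trace_units_conj, coe_fibMatrix_sq]
  rfl

lemma det_eq : M.1.det = 1 := by
  obtain ⟨C, rfl⟩ := hM.exists_eq_conj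
  rw [Units.val_mul, Units.val_mul, Matrix.det_units_conj, coe_fibMatrix_sq]
  simp

lemma representsUnit : RepresentsUnit M := by
  obtain ⟨C, hC⟩ := hM.exists_eq_conj
  have hMC : M.1 * C.1 = C.1 * !![2, 1; 1, 1] := by
    rw [← coe_fibMatrix_sq, ← Units.val_mul, ← Units.val_mul, hC, inv_mul_cancel_right]
  set m : Fin 2 → ℤ := fun i => C.1 i 0 with hm
  have hMm (i) : M.1.mulVec m i = C.1 i 0 * 2 + C.1 i 1 := by
    simpa [Matrix.mul_apply, Fin.sum_univ_two, Matrix.mulVec, dotProduct] using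
      congrFun (congrFun hMC i) 0
  have hcyc : cyclicMat M m = C.1 * !![1, 2; 0, 1] := by
    unfold cyclicMat
    rw [hMm, hMm]
    ext i j
    fin_cases i <;> fin_cases j <;> simp [hm, Matrix.mul_apply, Fin.sum_univ_two]
  refine (representsUnit_iff M).2 ⟨m, ?_⟩
  rw [hcyc, Matrix.det_mul]
  exact (isUnit_det_coe C).mul (by simp)

end IsFibSquare

end ArithmeticCoding

theorem theorem2p6 (M : GL (Fin 2) ℤ) (hM : IsHyperbolicMatrix M) (htr : 0 < M.1.trace) :
    (AdmitsBAC M ↔ RepresentsUnit M) ∧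
    (AdmitsBAC M → IsPrimitiveMatrix M ∨ IsFibSquare M) ∧
    (IsFibSquare M → ¬ IsPrimitiveMatrix M ∧ AdmitsBAC M) ∧
    (RepresentsUnit M → IsPrimitiveMatrix M →
      dirichletGroup (discrim M) = signedPowers (eigen M) ∧
      ∃ v : Fin 2 → ℝ, IsHomoclinicCoord M v ∧
        ParametrizesBACs M (signedPowers (eigen M)) v) ∧
    (RepresentsUnit M → ¬ IsPrimitiveMatrix M →
      eigen M = (3 + √5) / 2 ∧ √(eigen M) = (1 + √5) / 2 ∧
      dirichletGroup (discrim M) = signedPowers ((1 + √5) / 2) ∧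
      ∃ v : Fin 2 → ℝ, IsHomoclinicCoord M v ∧
        ParametrizesBACs M (signedPowers ((1 + √5) / 2)) v) := by
  have hq := hM.isQuadUnit htr
  have hadm := admitsBAC_iff hq
  refine ⟨hadm, fun h => ?_, fun h => ?_, fun hr hp => ?_, fun hr hp => ?_⟩
  · by_cases h3 : M.1.trace = 3 ∧ M.1.det = 1
    · exact Or.inr (isFibSquare_of_trace_det h3.1 h3.2 (hadm.1 h))
    · exact Or.inl (isPrimitiveMatrix_of_ne hq (hadm.1 h) h3)
  · exact ⟨not_isPrimitiveMatrix_of_trace_det h.trace_eq h.det_eq, hadm.2 h.representsUnit⟩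
  · obtain ⟨m, hm⟩ := (representsUnit_iff M).1 hr
    have hD : dirichletGroup (discrim M) = signedPowers (eigen M) :=
      hq.dirichletGroup_eq fun h3 => not_isPrimitiveMatrix_of_trace_det h3.1 h3.2 hp
    exact ⟨hD, homVec M m, isHomoclinicCoord_homVec hq m, hD ▸ parametrizesBACs hq hm⟩
  · obtain ⟨m, hm⟩ := (representsUnit_iff M).1 hr
    obtain ⟨ht, hd⟩ : M.1.trace = 3 ∧ M.1.det = 1 := by
      by_contra h3
      exact hp (isPrimitiveMatrix_of_ne hq hr h3)
    have hD := dirichletGroup_of_trace_det ht hd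
    exact ⟨eigen_of_trace_det ht hd, sqrt_eigen_of_trace_det ht hd, hD, homVec M m,
      isHomoclinicCoord_homVec hq m, hD ▸ parametrizesBACs hq hm⟩
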